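/- Let $n\ge 1$ and let $\varphi:\mathbb R^n\to\mathbb R\cup\{+\infty\}$ be convex with $0<\int_{\mathbb R^n}e^{-\varphi(x)}\,dx<+\infty$. Write $\mathrm{dom}(\varphi)=\{\varphi<+\infty\}$, let $\mu_\varphi$ be the measure with density $e^{-\varphi}$ with respect to Lebesgue measure, and let $\mathcal L\varphi(y)=\sup_{x\in\mathbb R^n}(\langle x,y\rangle-\varphi(x))$. Let $A\subset\mathbb R^n$ be a Borel set with $\mu_\varphi(A)>0$ whose topological boundary $\partial A$ is a hypersurface (possibly with singularities, possibly empty), in the following sense: the points of $\partial A$ near which $\partial A$ is the graph of a Lipschitz function over a hyperplane are dense in $\partial A$ and have full $(n-1)$-dimensional Hausdorff measure in $\partial A$. Assume that the exterior unit normal $n_A$ exists almost everywhere on $\partial A$; here $\nu$, $|\nu|=1$, is the exterior unit normal at $y$ if for every $\varepsilon>0$ all points $z\neq y$ close enough to $y$ satisfy: $z\in A$ if $\langle z-y,\nu\rangle\le-\varepsilon|z-y|$, and $z\notin A$ if $\langle z-y,\nu\rangle\ge\varepsilon|z-y|$. Assume that the integrals (with respect to the $(n-1)$-dimensional Hausdorff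 measure, normalized to be Lebesgue measure on hyperplanes) $$V_{\partial A}(\varphi)=\int_{\partial A}n_A(y)e^{-\varphi(y)}\,dy,\qquad Q_{\partial A}(\varphi)=\int_{\partial A}\langle y,n_A(y)\rangle e^{-\varphi(y)}\,dy$$ converge absolutely. Then $\varphi$ is $\mu_\varphi$-integrable on $A$, and for every $x\in\mathbb R^n$ $$\Big\langle x,-\frac{V_{\partial A}(\varphi)}{\mu_\varphi(A)}\Big\rangle-\varphi(x)\le n-\int_A\varphi(y)\frac{d\mu_\varphi(y)}{\mu_\varphi(A)}-\frac{Q_{\partial A}(\varphi)}{\mu_\varphi(A)},\qquad(*)$$ i.e. $$\mathcal L\varphi\Big(-\frac{V_{\partial A}(\varphi)}{\mu_\varphi(A)}\Big)\le n-\int_A\varphi(y)\frac{d\mu_\varphi(y)}{\mu_\varphi(A)}-\frac{Q_{\partial A}(\varphi)}{\mu_\varphi(A)}.$$ Moreover, if equality holds in $(*)$ for $x=x_0$, then $x_0\in\mathrm{dom}(\varphi)$, and $\varphi$ is affine on $[x_0,z]$ for every $z\in A\cap\mathrm{dom}(\varphi)$ at which $\varphi$ is lower semicontinuous and such that either $z$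 is interior to $\mathrm{dom}(\varphi)$, or some open segment with endpoint $z$ is contained in $\mathrm{int}(A)\cap\mathrm{int}(\mathrm{dom}(\varphi))$. (Lower semicontinuity holds at every $z$ if $\varphi$ is lower semicontinuous, and at every $z$ interior to $\mathrm{dom}(\varphi)$; the second alternative holds for every $z\in A\cap\mathrm{dom}(\varphi)$ if $A$ is convex, and for every $z\in\mathrm{int}(A)\cap\mathrm{dom}(\varphi)$ in general.) -/

import Mathlib

open MeasureTheory Set
open scoped RealInnerProductSpace

noncomputable section

namespace FunctionalMahler

/-- Euclidean space `ℝⁿ`. -/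
abbrev Rn (n : ℕ) : Type := EuclideanSpace ℝ (Fin n)

/-- Convexity of `φ : ℝⁿ → ℝ ∪ {+∞}`, that is of an extended-real-valued function which never takes
the value `-∞`. -/
structure IsConvexFun {n : ℕ} (φ : Rn n → EReal) : Prop where
  ne_bot : ∀ x, φ x ≠ ⊥
  le_combo : ∀ x y : Rn n, ∀ a b : ℝ, 0 ≤ a → 0 ≤ b → a + b = 1 →
    φ (a • x + b • y) ≤ (a : EReal) * φ x + (b : EReal) * φ y

/-- The domain `{φ < +∞}` of `φ`. -/
def dom {n : ℕ} (φ : Rn n → EReal) : Set (Rn n) := {x | φ x < ⊤}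

/-- The Legendre transform `y ↦ sup_x (⟨x, y⟩ - φ x)`. -/
def legendre {n : ℕ} (φ : Rn n → EReal) (y : Rn n) : EReal :=
  ⨆ x : Rn n, (((⟪x, y⟫ : ℝ) : EReal) - φ x)

/-- The measure with density `e^{-φ}` with respect to the Lebesgue measure
(with `e^{-∞} = 0`). -/
def expMeasure {n : ℕ} (φ : Rn n → EReal) : Measure (Rn n) :=
  volume.withDensity fun x => EReal.exp (-φ x)

/-- The real number `e^{-φ y}`. -/
def expNeg {n : ℕ} (φ : Rn n → EReal) (y : Rn n) : ℝ := (EReal.exp (-φ y)).toReal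

/-- `φ` is affine on the segment `[x, z]`. -/
def IsAffineOnSegment {n : ℕ} (φ : Rn n → EReal) (x z : Rn n) : Prop :=
  ∀ a b : ℝ, 0 ≤ a → 0 ≤ b → a + b = 1 →
    φ (a • x + b • z) = (a : EReal) * φ x + (b : EReal) * φ z

/-- Near `y`, the set `S` is the graph of a Lipschitz function over a hyperplane `e^⊥`. The point
`z - ⟨e, z⟩ e` is the orthogonal projection of `z` on `e^⊥`. -/
def IsLipschitzGraphAt {n : ℕ} (S : Set (Rn n)) (y : Rn n) : Prop :=
  ∃ U : Set (Rn n), IsOpen U ∧ y ∈ U ∧ ∃ e : Rn n, ‖e‖ = 1 ∧ ∃ (K : NNReal) (g : Rn n → ℝ),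
    LipschitzWith K g ∧ S ∩ U = {z | ⟪e, z⟫ = g (z - ⟪e, z⟫ • e)} ∩ U

/-- The surface measure of `S`: the `(n-1)`-dimensional Hausdorff measure on `ℝⁿ`, normalized so
that it is the Lebesgue measure on hyperplanes, restricted to `S`. -/
def surfaceMeasure {n : ℕ} (S : Set (Rn n)) : Measure (Rn n) :=
  (Measure.euclideanHausdorffMeasure (n - 1)).restrict S

/-- A hypersurface with possible singularities (edges, corners, ...): the points near which it is a
Lipschitz graph have full surface measure, and they are dense in it. -/
structure IsHypersurface {n : ℕ} (S : Set (Rn n)) : Prop where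
  ae_graph : ∀ᵐ y ∂(surfaceMeasure S), IsLipschitzGraphAt S y
  dense_graph : S ⊆ closure {y ∈ S | IsLipschitzGraphAt S y}

/-- `ν` is the exterior unit normal of `A` at `y`: for every `ε > 0`, near `y` the set `A` contains
the cone `⟨z - y, ν⟩ ≤ -ε |z - y|` and misses the cone `⟨z - y, ν⟩ ≥ ε |z - y|`
(the apex `y` itself is disregarded). -/
def IsExteriorNormal {n : ℕ} (A : Set (Rn n)) (y ν : Rn n) : Prop :=
  ‖ν‖ = 1 ∧ ∀ ε : ℝ, 0 < ε → ∃ r : ℝ, 0 < r ∧ ∀ z : Rn n, z ≠ y → ‖z - y‖ < r →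
    (⟪z - y, ν⟫ ≤ -(ε * ‖z - y‖) → z ∈ A) ∧ (ε * ‖z - y‖ ≤ ⟪z - y, ν⟫ → z ∉ A)

/-- There is at most one exterior unit normal at a point. -/
theorem IsExteriorNormal.unique {n : ℕ} {A : Set (Rn n)} {y ν ν' : Rn n}
    (h : IsExteriorNormal A y ν) (h' : IsExteriorNormal A y ν') : ν = ν' := by
  by_contra hne
  obtain ⟨hν, h⟩ := h
  obtain ⟨hν', h'⟩ := h'
  set w := ν - ν' with hw
  have hw0 : w ≠ 0 := sub_ne_zero.mpr hne
  have hwpos : 0 < ‖w‖ := norm_pos_iff.mpr hw0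
  have hsq : ‖w‖ ^ 2 = 2 - 2 * ⟪ν, ν'⟫ := by
    rw [hw, norm_sub_sq_real, hν, hν']; ring
  have h1 : ⟪w, ν⟫ = ‖w‖ ^ 2 / 2 := by
    rw [hsq, hw, inner_sub_left, real_inner_self_eq_norm_sq, hν, real_inner_comm]; ring
  have h2 : ⟪w, ν'⟫ = -(‖w‖ ^ 2 / 2) := by
    rw [hsq, hw, inner_sub_left, real_inner_self_eq_norm_sq, hν']; ring
  obtain ⟨r, hr, H⟩ := h (‖w‖ / 2) (by positivity)
  obtain ⟨r', hr', H'⟩ := h' (‖w‖ / 2) (by positivity)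
  set t := min r r' / (2 * ‖w‖) with ht
  have hm : 0 < min r r' := lt_min hr hr'
  have htpos : 0 < t := by positivity
  have htw : t * ‖w‖ = min r r' / 2 := by rw [ht]; field_simp
  have hz : (y + t • w) - y = t • w := by simp
  have hnorm : ‖t • w‖ = t * ‖w‖ := by rw [norm_smul, Real.norm_of_nonneg htpos.le]
  have hzne : y + t • w ≠ y := by
    intro hc
    have : t • w = 0 := by simpa using hc
    rcases smul_eq_zero.mp this with h0 | h0
    · exact htpos.ne' h0
    · exact hw0 h0
  have hlt : ‖(y + t • w) - y‖ < min r r' := by rw [hz, hnorm, htw]; linarith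
  have A1 := (H _ hzne (hlt.trans_le (min_le_left _ _))).2
  have A2 := (H' _ hzne (hlt.trans_le (min_le_right _ _))).1
  rw [hz, hnorm, real_inner_smul_left] at A1 A2
  refine A1 ?_ (A2 ?_)
  · rw [h1]; exact le_of_eq (by ring)
  · rw [h2]; exact le_of_eq (by ring)

open Classical in
/-- The exterior unit normal `n_A` (zero where there is none). -/
def exteriorNormal {n : ℕ} (A : Set (Rn n)) (y : Rn n) : Rn n :=
  if h : ∃ ν, IsExteriorNormal A y ν then h.choose else 0

/-- `V_{∂A}(φ) = ∫_{∂A} n_A(y) e^{-φ(y)} dy`. -/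
def boundaryV {n : ℕ} (φ : Rn n → EReal) (A : Set (Rn n)) : Rn n :=
  ∫ y, expNeg φ y • exteriorNormal A y ∂(surfaceMeasure (frontier A))

/-- `Q_{∂A}(φ) = ∫_{∂A} ⟨y, n_A(y)⟩ e^{-φ(y)} dy`. -/
def boundaryQ {n : ℕ} (φ : Rn n → EReal) (A : Set (Rn n)) : ℝ :=
  ∫ y, ⟪y, exteriorNormal A y⟫ * expNeg φ y ∂(surfaceMeasure (frontier A))

/-- The right-hand side
`n - ∫_A φ dμ_φ / μ_φ(A) - Q_{∂A}(φ) / μ_φ(A)`. On `{φ = +∞}`, which is `μ_φ`-null, the value of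
`φ` in the integral is immaterial. -/
def upperBound {n : ℕ} (φ : Rn n → EReal) (A : Set (Rn n)) : ℝ :=
  n - (∫ y in A, (φ y).toReal ∂(expMeasure φ)) / (expMeasure φ).real A
    - boundaryQ φ A / (expMeasure φ).real A

/-- The vector `-V_{∂A}(φ) / μ_φ(A)`. -/
def slope {n : ℕ} (φ : Rn n → EReal) (A : Set (Rn n)) : Rn n :=
  -(((expMeasure φ).real A)⁻¹ • boundaryV φ A)

end FunctionalMahler

end

/-! Fix `x` in the domain and look at `A` along the rays `x + r θ`, `r > 0`. On a ray `f(r) = φ(x +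
r θ)` is convex, so `r f'(r) ≥ f(r) - f(0)` and the derivative of `r ^ n e^{-f}` is at most `r ^ (n
- 1) e^{-f} (n + f(0) - f(r))` (`rayFlux_deriv_le`). Integrating over the part of the ray inside
`A`, the sum of `r ^ n e^{-f}` over the exits from `A` minus the sum over the entries is at most the
integral of that bound (`IsRay.tsum_rayJump_add_le`).

Now integrate over all directions `θ`. By polar coordinates the right-hand side becomes `∫_A
e^{-φ(y)} (n + φ(x) - φ(y)) dy`. By the area formula for the radial projection
(`HasNormal.lintegral_raySum`) the left-hand side becomes `∫_{∂A} ⟨n_A(y), y - x⟩ e^{-φ(y)} dy = Q -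
⟨x, V⟩`. Division by `μ_φ(A)` gives the inequality. No divergence theorem in dimension `n` is
needed: absolute convergence of `V` and `Q` makes the boundary sums converge on almost every ray,
hence the crossings are locally finite there.

The area formula comes from computing the volume of a thin frustum `{(1 + s) y : y ∈ B, 0 ≤ s ≤ τ}`
twice: exactly in polar coordinates, and up to a small error by a linear approximation over an
almost flat piece `B`, which gives `τ |⟨ν, y⟩|` times the surface measure. Tangential directions and
exceptional null sets are met by almost no ray, since the cones over them have volume zero.

Equality in the integrated inequality forces equality on almost every ray. Then at each `r` interior
to `A` and to the domain the supporting line of `f` passes through `(0, f(0))`, so `f` is affine on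
`[0, r]` (`IsRay.affine_of_tsum_eq`). Continuity inside the domain and lower semicontinuity at its
boundary carry this to the points `z` of the statement (`isAffineOnSegment_of_ae`). Points of `A` on
`∂A` are reached because the density of graph points gives `∂A ⊆ closure (interior A)`
(`frontier_subset_closure_interior`). -/

namespace FunctionalMahler

set_option linter.unusedSectionVars false

open Module Filter Topology
open scoped NNReal ENNReal Pointwise

/-! ### Volumes of thin frusta over almost flat sets. -/

section Cone

variable {E : Type*} [NormedAddCommGroup E] [InnerProductSpace ℝ E] [FiniteDimensional ℝ E]
  [MeasurableSpace E] [BorelSpace E]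

/-- The volume of a cylinder over a subset of a hyperplane. -/
theorem volume_slab {ν : E} (hν : ‖ν‖ = 1) {D : Set E} (hD : ∀ d ∈ D, ⟪ν, d⟫ = 0) (τ : ℝ) :
    volume {p : E | ∃ d ∈ D, ∃ s ∈ Icc 0 τ, p = d + s • ν} =
      ENNReal.ofReal τ * μHE[finrank ℝ E - 1] D := by
  set S : Submodule ℝ E := ℝ ∙ ν with hS
  have hν0 : ν ≠ 0 := by rintro rfl; simp at hν
  have hrank : finrank ℝ Sᗮ = finrank ℝ E - 1 := by
    have := S.finrank_add_finrank_orthogonal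
    have h1 : finrank ℝ S = 1 := finrank_span_singleton hν0
    omega
  have hmp := S.measurePreserving_measurableEquivProd (0 : E)
  rw [InnerProductSpace.euclideanHausdorffMeasure_eq_volume] at hmp
  let e := LinearIsometryEquiv.toSpanUnitSingleton (𝕜 := ℝ) ν hν
  have he : ∀ r : ℝ, ((e r : S) : E) = r • ν := fun r => by simp [e]
  have hset : {p : E | ∃ d ∈ D, ∃ s ∈ Icc 0 τ, p = d + s • ν} =
      S.measurableEquivProd (0 : E) ⁻¹' ((e.symm ⁻¹' Icc 0 τ) ×ˢ ((↑) ⁻¹' D : Set Sᗮ)) := by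
    ext p
    constructor
    · rintro ⟨d, hd, s, hs, rfl⟩
      have hd' : d ∈ Sᗮ := by
        rw [hS, Submodule.mem_orthogonal_singleton_iff_inner_right]; exact hD d hd
      have h1 : S.measurableEquivProd (0 : E) (d + s • ν) = (e s, ⟨d, hd'⟩) := by
        apply (S.measurableEquivProd (0 : E)).symm.injective
        rw [MeasurableEquiv.symm_apply_apply, Submodule.measurableEquivProd_symm_apply]
        simp [he, add_comm]
      rw [mem_preimage, h1]
      simp only [mem_prod, mem_preimage, LinearIsometryEquiv.symm_apply_apply]
      exact ⟨hs, hd⟩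
    · intro hp
      set q := S.measurableEquivProd (0 : E) p with hq
      obtain ⟨h1, h2⟩ := hp
      refine ⟨q.2, h2, e.symm q.1, h1, ?_⟩
      have : p = (S.measurableEquivProd (0 : E)).symm q := by simp [hq]
      rw [this, Submodule.measurableEquivProd_symm_apply]
      have h3 : (q.1 : E) = (e.symm q.1 : ℝ) • ν :=
        (congrArg Subtype.val (e.apply_symm_apply q.1)).symm.trans (he _)
      rw [← h3]; simp [add_comm]
  rw [hset, hmp.measure_preimage_equiv, Measure.volume_eq_prod, Measure.prod_prod,
    e.symm.measurePreserving.measure_preimage_emb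
      e.symm.toHomeomorph.measurableEmbedding, Real.volume_Icc, sub_zero]
  congr 1
  rw [← InnerProductSpace.euclideanHausdorffMeasure_eq_volume, hrank,
    ← (isometry_subtype_coe (s := (Sᗮ : Set E))).euclideanHausdorffMeasure_image]
  congr 1
  refine image_preimage_eq_of_subset fun d hd => ⟨⟨d, ?_⟩, rfl⟩
  rw [SetLike.mem_coe, hS, Submodule.mem_orthogonal_singleton_iff_inner_right]
  exact hD d hd

/-- The part of the cone over `B` lying between `B` and `(1 + τ) B`. -/
def frustum (τ : ℝ) (B : Set E) : Set E := (fun p : E × ℝ => (1 + p.2) • p.1) '' (B ×ˢ Icc 0 τ)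

theorem LipschitzOnWith.euclideanHausdorffMeasure_image_le {K : ℝ≥0} {f : E → E} {s : Set E}
    (h : LipschitzOnWith K f s) (d : ℕ) : μHE[d] (f '' s) ≤ (K : ℝ≥0∞) ^ d * μHE[d] s := by
  simp_rw [Measure.euclideanHausdorffMeasure_def, Measure.smul_apply, ENNReal.smul_def, smul_eq_mul]
  have := h.hausdorffMeasure_image_le (d := d) (by positivity)
  rw [ENNReal.rpow_natCast] at this
  calc _ ≤ _ * (_ * _) := mul_le_mul_right this _
    _ = _ := by ring

/-- The orthogonal projection along `ν`. -/
def projAlong (ν y : E) : E := y - ⟪ν, y⟫ • ν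

theorem projAlong_sub (ν y z : E) : projAlong ν y - projAlong ν z = projAlong ν (y - z) := by
  simp only [projAlong, inner_sub_right, sub_smul]; abel

theorem inner_projAlong {ν : E} (hν : ‖ν‖ = 1) (y : E) : ⟪ν, projAlong ν y⟫ = 0 := by
  simp [projAlong, inner_sub_right, real_inner_smul_right, hν]

theorem norm_projAlong_le {ν : E} (hν : ‖ν‖ = 1) (y : E) : ‖projAlong ν y‖ ≤ ‖y‖ := by
  have h : ‖y‖ ^ 2 = ‖projAlong ν y‖ ^ 2 + ⟪ν, y⟫ ^ 2 := by
    have h1 : y = projAlong ν y + ⟪ν, y⟫ • ν := by simp [projAlong]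
    have h2 : ⟪projAlong ν y, ν⟫ = 0 := by rw [real_inner_comm]; exact inner_projAlong hν y
    conv_lhs => rw [h1]
    rw [norm_add_sq_real, real_inner_smul_right, h2, norm_smul, hν]
    simp
  exact le_of_sq_le_sq (by nlinarith [sq_nonneg ⟪ν, y⟫]) (norm_nonneg _)

/-- The triangle inequality gives `‖y‖ ≤ ‖projAlong ν y‖ + δ ‖y‖`. Applied to differences of points
of a flat set, this makes the projection along `ν` bi-Lipschitz on it, with constants tending to `1`
as `δ → 0`. -/
theorem norm_le_of_flat {ν y : E} (hν : ‖ν‖ = 1) {δ : ℝ} (hδ : δ < 1)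
    (h : |⟪ν, y⟫| ≤ δ * ‖y‖) : ‖y‖ ≤ (1 - δ)⁻¹ * ‖projAlong ν y‖ := by
  have h1 : ‖y‖ ≤ ‖projAlong ν y‖ + |⟪ν, y⟫| := by
    have : y = projAlong ν y + ⟪ν, y⟫ • ν := by simp [projAlong]
    calc ‖y‖ = ‖projAlong ν y + ⟪ν, y⟫ • ν‖ := by rw [← this]
      _ ≤ _ := norm_add_le _ _
      _ = _ := by rw [norm_smul, hν]; simp
  have : 0 < 1 - δ := by linarith
  rw [inv_mul_eq_div, le_div_iff₀ this]
  nlinarith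

/-- `B` is `δ`-flat with respect to the normal `ν`. -/
def IsFlat (δ : ℝ) (ν : E) (B : Set E) : Prop := ∀ y ∈ B, ∀ z ∈ B, |⟪ν, z - y⟫| ≤ δ * ‖z - y‖

theorem IsFlat.mono {δ δ' : ℝ} {ν : E} {B B' : Set E} (h : IsFlat δ ν B) (hδ : δ ≤ δ')
    (hB : B' ⊆ B) : IsFlat δ' ν B' := fun y hy z hz =>
  (h y (hB hy) z (hB hz)).trans (by gcongr)

theorem IsFlat.injOn_projAlong {δ : ℝ} {ν : E} {B : Set E} (h : IsFlat δ ν B) (hν : ‖ν‖ = 1)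
    (hδ : δ < 1) : InjOn (projAlong ν) B := by
  intro y hy z hz hyz
  have := norm_le_of_flat hν hδ (h y hy z hz)
  rw [← projAlong_sub, hyz, sub_self, norm_zero, mul_zero] at this
  exact (sub_eq_zero.mp (norm_le_zero_iff.mp this)).symm

theorem euclideanHausdorffMeasure_projAlong_image_le {ν : E} (B : Set E) (hν : ‖ν‖ = 1) (d : ℕ) :
    μHE[d] (projAlong ν '' B) ≤ μHE[d] B := by
  have : LipschitzOnWith 1 (projAlong ν) B := by
    refine LipschitzOnWith.of_dist_le_mul fun x _ y _ => ?_
    rw [dist_eq_norm, dist_eq_norm, projAlong_sub]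
    simpa using norm_projAlong_le hν _
  simpa using LipschitzOnWith.euclideanHausdorffMeasure_image_le this d

/-- On a flat set the projection has a `(1 - δ)⁻¹`-Lipschitz inverse, so it shrinks `d`-dimensional
measure by a factor of at least `(1 - δ) ^ d`. -/
theorem IsFlat.le_hausdorff_projAlong {δ : ℝ} {ν : E} {B : Set E} (h : IsFlat δ ν B)
    (hν : ‖ν‖ = 1) (hδ : δ < 1) (d : ℕ) :
    ENNReal.ofReal ((1 - δ) ^ d) * μHE[d] B ≤ μHE[d] (projAlong ν '' B) := by
  have h1 : 0 < 1 - δ := by linarith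
  set γ := Function.invFunOn (projAlong ν) B
  have hγ : ∀ y ∈ B, γ (projAlong ν y) = y := fun y hy =>
    (h.injOn_projAlong hν hδ).leftInvOn_invFunOn hy
  have hL : LipschitzOnWith (Real.toNNReal (1 - δ)⁻¹) γ (projAlong ν '' B) := by
    refine LipschitzOnWith.of_dist_le_mul ?_
    rintro _ ⟨y, hy, rfl⟩ _ ⟨z, hz, rfl⟩
    rw [hγ y hy, hγ z hz, dist_eq_norm, dist_eq_norm, projAlong_sub,
      Real.coe_toNNReal _ (by positivity)]
    exact norm_le_of_flat hν hδ (h z hz y hy)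
  have h2 := LipschitzOnWith.euclideanHausdorffMeasure_image_le hL d
  have h3 : γ '' (projAlong ν '' B) = B := by
    rw [image_image]
    exact (image_congr hγ).trans (image_id' B)
  rw [h3] at h2
  calc ENNReal.ofReal ((1 - δ) ^ d) * μHE[d] B
      ≤ ENNReal.ofReal ((1 - δ) ^ d) * (((1 - δ)⁻¹.toNNReal : ℝ≥0∞) ^ d * μHE[d] (projAlong ν '' B)) :=
        mul_le_mul_right h2 _
    _ = μHE[d] (projAlong ν '' B) := by
      rw [← mul_assoc]
      change _ * (ENNReal.ofReal _) ^ d * _ = _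
      rw [← ENNReal.ofReal_pow (by positivity), ← ENNReal.ofReal_mul (by positivity), ← mul_pow,
        mul_inv_cancel₀ h1.ne', one_pow, ENNReal.ofReal_one, one_mul]

/-- The linear map which sends `ν` to `y₀` and is the identity on the hyperplane `ν^⊥`. -/
noncomputable def shearTo (ν y₀ : E) : E →L[ℝ] E :=
  LinearMap.toContinuousLinearMap (LinearMap.transvection (innerₛₗ ℝ ν) (y₀ - ν))

theorem shearTo_apply (ν y₀ p : E) : shearTo ν y₀ p = p + ⟪ν, p⟫ • (y₀ - ν) := by
  simp [shearTo, LinearMap.transvection]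

/-- This determinant, the height of `y₀` over the hyperplane `ν^⊥`, is the source of the density
`|⟨ν, y⟩|` in the area formula. -/
theorem det_shearTo {ν : E} (hν : ‖ν‖ = 1) (y₀ : E) : (shearTo ν y₀).det = ⟪ν, y₀⟫ := by
  rw [ContinuousLinearMap.det, shearTo, LinearMap.coe_toContinuousLinearMap,
    LinearMap.transvection.det]
  simp [inner_sub_right, hν]

/-- The map from the cylinder over the projection of `B` onto the frustum over `B`. -/
theorem exists_frustum_param {δ : ℝ} {ν : E} {B : Set E} (h : IsFlat δ ν B) (hν : ‖ν‖ = 1)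
    (hδ : δ < 1) : ∃ f : E → E, ∀ y ∈ B, ∀ s : ℝ, f (projAlong ν y + s • ν) = (1 + s) • y := by
  -- Lift the projection of `p` back to `B`, then dilate by `1` plus the height of `p`.
  refine ⟨fun p => (1 + ⟪ν, p⟫) • Function.invFunOn (projAlong ν) B (projAlong ν p), ?_⟩
  intro y hy s
  have h1 : ⟪ν, projAlong ν y + s • ν⟫ = s := by
    rw [inner_add_right, inner_projAlong hν, real_inner_smul_right, real_inner_self_eq_norm_sq, hν]
    simp
  have h2 : projAlong ν (projAlong ν y + s • ν) = projAlong ν y := by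
    conv_lhs => rw [projAlong, h1]
    simp
  simp only [h1, h2]
  rw [(h.injOn_projAlong hν hδ).leftInvOn_invFunOn hy]

/-- Along `ν` the parametrization moves with velocity `y ≈ y₀`; along the base it inverts the
projection of a flat set, hence is nearly the identity. The linear model is therefore `shearTo ν
y₀`. -/
theorem approximatesLinearOn_frustum_param {δ τ : ℝ} {ν y₀ : E} {B : Set E} (h : IsFlat δ ν B)
    (hν : ‖ν‖ = 1) (hδ : δ ≤ 1 / 2) (hB : B ⊆ Metric.ball y₀ δ) (hτ : τ ≤ δ)
    {f : E → E} (hf : ∀ y ∈ B, ∀ s : ℝ, f (projAlong ν y + s • ν) = (1 + s) • y) (hδ0 : 0 ≤ δ) :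
    ApproximatesLinearOn f (shearTo ν y₀)
      {p : E | ∃ d ∈ projAlong ν '' B, ∃ s ∈ Icc 0 τ, p = d + s • ν} (Real.toNNReal (5 * δ)) := by
  rintro _ ⟨_, ⟨y, hy, rfl⟩, s, hs, rfl⟩ _ ⟨_, ⟨z, hz, rfl⟩, t, ht, rfl⟩
  rw [hf y hy, hf z hz, shearTo_apply, Real.coe_toNNReal _ (by positivity)]
  set p := projAlong ν y + s • ν - (projAlong ν z + t • ν) with hp
  have hp' : p = projAlong ν (y - z) + (s - t) • ν := by
    rw [hp, ← projAlong_sub, sub_smul]; abel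
  have h1 : ⟪ν, p⟫ = s - t := by
    rw [hp', inner_add_right, inner_projAlong hν, real_inner_smul_right, real_inner_self_eq_norm_sq,
      hν]
    simp
  have h2 : projAlong ν p = projAlong ν (y - z) := by
    conv_lhs => rw [projAlong, h1, hp']
    simp
  have h3 : ‖projAlong ν (y - z)‖ ≤ ‖p‖ := h2 ▸ norm_projAlong_le hν p
  have h4 : |s - t| ≤ ‖p‖ := by
    rw [← h1]; simpa [hν] using abs_real_inner_le_norm ν p
  have h5 : ‖y - z‖ ≤ 2 * ‖p‖ := by
    refine (norm_le_of_flat hν (by linarith : δ < 1) (h z hz y hy)).trans ?_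
    gcongr
    exact inv_le_of_inv_le₀ (by norm_num) (by linarith)
  -- The three errors come from the thickness `s ≤ δ`, the flatness of `B`, and the distance from
  -- `z` to `y₀`; they contribute `2 δ + 2 δ + δ`.
  have key : (1 + s) • y - (1 + t) • z - (p + ⟪ν, p⟫ • (y₀ - ν)) =
      s • (y - z) + ⟪ν, y - z⟫ • ν + (s - t) • (z - y₀) := by
    rw [h1, hp', projAlong]
    module
  rw [key]
  have h6 : ‖z - y₀‖ ≤ δ := by
    have := hB hz
    rw [Metric.mem_ball, dist_eq_norm] at this
    exact this.le
  have h7 : |s| ≤ δ := by rw [abs_of_nonneg hs.1]; exact hs.2.trans hτ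
  calc _ ≤ ‖s • (y - z)‖ + ‖⟪ν, y - z⟫ • ν‖ + ‖(s - t) • (z - y₀)‖ := norm_add₃_le
    _ = |s| * ‖y - z‖ + |⟪ν, y - z⟫| + |s - t| * ‖z - y₀‖ := by
      simp only [norm_smul, hν, Real.norm_eq_abs, mul_one]
    _ ≤ δ * (2 * ‖p‖) + δ * (2 * ‖p‖) + ‖p‖ * δ := by
      have h8 := (h z hz y hy).trans (mul_le_mul_of_nonneg_left h5 hδ0)
      gcongr
    _ = 5 * δ * ‖p‖ := by ring

theorem image_frustum_param {τ : ℝ} {ν : E} {B : Set E} {f : E → E}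
    (hf : ∀ y ∈ B, ∀ s : ℝ, f (projAlong ν y + s • ν) = (1 + s) • y) :
    f '' {p : E | ∃ d ∈ projAlong ν '' B, ∃ s ∈ Icc 0 τ, p = d + s • ν} = frustum τ B := by
  ext q
  constructor
  · rintro ⟨_, ⟨_, ⟨y, hy, rfl⟩, s, hs, rfl⟩, rfl⟩
    exact ⟨(y, s), ⟨hy, hs⟩, (hf y hy s).symm⟩
  · rintro ⟨⟨y, s⟩, ⟨hy, hs⟩, rfl⟩
    exact ⟨_, ⟨_, ⟨y, hy, rfl⟩, s, hs, rfl⟩, hf y hy s⟩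

/-- The volume of a thin frustum over a small flat set. -/
theorem exists_volume_frustum_estimate {ν : E} (hν : ‖ν‖ = 1) (y₀ : E) {η : ℝ} (hη : 0 < η) :
    ∃ δ : ℝ, 0 < δ ∧ ∀ B : Set E, B ⊆ Metric.ball y₀ δ → IsFlat δ ν B → ∀ τ, 0 < τ → τ ≤ δ →
      volume (frustum τ B) ≤
        ENNReal.ofReal ((|⟪ν, y₀⟫| + η) * τ) * μHE[finrank ℝ E - 1] B ∧
      ENNReal.ofReal ((|⟪ν, y₀⟫| - η) * τ) * μHE[finrank ℝ E - 1] B ≤ volume (frustum τ B) := by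
  set a := |⟪ν, y₀⟫| with ha
  have ha0 : 0 ≤ a := abs_nonneg _
  set m := finrank ℝ E - 1
  have hu := addHaar_image_le_mul_of_det_lt (volume : Measure E) (shearTo ν y₀)
    (m := Real.toNNReal (a + η)) (by
      rw [det_shearTo hν, ← ha]
      exact (ENNReal.ofReal_lt_ofReal_iff (by positivity)).2 (by linarith))
  have hl : ∀ᶠ δ in 𝓝[>] (0 : ℝ≥0), ∀ (s : Set E) (f : E → E),
      ApproximatesLinearOn f (shearTo ν y₀) s δ →
      ENNReal.ofReal (a - η / 2) * volume s ≤ volume (f '' s) := by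
    -- If `a ≤ η / 2` the lower bound is trivial, since `ENNReal.ofReal` truncates at `0`; the
    -- determinant estimate needs a positive determinant only otherwise.
    rcases le_or_gt (a - η / 2) 0 with h | h
    · refine Eventually.of_forall fun δ s f _ => ?_
      rw [ENNReal.ofReal_of_nonpos h, zero_mul]; exact zero_le
    · exact mul_le_addHaar_image_of_lt_det (volume : Measure E) (shearTo ν y₀)
        (m := Real.toNNReal (a - η / 2)) (by
          rw [det_shearTo hν, ← ha]
          exact (ENNReal.ofReal_lt_ofReal_iff (by linarith)).2 (by linarith))
  have htend : Tendsto (fun δ : ℝ => Real.toNNReal (5 * δ)) (𝓝[>] 0) (𝓝[>] 0) := by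
    refine tendsto_nhdsWithin_iff.2 ⟨?_, ?_⟩
    · have : Continuous fun δ : ℝ => Real.toNNReal (5 * δ) := by fun_prop
      have h0 := this.tendsto 0
      simp only [mul_zero, Real.toNNReal_zero] at h0
      exact h0.mono_left nhdsWithin_le_nhds
    · filter_upwards [self_mem_nhdsWithin] with δ hδ
      simp only [mem_Ioi, Real.toNNReal_pos] at hδ ⊢
      linarith
  -- One half of `η` pays for the determinant; the other half absorbs the factor `(1 - δ) ^ m` lost
  -- by projecting `B`.
  have hc : ∀ᶠ δ : ℝ in 𝓝[>] 0, a - η ≤ (a - η / 2) * (1 - δ) ^ m := by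
    have : Continuous fun δ : ℝ => (a - η / 2) * (1 - δ) ^ m := by fun_prop
    have h0 := this.tendsto 0
    simp only [sub_zero, one_pow, mul_one] at h0
    have := h0.eventually (lt_mem_nhds (show a - η < a - η / 2 by linarith))
    exact (this.filter_mono nhdsWithin_le_nhds).mono fun δ h => h.le
  have hs : ∀ᶠ δ : ℝ in 𝓝[>] 0, δ < 1 / 2 :=
    (gt_mem_nhds (by norm_num : (0 : ℝ) < 1 / 2)).filter_mono nhdsWithin_le_nhds
  obtain ⟨δ, h1, h2, h3, h4, h5⟩ := ((htend.eventually hu).and ((htend.eventually hl).and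
    (hc.and (hs.and self_mem_nhdsWithin)))).exists
  have hδ0 : 0 < δ := h5
  refine ⟨δ, hδ0, fun B hB hflat τ hτ0 hτ => ?_⟩
  obtain ⟨f, hf⟩ := exists_frustum_param hflat hν (by linarith)
  have happ := approximatesLinearOn_frustum_param hflat hν h4.le hB hτ hf hδ0.le
  have hslab := volume_slab hν (D := projAlong ν '' B)
    (by rintro _ ⟨y, _, rfl⟩; exact inner_projAlong hν y) τ
  have hup := h1 _ f happ
  have hlow := h2 _ f happ
  rw [image_frustum_param hf, hslab] at hup hlow
  constructor
  · refine hup.trans ?_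
    change ENNReal.ofReal (a + η) * _ ≤ _
    rw [← mul_assoc, ← ENNReal.ofReal_mul (by positivity)]
    exact mul_le_mul_right (euclideanHausdorffMeasure_projAlong_image_le B hν m) _
  · refine le_trans ?_ hlow
    rw [← mul_assoc]
    rcases le_or_gt (a - η) 0 with h | h
    · rw [ENNReal.ofReal_of_nonpos (by nlinarith), zero_mul]; exact zero_le
    · rw [← ENNReal.ofReal_mul (by linarith)]
      calc _ ≤ ENNReal.ofReal ((a - η / 2) * τ) * (ENNReal.ofReal ((1 - δ) ^ m) * μHE[m] B) := by
            rw [← mul_assoc, ← ENNReal.ofReal_mul (by nlinarith)]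
            gcongr ENNReal.ofReal ?_ * _
            nlinarith
        _ ≤ _ := by
          exact mul_le_mul_right (hflat.le_hausdorff_projAlong hν (by linarith) m) _

end Cone

/-! ### Polar coordinates, cones, and sums along rays. -/

section Polar

open Metric

variable {E : Type*} [NormedAddCommGroup E] [InnerProductSpace ℝ E] [FiniteDimensional ℝ E]
  [MeasurableSpace E] [BorelSpace E] [Nontrivial E]

theorem lintegral_volumeIoiPow {k : ℕ} (g : ℝ → ℝ≥0∞) (hg : Measurable g) :
    ∫⁻ r : Ioi (0 : ℝ), g r ∂(Measure.volumeIoiPow k) =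
      ∫⁻ r in Ioi (0 : ℝ), ENNReal.ofReal (r ^ k) * g r := by
  rw [Measure.volumeIoiPow, lintegral_withDensity_eq_lintegral_mul _ (by fun_prop) (by fun_prop),
    ← lintegral_subtype_comap measurableSet_Ioi]
  rfl

theorem lintegral_polar_aux (G : E → ℝ≥0∞) :
    ∫⁻ y, G y = ∫⁻ p : sphere (0 : E) 1 × Ioi (0 : ℝ), G ((p.2 : ℝ) • (p.1 : E))
      ∂((volume : Measure E).toSphere.prod (Measure.volumeIoiPow (finrank ℝ E - 1))) := by
  have h := ((volume : Measure E).measurePreserving_homeomorphUnitSphereProd).symm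
    (e := (homeomorphUnitSphereProd E).toMeasurableEquiv)
  conv_lhs => rw [← restrict_compl_singleton (μ := (volume : Measure E)) 0]
  rw [← lintegral_subtype_comap (measurableSet_singleton _).compl,
    ← h.lintegral_comp_emb (MeasurableEquiv.measurableEmbedding _)]
  rfl

/-- Integration in polar coordinates. -/
theorem lintegral_polar {G : E → ℝ≥0∞} (hG : Measurable G) :
    ∫⁻ y, G y = ∫⁻ θ : sphere (0 : E) 1, (∫⁻ r in Ioi (0 : ℝ),
      ENNReal.ofReal (r ^ (finrank ℝ E - 1)) * G (r • (θ : E))) ∂(volume : Measure E).toSphere := by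
  rw [lintegral_polar_aux, lintegral_prod _ (by fun_prop)]
  refine lintegral_congr fun θ => ?_
  exact lintegral_volumeIoiPow (fun r => G (r • (θ : E))) (by fun_prop)

theorem measurable_polar {G : E → ℝ≥0∞} (hG : Measurable G) :
    Measurable fun θ : sphere (0 : E) 1 => ∫⁻ r in Ioi (0 : ℝ),
      ENNReal.ofReal (r ^ (finrank ℝ E - 1)) * G (r • (θ : E)) := by
  apply Measurable.lintegral_prod_right (f := fun (θ : sphere (0 : E) 1) (r : ℝ) =>
      ENNReal.ofReal (r ^ (finrank ℝ E - 1)) * G (r • (θ : E)))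
  fun_prop

theorem ae_polar {p : E → Prop} (h : ∀ᵐ y : E, p y) :
    ∀ᵐ θ : sphere (0 : E) 1 ∂(volume : Measure E).toSphere,
      ∀ᵐ r ∂volume.restrict (Ioi (0 : ℝ)), p (r • (θ : E)) := by
  obtain ⟨T, hpT, hT, hT0⟩ := exists_measurable_superset_of_null (ae_iff.1 h)
  have h1 : ∫⁻ y, T.indicator 1 y = 0 := by rw [lintegral_indicator_one hT, hT0]
  rw [lintegral_polar (measurable_one.indicator hT),
    lintegral_eq_zero_iff (measurable_polar (measurable_one.indicator hT))] at h1
  filter_upwards [h1] with θ hθ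
  have hmeas : Measurable fun r : ℝ => ENNReal.ofReal (r ^ (finrank ℝ E - 1)) *
      T.indicator (1 : E → ℝ≥0∞) (r • (θ : E)) := by
    have := measurable_one (α := ℝ≥0∞).indicator hT
    fun_prop
  rw [Pi.zero_apply, lintegral_eq_zero_iff hmeas] at hθ
  filter_upwards [hθ, ae_restrict_mem measurableSet_Ioi] with r hr hr0
  by_contra hp
  have hr1 : 0 < r := hr0
  have : r • (θ : E) ∈ T := hpT hp
  simp [this] at hr
  exact absurd hr (not_le.2 (by positivity))

/-- The open cone spanned by a set. -/
def coneOf (B : Set E) : Set E := {p | ∃ r : ℝ, 0 < r ∧ ∃ y ∈ B, p = r • y}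

/-- A ray that meets `B` lies entirely in the cone over `B`, and almost no ray can meet a null set
in a whole half-line. -/
theorem ae_ray_notMem {B : Set E} (h : volume (coneOf B) = 0) :
    ∀ᵐ θ : sphere (0 : E) 1 ∂(volume : Measure E).toSphere,
      ∀ r : ℝ, 0 < r → r • (θ : E) ∉ B := by
  have h1 : ∀ᵐ y : E, y ∉ coneOf B := by rw [ae_iff]; simpa using h
  filter_upwards [ae_polar h1] with θ hθ r hr hB
  have h2 : ∀ᵐ s : ℝ ∂volume.restrict (Ioi (0 : ℝ)), False := by
    filter_upwards [hθ, ae_restrict_mem measurableSet_Ioi] with s hs hs0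
    refine hs ⟨s / r, div_pos hs0 hr, _, hB, ?_⟩
    rw [smul_smul, div_mul_cancel₀ _ hr.ne']
  rw [eventually_false_iff_eq_bot, ae_eq_bot, Measure.restrict_eq_zero] at h2
  simp at h2

/-- The cone over a null set of dimension `n - 1` is a null set. -/
theorem volume_halfCone_eq_zero {N : Set E} (hN : μHE[finrank ℝ E - 1] N = 0) {v : E}
    (hv : ‖v‖ = 1) : volume (coneOf {y ∈ N | 0 < ⟪v, y⟫}) = 0 := by
  set H : Measure E := μHE[finrank ℝ E - 1] with hH
  -- Central projection onto the hyperplane `⟨v, ·⟩ = 1`. It is constant on rays, so the cone is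
  -- determined by the image of `N` under `q`.
  set q : E → E := fun y => ⟪v, y⟫⁻¹ • y with hq
  have hqr : ∀ (r : ℝ) (y : E), 0 < r → q (r • y) = q y := by
    intro r y hr
    simp only [hq, real_inner_smul_right, smul_smul, mul_inv]
    congr 1
    field_simp
  -- The projection is only locally Lipschitz: its constant blows up as `⟨v, y⟩ → 0` or `‖y‖ → ∞`.
  -- These countably many regions exhaust the half-space.
  have hlip : ∀ k : ℕ, LipschitzOnWith (Real.toNNReal ((k + 1) + (k + 1) ^ 3)) q
      {y | ((k : ℝ) + 1)⁻¹ ≤ ⟪v, y⟫ ∧ ‖y‖ ≤ k + 1} := by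
    intro k
    refine LipschitzOnWith.of_dist_le_mul ?_
    rintro y ⟨hy1, -⟩ z ⟨hz1, hz2⟩
    set K : ℝ := (k : ℝ) + 1 with hK
    have hK0 : 0 < K := by positivity
    have hy0 : 0 < ⟪v, y⟫ := lt_of_lt_of_le (by positivity) hy1
    have hz0 : 0 < ⟪v, z⟫ := lt_of_lt_of_le (by positivity) hz1
    have hyK : ⟪v, y⟫⁻¹ ≤ K := inv_le_of_inv_le₀ hK0 hy1
    have hzK : ⟪v, z⟫⁻¹ ≤ K := inv_le_of_inv_le₀ hK0 hz1
    have hsub : q y - q z = ⟪v, y⟫⁻¹ • (y - z) + (⟪v, y⟫⁻¹ * ⟪v, z⟫⁻¹ * ⟪v, z - y⟫) • z := by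
      have : ⟪v, y⟫⁻¹ * ⟪v, z⟫⁻¹ * ⟪v, z - y⟫ = ⟪v, y⟫⁻¹ - ⟪v, z⟫⁻¹ := by
        rw [inner_sub_right]; field_simp
      rw [this, hq]
      module
    have hin : |⟪v, z - y⟫| ≤ ‖y - z‖ := by
      rw [norm_sub_rev]; simpa [hv] using abs_real_inner_le_norm v (z - y)
    rw [dist_eq_norm, dist_eq_norm, hsub, Real.coe_toNNReal _ (by positivity)]
    calc _ ≤ ‖⟪v, y⟫⁻¹ • (y - z)‖ + ‖(⟪v, y⟫⁻¹ * ⟪v, z⟫⁻¹ * ⟪v, z - y⟫) • z‖ := norm_add_le _ _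
      _ = ⟪v, y⟫⁻¹ * ‖y - z‖ + ⟪v, y⟫⁻¹ * ⟪v, z⟫⁻¹ * |⟪v, z - y⟫| * ‖z‖ := by
        simp only [norm_smul, norm_mul, norm_inv, Real.norm_eq_abs, abs_of_pos hy0, abs_of_pos hz0]
      _ ≤ K * ‖y - z‖ + K * K * ‖y - z‖ * K := by gcongr
      _ = _ := by ring
  have hD : H (q '' {y ∈ N | 0 < ⟪v, y⟫}) = 0 := by
    have hcov : q '' {y ∈ N | 0 < ⟪v, y⟫} ⊆
        ⋃ k : ℕ, q '' (N ∩ {y | ((k : ℝ) + 1)⁻¹ ≤ ⟪v, y⟫ ∧ ‖y‖ ≤ k + 1}) := by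
      rintro _ ⟨y, ⟨hyN, hy0⟩, rfl⟩
      obtain ⟨k, hk⟩ := exists_nat_ge (max ⟪v, y⟫⁻¹ ‖y‖)
      have h1 := (le_max_left _ _).trans hk
      have h2 := (le_max_right _ _).trans hk
      refine mem_iUnion.2 ⟨k, y, ⟨hyN, ?_, by linarith⟩, rfl⟩
      exact inv_le_of_inv_le₀ hy0 (by linarith)
    refine measure_mono_null hcov (measure_iUnion_null fun k => ?_)
    have := LipschitzOnWith.euclideanHausdorffMeasure_image_le
      ((hlip k).mono (inter_subset_right (s := N))) (finrank ℝ E - 1)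
    rw [measure_mono_null inter_subset_left hN, mul_zero] at this
    exact le_antisymm this zero_le
  obtain ⟨T, hDT, hT, hT0⟩ := exists_measurable_superset_of_null hD
  have hqm : Measurable q := by fun_prop
  set t : Set E := {p | 0 < ⟪v, p⟫} ∩ q ⁻¹' T with ht
  have htm : MeasurableSet t :=
    (measurableSet_lt measurable_const (by fun_prop)).inter (hqm hT)
  have hsub : coneOf {y ∈ N | 0 < ⟪v, y⟫} ⊆ t := by
    rintro _ ⟨r, hr, y, hy, rfl⟩
    refine ⟨?_, ?_⟩
    · simp only [mem_ofPred_eq, real_inner_smul_right]; exact mul_pos hr hy.2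
    · rw [mem_preimage, hqr r y hr]; exact hDT ⟨y, hy, rfl⟩
  refine measure_mono_null hsub ?_
  have hv0 : v ≠ 0 := by rintro rfl; simp at hv
  rw [← InnerProductSpace.euclideanHausdorffMeasure_eq_volume,
    EuclideanGeometry.euclideanHausdorffMeasure_eq_lintegral (0 : E) hv0 htm]
  rw [lintegral_eq_zero_of_ae_eq_zero, mul_zero]
  refine Eventually.of_forall fun s => ?_
  -- The slice of the cone at height `s` is a dilate by `s` of a subset of the null set `T`; Fubini
  -- over the slices concludes.
  have hslice : t ∩ (AffineSubspace.mk' (s • v +ᵥ (0 : E)) (ℝ ∙ v)ᗮ) ⊆ s • T ∩ {_p | 0 < s} := by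
    rintro p ⟨⟨hp0, hpT⟩, hp⟩
    rw [SetLike.mem_coe, AffineSubspace.mem_mk', Submodule.mem_orthogonal_singleton_iff_inner_right] at hp
    have hs : ⟪v, p⟫ = s := by
      simp [inner_sub_right, inner_smul_right, hv, sub_eq_zero] at hp
      exact hp
    have hs0 : 0 < s := hs ▸ hp0
    refine ⟨⟨q p, hpT, ?_⟩, hs0⟩
    simp only [hq, hs]
    rw [smul_smul, mul_inv_cancel₀ hs0.ne', one_smul]
  refine measure_mono_null hslice ?_
  by_cases hs : 0 < s
  · refine measure_mono_null inter_subset_left ?_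
    rw [Measure.euclideanHausdorffMeasure_smul₀ _ hs.ne']
    rw [← hH, hT0, smul_zero]
  · simp [hs]

/-- A nonzero vector has a nonzero coordinate, so the half-spaces given by `± b i` reduce this to
`volume_halfCone_eq_zero`. -/
theorem volume_coneOf_eq_zero {N : Set E} (hN : μHE[finrank ℝ E - 1] N = 0) :
    volume (coneOf N) = 0 := by
  set b := stdOrthonormalBasis ℝ E
  have hcov : coneOf N ⊆ {0} ∪ ((⋃ i, coneOf {y ∈ N | 0 < ⟪b i, y⟫}) ∪
      ⋃ i, coneOf {y ∈ N | 0 < ⟪-b i, y⟫}) := by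
    rintro _ ⟨r, hr, y, hy, rfl⟩
    by_cases h : ∃ i, ⟪b i, y⟫ ≠ 0
    · obtain ⟨i, hi⟩ := h
      rcases lt_or_gt_of_ne hi with hi | hi
      · exact Or.inr (Or.inr (mem_iUnion.2 ⟨i, r, hr, y, ⟨hy, by simpa using hi⟩, rfl⟩))
      · exact Or.inr (Or.inl (mem_iUnion.2 ⟨i, r, hr, y, ⟨hy, hi⟩, rfl⟩))
    · push Not at h
      have : y = 0 := by
        rw [← b.sum_repr' y]
        exact Finset.sum_eq_zero fun i _ => by rw [h i, zero_smul]
      simp [this]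
  refine measure_mono_null hcov (measure_union_null (by simp) (measure_union_null ?_ ?_))
  · exact measure_iUnion_null fun i => volume_halfCone_eq_zero hN (by simp)
  · exact measure_iUnion_null fun i => volume_halfCone_eq_zero hN (by simp)

/-- A countable union of dilations of a frustum covers the cone. -/
theorem volume_coneOf_eq_zero_of_frustum {C : Set E} (h : volume (frustum 1 C) = 0) :
    volume (coneOf C) = 0 := by
  have hcov : coneOf C ⊆ ⋃ j : ℤ, (fun p : E => ((2 : ℝ) ^ j) • p) '' frustum 1 C := by
    rintro _ ⟨r, hr, y, hy, rfl⟩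
    obtain ⟨j, hj1, hj2⟩ := exists_mem_Ico_zpow hr (one_lt_two (α := ℝ))
    have h2 : (0 : ℝ) < 2 ^ j := by positivity
    refine mem_iUnion.2 ⟨j, (r / 2 ^ j) • y, ⟨(y, r / 2 ^ j - 1), ⟨hy, ?_, ?_⟩, ?_⟩, ?_⟩
    · rw [sub_nonneg, le_div_iff₀ h2]; linarith
    · rw [sub_le_iff_le_add, div_le_iff₀ h2]; rw [zpow_add_one₀ two_ne_zero] at hj2; linarith
    · simp
    · simp only [smul_smul]; congr 1; field_simp
  refine measure_mono_null hcov (measure_iUnion_null fun j => ?_)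
  rw [image_smul, Measure.addHaar_smul, h, mul_zero]

/-- The frustum estimates hold only for small thickness. A frustum of thickness `1` is covered by
`N` layers, each a dilate by `1 + j / N ≤ 2` of the frustum of thickness `1 / N`. -/
theorem volume_frustum_one_le (C : Set E) {N : ℕ} (hN : 0 < N) :
    volume (frustum 1 C) ≤ N * ENNReal.ofReal (2 ^ finrank ℝ E) * volume (frustum (N : ℝ)⁻¹ C) := by
  have hN0 : (0 : ℝ) < N := by exact_mod_cast hN
  have hcov : frustum 1 C ⊆
      ⋃ j : Fin N, (fun p : E => (1 + (j : ℝ) / N) • p) '' frustum (N : ℝ)⁻¹ C := by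
    rintro _ ⟨⟨y, s⟩, ⟨hy, hs0, hs1⟩, rfl⟩
    simp only at hy hs0 hs1 ⊢
    obtain ⟨j, hjN, hj1, hj2⟩ : ∃ j : ℕ, j < N ∧ (j : ℝ) ≤ s * N ∧ s * N ≤ j + 1 := by
      rcases hs1.lt_or_eq with h | rfl
      · refine ⟨⌊s * N⌋₊, ?_, Nat.floor_le (by positivity), (Nat.lt_floor_add_one _).le⟩
        rw [Nat.floor_lt (by positivity)]; nlinarith
      -- At `s = 1` the floor of `s * N` would be `N`, one layer too far.
      · refine ⟨N - 1, by omega, ?_, ?_⟩ <;> rw [Nat.cast_sub (by omega)] <;> simp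
    have h1 : (0 : ℝ) < 1 + j / N := by positivity
    refine mem_iUnion.2 ⟨⟨j, hjN⟩, ((1 + s) / (1 + j / N)) • y,
      ⟨(y, (1 + s) / (1 + j / N) - 1), ⟨hy, ?_, ?_⟩, by simp⟩, ?_⟩
    · rw [sub_nonneg, le_div_iff₀ h1, one_mul]
      gcongr; rwa [div_le_iff₀ hN0]
    · rw [sub_le_iff_le_add, div_le_iff₀ h1]
      have h3 : s ≤ (j : ℝ) / N + (N : ℝ)⁻¹ := by
        rw [← one_div, ← add_div, le_div_iff₀ hN0]; exact hj2
      have h4 : 0 ≤ (N : ℝ)⁻¹ * (j / N) := by positivity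
      linarith
    · simp only [smul_smul]; congr 1; field_simp
  refine (measure_mono hcov).trans ((measure_iUnion_fintype_le _ _).trans ?_)
  refine (Finset.sum_le_card_nsmul _ _ (ENNReal.ofReal (2 ^ finrank ℝ E) *
    volume (frustum (N : ℝ)⁻¹ C)) fun j _ => ?_).trans ?_
  · rw [image_smul, Measure.addHaar_smul]
    gcongr
    have h1 : (j : ℝ) / N ≤ 1 := by
      rw [div_le_one hN0]; exact_mod_cast j.2.le
    rw [abs_of_nonneg (by positivity)]
    gcongr
    linarith
  · simp [mul_assoc]

/-- The sum of `r ^ n * G (r • θ)` over all positive `r`. -/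
noncomputable def raySum (G : E → ℝ≥0∞) (θ : sphere (0 : E) 1) : ℝ≥0∞ :=
  ∫⁻ r : Ioi (0 : ℝ), ENNReal.ofReal ((r : ℝ) ^ finrank ℝ E) * G ((r : ℝ) • (θ : E))
    ∂Measure.count

/-- Every ray from the origin meets `B` at most once. -/
def RadiallyInjective (B : Set E) : Prop := ∀ y ∈ B, y ≠ 0 ∧ ∀ t : ℝ, 0 < t → t • y ∈ B → t = 1

theorem RadiallyInjective.mono {B B' : Set E} (h : RadiallyInjective B) (hB : B' ⊆ B) :
    RadiallyInjective B' := fun y hy =>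
  ⟨(h y (hB hy)).1, fun t ht hty => (h y (hB hy)).2 t ht (hB hty)⟩

theorem RadiallyInjective.eq_of_mem {B : Set E} (h : RadiallyInjective B) {v : E} {r s : ℝ}
    (hr : 0 < r) (hs : 0 < s) (hrB : r • v ∈ B) (hsB : s • v ∈ B) : s = r := by
  have := (h _ hrB).2 (s / r) (div_pos hs hr) (by rwa [smul_smul, div_mul_cancel₀ _ hr.ne'])
  rwa [div_eq_one_iff_eq hr.ne'] at this

/-- Radial injectivity makes `(y, s) ↦ (1 + s) y` injective on `B × [0, τ]`, and injective
continuous images of Borel sets are Borel (Lusin–Souslin). -/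
theorem RadiallyInjective.measurableSet_frustum {B : Set E} (h : RadiallyInjective B)
    (hB : MeasurableSet B) (τ : ℝ) : MeasurableSet (frustum τ B) := by
  refine (hB.prod measurableSet_Icc).image_of_continuousOn_injOn
    (Continuous.continuousOn (by fun_prop)) ?_
  rintro ⟨y, s⟩ ⟨hy, hs, -⟩ ⟨z, t⟩ ⟨hz, ht, -⟩ hyz
  simp only at hy hz hs ht hyz
  have h1 : (0 : ℝ) < 1 + s := by linarith
  have h2 : (0 : ℝ) < 1 + t := by linarith
  have hz' : z = ((1 + s) / (1 + t)) • y := by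
    rw [div_eq_inv_mul, mul_smul, hyz, smul_smul, inv_mul_cancel₀ h2.ne', one_smul]
  have h3 := (h y hy).2 _ (div_pos h1 h2) (hz' ▸ hz)
  rw [h3, one_smul] at hz'
  rw [div_eq_one_iff_eq h2.ne'] at h3
  simp only [Prod.mk.injEq]
  exact ⟨hz'.symm, by linarith⟩

/-- A ray meets `B` in at most one radius `r₀`, and then meets the frustum exactly for `r₀ ≤ r ≤ (1
+ τ) r₀`. The integral of `r ^ (n - 1)` over this interval is a constant times `r₀ ^ n`. -/
theorem RadiallyInjective.polar_frustum {B : Set E} (h : RadiallyInjective B)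
    {τ : ℝ} (hτ : 0 < τ) (θ : sphere (0 : E) 1) :
    ∫⁻ r in Ioi (0 : ℝ), ENNReal.ofReal (r ^ (finrank ℝ E - 1)) *
        (frustum τ B).indicator 1 (r • (θ : E)) =
      ENNReal.ofReal (((1 + τ) ^ finrank ℝ E - 1) / finrank ℝ E) * raySum (B.indicator 1) θ := by
  have hn : 0 < finrank ℝ E := finrank_pos
  by_cases hθ : ∃ r : ℝ, 0 < r ∧ r • (θ : E) ∈ B
  · obtain ⟨r₀, hr₀, hrB⟩ := hθ
    have h1 : raySum (B.indicator 1) θ = ENNReal.ofReal (r₀ ^ finrank ℝ E) := by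
      have : ∀ r : Ioi (0 : ℝ), ENNReal.ofReal ((r : ℝ) ^ finrank ℝ E) *
          B.indicator (1 : E → ℝ≥0∞) ((r : ℝ) • (θ : E)) =
          ({⟨r₀, hr₀⟩} : Set (Ioi (0 : ℝ))).indicator
            (fun _ => ENNReal.ofReal (r₀ ^ finrank ℝ E)) r := by
        intro r
        by_cases hr : (r : ℝ) • (θ : E) ∈ B
        · have h2 : r = ⟨r₀, hr₀⟩ := Subtype.ext (h.eq_of_mem hr₀ r.2 hrB hr)
          subst h2
          simp [hrB]
        · have h2 : r ≠ ⟨r₀, hr₀⟩ := by rintro rfl; exact hr hrB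
          simp [hr, h2]
      rw [raySum, lintegral_congr this, lintegral_indicator (measurableSet_singleton _)]
      simp
    have h2 : ∀ r ∈ Ioi (0 : ℝ), ENNReal.ofReal (r ^ (finrank ℝ E - 1)) *
        (frustum τ B).indicator (1 : E → ℝ≥0∞) (r • (θ : E)) =
        (Icc r₀ ((1 + τ) * r₀)).indicator (fun r => ENNReal.ofReal (r ^ (finrank ℝ E - 1))) r := by
      intro r hr
      have hr' : 0 < r := hr
      have : r • (θ : E) ∈ frustum τ B ↔ r ∈ Icc r₀ ((1 + τ) * r₀) := by
        constructor
        · rintro ⟨⟨y, s⟩, ⟨hy, hs0, hs1⟩, hys⟩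
          simp only at hy hs0 hs1 hys
          have hs : 0 < 1 + s := by linarith
          have hy' : y = (r / (1 + s)) • (θ : E) := by
            rw [div_eq_inv_mul, mul_smul, ← hys, smul_smul, inv_mul_cancel₀ hs.ne', one_smul]
          have := h.eq_of_mem hr₀ (div_pos hr' hs) hrB (hy' ▸ hy)
          rw [div_eq_iff hs.ne'] at this
          constructor <;> nlinarith
        · rintro ⟨h3, h4⟩
          refine ⟨(r₀ • (θ : E), r / r₀ - 1), ⟨hrB, ?_, ?_⟩, ?_⟩
          · rw [sub_nonneg, le_div_iff₀ hr₀]; linarith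
          · rw [sub_le_iff_le_add, div_le_iff₀ hr₀]; linarith
          · simp only [smul_smul]; congr 1; field_simp; ring
      by_cases h5 : r ∈ Icc r₀ ((1 + τ) * r₀)
      · rw [indicator_of_mem (this.2 h5), indicator_of_mem h5]; simp
      · rw [indicator_of_notMem (fun h6 => h5 (this.1 h6)), indicator_of_notMem h5]; simp
    have hle : r₀ ≤ (1 + τ) * r₀ := by nlinarith
    rw [setLIntegral_congr_fun measurableSet_Ioi h2, h1, lintegral_indicator measurableSet_Icc,
      Measure.restrict_restrict measurableSet_Icc,
      inter_eq_left.2 (fun r hr => mem_Ioi.2 (lt_of_lt_of_le hr₀ hr.1)),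
      Measure.restrict_congr_set Ioc_ae_eq_Icc.symm,
      ← ofReal_integral_eq_lintegral_ofReal (intervalIntegrable_iff_integrableOn_Ioc_of_le hle |>.1
        (intervalIntegral.intervalIntegrable_pow _)), ← intervalIntegral.integral_of_le hle,
      integral_pow, ← ENNReal.ofReal_mul]
    · congr 1
      rw [Nat.sub_add_cancel hn, mul_pow, Nat.cast_sub (by omega)]
      have hn' : (finrank ℝ E : ℝ) ≠ 0 := by positivity
      field_simp
      simp [hn']
    · have : (1 : ℝ) ≤ (1 + τ) ^ finrank ℝ E := one_le_pow₀ (by linarith)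
      exact div_nonneg (by linarith) (by positivity)
    · filter_upwards [ae_restrict_mem measurableSet_Ioc] with r hr
      have : 0 < r := hr₀.trans hr.1
      positivity
  · push Not at hθ
    have h1 : raySum (B.indicator 1) θ = 0 := by
      have : ∀ r : Ioi (0 : ℝ), ENNReal.ofReal ((r : ℝ) ^ finrank ℝ E) *
          B.indicator (1 : E → ℝ≥0∞) ((r : ℝ) • (θ : E)) = 0 := by
        intro r
        rw [indicator_of_notMem (hθ r r.2), mul_zero]
      rw [raySum, lintegral_congr this, lintegral_zero]
    rw [h1, mul_zero, setLIntegral_congr_fun measurableSet_Ioi (g := fun _ => 0), lintegral_zero]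
    intro r hr
    have hr' : 0 < r := hr
    simp only
    rw [indicator_of_notMem, mul_zero]
    rintro ⟨⟨y, s⟩, ⟨hy, hs0, hs1⟩, hys⟩
    simp only at hy hs0 hs1 hys
    have hs : 0 < 1 + s := by linarith
    have hy' : y = (r / (1 + s)) • (θ : E) := by
      rw [div_eq_inv_mul, mul_smul, ← hys, smul_smul, inv_mul_cancel₀ hs.ne', one_smul]
    exact hθ _ (div_pos hr' hs) (hy' ▸ hy)

/-- Counting measure on `(0, ∞)` is not σ-finite, so Fubini does not give measurability; it is read
off from `polar_frustum` with `τ = 1`. -/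
theorem RadiallyInjective.measurable_raySum {B : Set E} (h : RadiallyInjective B)
    (hB : MeasurableSet B) : Measurable (raySum (B.indicator (1 : E → ℝ≥0∞))) := by
  have h1 := measurable_polar (measurable_one (α := ℝ≥0∞).indicator (h.measurableSet_frustum hB 1))
  simp_rw [h.polar_frustum one_pos] at h1
  have hn : 0 < finrank ℝ E := finrank_pos
  set c := ENNReal.ofReal (((1 + (1 : ℝ)) ^ finrank ℝ E - 1) / finrank ℝ E) with hc
  have hc0 : c ≠ 0 := by
    rw [hc, Ne, ENNReal.ofReal_eq_zero, not_le]
    have : (1 : ℝ) < (1 + 1) ^ finrank ℝ E := one_lt_pow₀ (by norm_num) hn.ne'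
    exact div_pos (by linarith) (by positivity)
  have h2 := h1.const_mul c⁻¹
  simp_rw [← mul_assoc] at h2
  rw [ENNReal.inv_mul_cancel hc0 ENNReal.ofReal_ne_top] at h2
  simpa using h2

theorem RadiallyInjective.volume_frustum {B : Set E} (h : RadiallyInjective B)
    (hB : MeasurableSet B) {τ : ℝ} (hτ : 0 < τ) :
    volume (frustum τ B) = ENNReal.ofReal (((1 + τ) ^ finrank ℝ E - 1) / finrank ℝ E) *
      ∫⁻ θ, raySum (B.indicator 1) θ ∂(volume : Measure E).toSphere := by
  rw [← lintegral_indicator_one (h.measurableSet_frustum hB τ),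
    lintegral_polar (measurable_one.indicator (h.measurableSet_frustum hB τ))]
  simp_rw [h.polar_frustum hτ]
  rw [lintegral_const_mul _ (h.measurable_raySum hB)]

end Polar

/-! ### Decomposition of a set with normals into almost flat pieces. -/

section Area

open Metric

variable {E : Type*} [NormedAddCommGroup E] [InnerProductSpace ℝ E] [FiniteDimensional ℝ E]
  [MeasurableSpace E] [BorelSpace E] [Nontrivial E]

/-- At every point `y` of `M` the hyperplane `(ν y)^⊥` is tangent to `M`. -/
def HasNormal (M : Set E) (ν : E → E) : Prop :=
  ∀ y ∈ M, ‖ν y‖ = 1 ∧ ∀ ε : ℝ, 0 < ε → ∃ r : ℝ, 0 < r ∧ ∀ z ∈ M, ‖z - y‖ < r →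
    |⟪ν y, z - y⟫| ≤ ε * ‖z - y‖

theorem HasNormal.mono {M M' : Set E} {ν : E → E} (h : HasNormal M ν) (hM : M' ⊆ M) :
    HasNormal M' ν := fun y hy => ⟨(h y (hM hy)).1, fun ε hε => by
  obtain ⟨r, hr, H⟩ := (h y (hM hy)).2 ε hε
  exact ⟨r, hr, fun z hz => H z (hM hz)⟩⟩

/-- For fixed `z` the failure of the condition is open in `z'`, so it is enough to test `z'` in a
countable dense subset of `M`. -/
theorem measurableSet_tangent {M : Set E} (hM : MeasurableSet M) {ν : E → E} (hν : Measurable ν)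
    (ε r : ℝ) :
    MeasurableSet {z ∈ M | ∀ z' ∈ M, ‖z' - z‖ < r → |⟪ν z, z' - z⟫| ≤ ε * ‖z' - z‖} := by
  rcases M.eq_empty_or_nonempty with rfl | hne
  · simp
  have : Nonempty M := hne.to_subtype
  set u : ℕ → M := TopologicalSpace.denseSeq M
  have hu : DenseRange u := TopologicalSpace.denseRange_denseSeq M
  have hset : {z ∈ M | ∀ z' ∈ M, ‖z' - z‖ < r → |⟪ν z, z' - z⟫| ≤ ε * ‖z' - z‖} =
      M ∩ ⋂ i, ({z | ‖(u i : E) - z‖ < r}ᶜ ∪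
        {z | |⟪ν z, (u i : E) - z⟫| ≤ ε * ‖(u i : E) - z‖}) := by
    ext z
    simp only [mem_ofPred_eq, mem_inter_iff, mem_iInter, mem_union, mem_compl_iff]
    refine and_congr_right fun _ => ⟨fun h i => ?_, fun h z' hz' hzr => ?_⟩
    · exact not_or_of_imp (h _ (u i).2)
    · by_contra hcon
      have hopen : IsOpen {w : M | ‖(w : E) - z‖ < r ∧ ε * ‖(w : E) - z‖ < |⟪ν z, (w : E) - z⟫|} :=
        IsOpen.inter (s := {w : M | ‖(w : E) - z‖ < r})
          (t := {w : M | ε * ‖(w : E) - z‖ < |⟪ν z, (w : E) - z⟫|})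
          (isOpen_lt (by fun_prop) (by fun_prop)) (isOpen_lt (by fun_prop) (by fun_prop))
      obtain ⟨i, hi⟩ := hu.exists_mem_open hopen ⟨⟨z', hz'⟩, hzr, not_le.1 hcon⟩
      rcases h i with h1 | h1
      · exact h1 hi.1
      · exact absurd hi.2 (not_lt.2 h1)
  rw [hset]
  refine hM.inter (MeasurableSet.iInter fun i => ?_)
  refine (measurableSet_lt (by fun_prop) (by fun_prop)).compl.union
    (measurableSet_le (by fun_prop) (by fun_prop))

/-- A set with normals splits into small flat pieces. -/
theorem HasNormal.exists_partition {M : Set E} {ν : E → E} (h : HasNormal M ν)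
    (hM : MeasurableSet M) (hν : Measurable ν) (hne : M.Nonempty) (δ : E → ℝ)
    (hδ : ∀ y, 0 < δ y) :
    ∃ (B : ℕ → Set E) (c : ℕ → E), (∀ k, c k ∈ M) ∧ (∀ k, MeasurableSet (B k)) ∧
      Pairwise (Function.onFun Disjoint B) ∧ (⋃ k, B k) = M ∧ (∀ k, B k ⊆ ball (c k) (δ (c k))) ∧
      (∀ k, IsFlat (δ (c k)) (ν (c k)) (B k)) ∧ ∀ k, ∀ z ∈ B k, ‖ν z - ν (c k)‖ ≤ δ (c k) := by
  -- Covering the graph of `ν` instead of `M` (Lindelöf) controls the position and the normal at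
  -- once.
  set s : Set (E × E) := (fun y => (y, ν y)) '' M
  obtain ⟨t, hts, htc, hst⟩ := TopologicalSpace.countable_cover_nhdsWithin (s := s)
    (f := fun p => ball p (δ p.1 / 2)) fun p _ =>
      mem_nhdsWithin_of_mem_nhds (ball_mem_nhds _ (half_pos (hδ _)))
  have htne : t.Nonempty := by
    obtain ⟨y, hy⟩ := hne
    obtain ⟨p, hp, -⟩ := mem_iUnion₂.1 (hst ⟨y, hy, rfl⟩)
    exact ⟨p, hp⟩
  obtain ⟨p, rfl⟩ := htc.exists_eq_range htne
  have hp : ∀ k, ∃ y ∈ M, (y, ν y) = p k := fun k => hts ⟨k, rfl⟩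
  choose c hcM hcp using hp
  set u : ℕ → E := TopologicalSpace.denseSeq E
  -- The indices are a centre `c`, a scale `1 / (j + 1)` on which tangency holds uniformly, and a
  -- ball of diameter at most this scale, so that any two points of a piece can be compared.
  set C : ℕ × ℕ × ℕ → Set E := fun i =>
    {z ∈ M | ∀ z' ∈ M, ‖z' - z‖ < ((i.2.1 : ℝ) + 1)⁻¹ →
        |⟪ν z, z' - z⟫| ≤ (δ (c i.1) / 2) * ‖z' - z‖} ∩
      (ball (c i.1) (δ (c i.1) / 2) ∩ ({z | ‖ν z - ν (c i.1)‖ < δ (c i.1) / 2} ∩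
        ball (u i.2.2) (((i.2.1 : ℝ) + 1)⁻¹ / 2))) with hC
  set e : ℕ ≃ ℕ × ℕ × ℕ := (Denumerable.eqv _).symm
  have hCm : ∀ i, MeasurableSet (C i) := fun i =>
    (measurableSet_tangent hM hν _ _).inter (measurableSet_ball.inter
      ((measurableSet_lt (by fun_prop) (by fun_prop)).inter measurableSet_ball))
  have hsub : ∀ k, disjointed (C ∘ e) k ⊆ C (e k) := fun k => disjointed_subset (C ∘ e) k
  refine ⟨disjointed (C ∘ e), fun k => c (e k).1, fun k => hcM _, fun k =>
    MeasurableSet.disjointed (fun i => hCm _) k, disjoint_disjointed _, ?_, ?_, ?_, ?_⟩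
  · rw [iUnion_disjointed]
    refine Subset.antisymm (iUnion_subset fun k => fun z hz => hz.1.1) fun z hz => ?_
    obtain ⟨_, ⟨a, rfl⟩, hb⟩ := mem_iUnion₂.1 (hst ⟨z, hz, rfl⟩)
    rw [mem_ball, ← hcp a, Prod.dist_eq, max_lt_iff] at hb
    simp only [dist_eq_norm] at hb
    obtain ⟨r, hr, H⟩ := (h z hz).2 (δ (c a) / 2) (half_pos (hδ _))
    obtain ⟨j, hj⟩ := exists_nat_one_div_lt hr
    rw [one_div] at hj
    have hj0 : (0 : ℝ) < ((j : ℝ) + 1)⁻¹ := by positivity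
    obtain ⟨i, hi⟩ := (TopologicalSpace.denseRange_denseSeq E).exists_dist_lt z (half_pos hj0)
    refine mem_iUnion.2 ⟨e.symm (a, j, i), ?_⟩
    simp only [Function.comp_apply, Equiv.apply_symm_apply]
    refine ⟨⟨hz, fun z' hz' hzz => H z' hz' (hzz.trans hj)⟩, ?_, hb.2, hi⟩
    rw [mem_ball, dist_eq_norm]; exact hb.1
  · exact fun k z hz => ball_subset_ball (half_le_self (hδ _).le) (hsub k hz).2.1
  · intro k y hy z hz
    obtain ⟨⟨hyM, hy1⟩, -, hy2, hy3⟩ := hsub k hy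
    obtain ⟨⟨hzM, -⟩, -, -, hz3⟩ := hsub k hz
    have h1 : ‖z - y‖ < (((e k).2.1 : ℝ) + 1)⁻¹ := by
      rw [← dist_eq_norm]
      calc dist z y ≤ dist z (u (e k).2.2) + dist y (u (e k).2.2) := dist_triangle_right _ _ _
        _ < _ := by rw [mem_ball] at hy3 hz3; linarith
    have h2 := hy1 z hzM h1
    have h3 : |⟪ν (c (e k).1) - ν y, z - y⟫| ≤ δ (c (e k).1) / 2 * ‖z - y‖ := by
      refine (abs_real_inner_le_norm _ _).trans ?_
      gcongr
      rw [norm_sub_rev]; exact hy2.le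
    calc |⟪ν (c (e k).1), z - y⟫| = |⟪ν (c (e k).1) - ν y, z - y⟫ + ⟪ν y, z - y⟫| := by
          rw [inner_sub_left]; congr 1; ring
      _ ≤ _ := abs_add_le _ _
      _ ≤ δ (c (e k).1) * ‖z - y‖ := by linarith
  · intro k z hz
    exact (hsub k hz).2.2.1.le.trans (half_le_self (hδ _).le)

/-- The surface measure with density `|⟨y, ν y⟩|`. -/
noncomputable def supportMeasure (ν : E → E) : Measure E :=
  (μHE[finrank ℝ E - 1] : Measure E).withDensity fun y => ENNReal.ofReal |⟪ν y, y⟫|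

theorem supportMeasure_bounds {ν : E → E} {C : Set E} (hC : MeasurableSet C)
    {a η : ℝ} (hνC : ∀ y ∈ C, |(|⟪ν y, y⟫| - a)| ≤ η) :
    supportMeasure ν C ≤ ENNReal.ofReal (a + η) * μHE[finrank ℝ E - 1] C ∧
    ENNReal.ofReal (a - η) * μHE[finrank ℝ E - 1] C ≤ supportMeasure ν C := by
  rw [supportMeasure, withDensity_apply _ hC]
  constructor
  · rw [← setLIntegral_const]
    refine setLIntegral_mono' hC fun y hy => ENNReal.ofReal_le_ofReal ?_
    have := (abs_le.1 (hνC y hy)).2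
    linarith
  · rw [← setLIntegral_const]
    refine setLIntegral_mono' hC fun y hy => ENNReal.ofReal_le_ofReal ?_
    have := (abs_le.1 (hνC y hy)).1
    linarith

/-- A set with normals splits into pieces over which frusta have the expected volume. -/
theorem HasNormal.exists_frustum_partition {M : Set E} {ν : E → E} (h : HasNormal M ν)
    (hM : MeasurableSet M) (hν : Measurable ν) (hne : M.Nonempty) {η : ℝ} (hη : 0 < η) :
    ∃ (B : ℕ → Set E) (τ : ℕ → ℝ), (∀ k, 0 < τ k) ∧ (∀ k, MeasurableSet (B k)) ∧
      Pairwise (Function.onFun Disjoint B) ∧ (⋃ k, B k) = M ∧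
      ∀ k, ∀ C ⊆ B k, MeasurableSet C → ∀ t, 0 < t → t ≤ τ k →
        volume (frustum t C) ≤ ENNReal.ofReal t *
          (supportMeasure ν C + ENNReal.ofReal η * μHE[finrank ℝ E - 1] C) ∧
        ENNReal.ofReal t * supportMeasure ν C ≤ volume (frustum t C) +
          ENNReal.ofReal t * (ENNReal.ofReal η * μHE[finrank ℝ E - 1] C) := by
  have hη2 : 0 < η / 2 := half_pos hη
  have hex : ∀ y : E, ∃ δ : ℝ, 0 < δ ∧ (y ∈ M → ∀ B : Set E, B ⊆ ball y δ → IsFlat δ (ν y) B →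
      ∀ τ, 0 < τ → τ ≤ δ →
      volume (frustum τ B) ≤
        ENNReal.ofReal ((|⟪ν y, y⟫| + η / 2) * τ) * μHE[finrank ℝ E - 1] B ∧
      ENNReal.ofReal ((|⟪ν y, y⟫| - η / 2) * τ) * μHE[finrank ℝ E - 1] B ≤
        volume (frustum τ B)) := by
    intro y
    by_cases hy : y ∈ M
    · obtain ⟨δ, hδ, H⟩ := exists_volume_frustum_estimate (h y hy).1 y hη2
      exact ⟨δ, hδ, fun _ => H⟩
    · exact ⟨1, one_pos, fun hy' => absurd hy' hy⟩
  choose δ₀ hδ₀ H using hex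
  -- The bound `δ₀` is for the frustum estimate; the other two keep the variation of `|⟨ν y, y⟩|` on
  -- a piece below `δ (‖c‖ + 2) ≤ η / 2`.
  set δ : E → ℝ := fun y => min (δ₀ y) (min 1 (η / 2 / (‖y‖ + 2))) with hδdef
  have hδ : ∀ y, 0 < δ y := fun y => by positivity [hδ₀ y]
  obtain ⟨B, c, hc, hBm, hBd, hBU, hBb, hBf, hBν⟩ := h.exists_partition hM hν hne δ hδ
  refine ⟨B, fun k => δ (c k), fun k => hδ _, hBm, hBd, hBU, fun k C hC hCm t ht htk => ?_⟩
  have h1 : δ (c k) ≤ δ₀ (c k) := min_le_left _ _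
  have h2 : δ (c k) ≤ 1 := (min_le_right _ _).trans (min_le_left _ _)
  have h3 : δ (c k) * (‖c k‖ + 2) ≤ η / 2 := by
    rw [← le_div_iff₀ (by positivity)]
    exact (min_le_right _ _).trans (min_le_right _ _)
  obtain ⟨hup, hlow⟩ := H (c k) (hc k) C ((hC.trans (hBb k)).trans (ball_subset_ball h1))
    ((hBf k).mono h1 hC) t ht (htk.trans h1)
  set a := |⟪ν (c k), c k⟫|
  have hνC : ∀ y ∈ C, |(|⟪ν y, y⟫| - a)| ≤ η / 2 := by
    intro y hy
    have hyb : ‖y - c k‖ ≤ δ (c k) := by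
      have := hBb k (hC hy)
      rw [mem_ball, dist_eq_norm] at this
      exact this.le
    have hyn : ‖y‖ ≤ ‖c k‖ + 1 := by
      calc ‖y‖ = ‖c k + (y - c k)‖ := by simp
        _ ≤ _ := norm_add_le _ _
        _ ≤ _ := by linarith
    refine (abs_abs_sub_abs_le _ _).trans ?_
    have : ⟪ν y, y⟫ - ⟪ν (c k), c k⟫ = ⟪ν y - ν (c k), y⟫ + ⟪ν (c k), y - c k⟫ := by
      rw [inner_sub_left, inner_sub_right]; ring
    rw [this]
    calc _ ≤ |⟪ν y - ν (c k), y⟫| + |⟪ν (c k), y - c k⟫| := abs_add_le _ _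
      _ ≤ ‖ν y - ν (c k)‖ * ‖y‖ + ‖ν (c k)‖ * ‖y - c k‖ := by
        gcongr <;> exact abs_real_inner_le_norm _ _
      _ ≤ δ (c k) * (‖c k‖ + 1) + 1 * δ (c k) := by
        rw [(h _ (hc k)).1]
        gcongr
        · exact (hδ _).le
        · exact hBν k y (hC hy)
      _ = δ (c k) * (‖c k‖ + 2) := by ring
      _ ≤ _ := h3
  obtain ⟨hsu, hsl⟩ := supportMeasure_bounds hCm hνC
  set m := μHE[finrank ℝ E - 1] C
  have hsplit : ENNReal.ofReal (a + η / 2) ≤ ENNReal.ofReal (a - η / 2) + ENNReal.ofReal η := by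
    refine le_trans (ENNReal.ofReal_le_ofReal ?_) ENNReal.ofReal_add_le
    linarith
  rw [mul_comm _ t, ENNReal.ofReal_mul ht.le, mul_assoc] at hup hlow
  constructor
  · refine hup.trans (mul_le_mul_right ?_ _)
    calc _ ≤ (ENNReal.ofReal (a - η / 2) + ENNReal.ofReal η) * m := mul_le_mul_left hsplit _
      _ = ENNReal.ofReal (a - η / 2) * m + ENNReal.ofReal η * m := add_mul _ _ _
      _ ≤ _ := by gcongr
  · calc _ ≤ ENNReal.ofReal t * (ENNReal.ofReal (a + η / 2) * m) := mul_le_mul_right hsu _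
      _ ≤ ENNReal.ofReal t * (ENNReal.ofReal (a - η / 2) * m + ENNReal.ofReal η * m) := by
        rw [← add_mul]
        exact mul_le_mul_right (mul_le_mul_left hsplit _) _
      _ = ENNReal.ofReal t * (ENNReal.ofReal (a - η / 2) * m) +
          ENNReal.ofReal t * (ENNReal.ofReal η * m) := mul_add _ _ _
      _ ≤ _ := by gcongr

end Area

/-! ### The area formula for the radial projection. -/

section AreaFormula

open Metric

variable {E : Type*} [NormedAddCommGroup E] [InnerProductSpace ℝ E] [FiniteDimensional ℝ E]
  [MeasurableSpace E] [BorelSpace E] [Nontrivial E]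

/-- The cylinder of height `1` over the projection of `B` is bounded, so the projection has finite
measure; flatness transfers this back to `B`. -/
theorem IsFlat.hausdorff_lt_top {δ : ℝ} {ν c : E} {B : Set E} (h : IsFlat δ ν B) (hν : ‖ν‖ = 1)
    (hδ : δ < 1) (hB : B ⊆ ball c δ) : μHE[finrank ℝ E - 1] B < ⊤ := by
  have h1 : μHE[finrank ℝ E - 1] (projAlong ν '' B) < ⊤ := by
    have hslab := volume_slab hν (D := projAlong ν '' B)
      (by rintro _ ⟨y, _, rfl⟩; exact inner_projAlong hν y) 1
    rw [ENNReal.ofReal_one, one_mul] at hslab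
    rw [← hslab]
    refine lt_of_le_of_lt (measure_mono (t := closedBall 0 (‖c‖ + δ + 1)) ?_)
      measure_closedBall_lt_top
    rintro _ ⟨_, ⟨y, hy, rfl⟩, s, ⟨hs0, hs1⟩, rfl⟩
    have h2 := hB hy
    rw [mem_ball, dist_eq_norm] at h2
    rw [mem_closedBall, dist_zero_right]
    calc _ ≤ ‖projAlong ν y‖ + ‖s • ν‖ := norm_add_le _ _
      _ ≤ ‖y‖ + 1 := by
        rw [norm_smul, hν, mul_one, Real.norm_of_nonneg hs0]
        gcongr
        exact norm_projAlong_le hν y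
      _ = ‖c + (y - c)‖ + 1 := by simp
      _ ≤ _ := by linarith [norm_add_le c (y - c)]
  have h2 := (h.le_hausdorff_projAlong hν hδ (finrank ℝ E - 1)).trans_lt h1
  have h3 : 0 < (1 - δ) ^ (finrank ℝ E - 1) := pow_pos (by linarith) _
  by_contra hcon
  rw [not_lt, top_le_iff] at hcon
  rw [hcon, ENNReal.mul_top (by simpa using h3)] at h2
  exact lt_irrefl _ h2

/-- A set with transversal normals splits into radially injective pieces of finite measure. -/
theorem HasNormal.exists_finite_partition {M : Set E} {ν : E → E} (h : HasNormal M ν)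
    (hM : MeasurableSet M) (hν : Measurable ν) (hne : M.Nonempty) :
    ∃ B : ℕ → Set E, (∀ k, MeasurableSet (B k)) ∧ Pairwise (Function.onFun Disjoint B) ∧
      (⋃ k, B k) = M ∧ (∀ k, μHE[finrank ℝ E - 1] (B k) < ⊤) ∧
      ((∀ y ∈ M, ⟪ν y, y⟫ ≠ 0) → ∀ k, RadiallyInjective (B k)) := by
  classical
  -- If `y` and `t y` with `t ≠ 1` lay in one piece, flatness would give `|⟨ν c, y⟩| ≤ δ ‖y‖`, hence
  -- `|⟨ν c, c⟩| ≤ δ (‖c‖ + 2)`, against the choice of `δ`. At tangential points only finiteness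
  -- matters and `1 / 2` is enough.
  set δ : E → ℝ := fun y =>
    if ⟪ν y, y⟫ = 0 then 1 / 2 else min (1 / 2) (|⟪ν y, y⟫| / (‖y‖ + 3)) with hδdef
  have hδ : ∀ y, 0 < δ y := by
    intro y
    simp only [hδdef]
    split_ifs with hy
    · norm_num
    · have : 0 < |⟪ν y, y⟫| := abs_pos.2 hy
      positivity
  have hδ2 : ∀ y, δ y ≤ 1 / 2 := by
    intro y
    simp only [hδdef]
    split_ifs
    · exact le_rfl
    · exact min_le_left _ _
  obtain ⟨B, c, hc, hBm, hBd, hBU, hBb, hBf, hBν⟩ := h.exists_partition hM hν hne δ hδ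
  refine ⟨B, hBm, hBd, hBU, fun k => ?_, fun hM0 k y hy => ?_⟩
  · exact (hBf k).hausdorff_lt_top (h _ (hc k)).1 (by linarith [hδ2 (c k)]) (hBb k)
  · have hyM : y ∈ M := hBU ▸ mem_iUnion.2 ⟨k, hy⟩
    refine ⟨fun h0 => hM0 y hyM (by rw [h0, inner_zero_right]), fun t ht hty => ?_⟩
    by_contra ht1
    have h1 := hBf k y hy _ hty
    have h2 : t • y - y = (t - 1) • y := by module
    have ht1' : 0 < |t - 1| := abs_pos.2 (sub_ne_zero.2 ht1)
    rw [h2, real_inner_smul_right, abs_mul, norm_smul, Real.norm_eq_abs, mul_left_comm,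
      mul_le_mul_iff_right₀ ht1'] at h1
    have h3 : δ (c k) * (‖c k‖ + 3) ≤ |⟪ν (c k), c k⟫| := by
      rw [← le_div_iff₀ (by positivity)]
      simp only [hδdef, if_neg (hM0 _ (hc k))]
      exact min_le_right _ _
    have hyb : ‖y - c k‖ ≤ δ (c k) := by
      have := hBb k hy
      rw [mem_ball, dist_eq_norm] at this
      exact this.le
    have hyn : ‖y‖ ≤ ‖c k‖ + 1 := by
      calc ‖y‖ = ‖c k + (y - c k)‖ := by simp
        _ ≤ _ := norm_add_le _ _
        _ ≤ _ := by linarith [hδ2 (c k)]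
    have h4 : |⟪ν (c k), c k⟫| ≤ |⟪ν (c k), y⟫| + δ (c k) := by
      have : ⟪ν (c k), c k⟫ = ⟪ν (c k), y⟫ - ⟪ν (c k), y - c k⟫ := by
        rw [inner_sub_right]; ring
      rw [this]
      refine (abs_sub _ _).trans ?_
      gcongr
      refine (abs_real_inner_le_norm _ _).trans ?_
      rw [(h _ (hc k)).1, one_mul]; exact hyb
    nlinarith [hδ (c k)]

theorem measure_eq_tsum_of_partition {μ : Measure E} {B : ℕ → Set E} {M : Set E}
    (hBm : ∀ k, MeasurableSet (B k)) (hBd : Pairwise (Function.onFun Disjoint B))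
    (hBU : (⋃ k, B k) = M) : μ M = ∑' k, μ (B k) := by
  rw [← hBU, measure_iUnion hBd hBm]

theorem frustum_iUnion (τ : ℝ) (B : ℕ → Set E) : frustum τ (⋃ k, B k) = ⋃ k, frustum τ (B k) := by
  simp only [frustum, iUnion_prod_const, image_iUnion]

/-- The cone over a set to which the radial direction is tangent is a null set. -/
theorem HasNormal.volume_coneOf_eq_zero {M : Set E} {ν : E → E} (h : HasNormal M ν)
    (hM : MeasurableSet M) (hν : Measurable ν) (h0 : ∀ y ∈ M, ⟪ν y, y⟫ = 0)
    (hfin : μHE[finrank ℝ E - 1] M < ⊤) : volume (coneOf M) = 0 := by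
  rcases M.eq_empty_or_nonempty with rfl | hne
  · simp [coneOf]
  apply volume_coneOf_eq_zero_of_frustum
  set m := μHE[finrank ℝ E - 1] M
  -- The support density vanishes on `M`, so a frustum of thickness `1 / N` has volume at most `η /
  -- N` times the surface measure. The `N` layers give a bound independent of `N`, and `η` is
  -- arbitrary.
  have hbound : ∀ η : ℝ≥0, 0 < η →
      volume (frustum 1 M) ≤ η * (ENNReal.ofReal (2 ^ finrank ℝ E) * m) := by
    intro η hη
    obtain ⟨B, τ, hτ, hBm, hBd, hBU, hB⟩ := h.exists_frustum_partition hM hν hne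
      (show (0 : ℝ) < η by exact_mod_cast hη)
    have hk : ∀ k, volume (frustum 1 (B k)) ≤
        η * (ENNReal.ofReal (2 ^ finrank ℝ E) * μHE[finrank ℝ E - 1] (B k)) := by
      intro k
      obtain ⟨N, hN⟩ := exists_nat_gt (τ k)⁻¹
      have hN0 : (0 : ℝ) < N := (inv_pos.2 (hτ k)).trans hN
      have h1 := (hB k (B k) subset_rfl (hBm k) (N : ℝ)⁻¹ (inv_pos.2 hN0)
        (inv_le_of_inv_le₀ (hτ k) hN.le)).1
      have h2 : supportMeasure ν (B k) = 0 := by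
        rw [supportMeasure, withDensity_apply _ (hBm k), setLIntegral_congr_fun (hBm k)
          (g := fun _ => 0), lintegral_zero]
        intro y hy
        simp [h0 y (hBU ▸ mem_iUnion.2 ⟨k, hy⟩)]
      rw [h2, zero_add, ENNReal.ofReal_coe_nnreal] at h1
      have hNN : (N : ℝ≥0∞) * ENNReal.ofReal (N : ℝ)⁻¹ = 1 := by
        rw [← ENNReal.ofReal_natCast, ← ENNReal.ofReal_mul hN0.le, mul_inv_cancel₀ hN0.ne',
          ENNReal.ofReal_one]
      calc _ ≤ _ := volume_frustum_one_le (B k) (by exact_mod_cast hN0 : 0 < N)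
        _ ≤ N * ENNReal.ofReal (2 ^ finrank ℝ E) * (ENNReal.ofReal (N : ℝ)⁻¹ *
            (η * μHE[finrank ℝ E - 1] (B k))) := mul_le_mul_right h1 _
        _ = (N * ENNReal.ofReal (N : ℝ)⁻¹) * (η * (ENNReal.ofReal (2 ^ finrank ℝ E) *
            μHE[finrank ℝ E - 1] (B k))) := by ring
        _ = _ := by rw [hNN, one_mul]
    calc volume (frustum 1 M) = volume (⋃ k, frustum 1 (B k)) := by rw [← hBU, frustum_iUnion]
      _ ≤ ∑' k, volume (frustum 1 (B k)) := measure_iUnion_le _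
      _ ≤ ∑' k, η * (ENNReal.ofReal (2 ^ finrank ℝ E) * μHE[finrank ℝ E - 1] (B k)) :=
        ENNReal.tsum_le_tsum hk
      _ = _ := by
        rw [ENNReal.tsum_mul_left, ENNReal.tsum_mul_left,
          ← measure_eq_tsum_of_partition hBm hBd hBU]
  have hK : ENNReal.ofReal (2 ^ finrank ℝ E) * m ≠ ⊤ :=
    ENNReal.mul_ne_top ENNReal.ofReal_ne_top hfin.ne
  refine le_antisymm (ENNReal.le_of_forall_pos_le_add fun ε hε _ => ?_) zero_le
  obtain ⟨η, hη0, hη⟩ := ENNReal.exists_nnreal_pos_mul_lt hK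
    (show (ε : ℝ≥0∞) ≠ 0 by exact_mod_cast hε.ne')
  rw [zero_add]
  exact (hbound η hη0).trans hη.le

theorem measurable_raySum_integrand {G : E → ℝ≥0∞} (hG : Measurable G) (θ : sphere (0 : E) 1) :
    Measurable fun r : Ioi (0 : ℝ) =>
      ENNReal.ofReal ((r : ℝ) ^ finrank ℝ E) * G ((r : ℝ) • (θ : E)) := by
  fun_prop

theorem raySum_tsum {G : ℕ → E → ℝ≥0∞} (hG : ∀ k, Measurable (G k)) (θ : sphere (0 : E) 1) :
    raySum (fun y => ∑' k, G k y) θ = ∑' k, raySum (G k) θ := by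
  simp only [raySum, ← ENNReal.tsum_mul_left]
  exact lintegral_tsum fun k => (measurable_raySum_integrand (hG k) θ).aemeasurable

theorem indicator_partition {B : ℕ → Set E} {M : Set E} (hBd : Pairwise (Function.onFun Disjoint B))
    (hBU : (⋃ k, B k) = M) (F : E → ℝ≥0∞) :
    M.indicator F = fun y => ∑' k, (B k).indicator F y := by
  ext y
  by_cases hy : y ∈ M
  · obtain ⟨k, hk⟩ := mem_iUnion.1 (hBU ▸ hy)
    rw [tsum_eq_single k fun j hj => indicator_of_notMem
      (fun h => (hBd hj).notMem_of_mem_left h hk) F, indicator_of_mem hy, indicator_of_mem hk]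
  · rw [indicator_of_notMem hy]
    refine (ENNReal.tsum_eq_zero.2 fun k => indicator_of_notMem (fun h => hy ?_) F).symm
    exact hBU ▸ mem_iUnion.2 ⟨k, h⟩

/-- The function `(1 + t) ^ n` has derivative `n` at `0`. Together with Bernoulli's inequality this
identifies the constant in `polar_frustum` with `t` to first order. -/
theorem exists_pow_sub_one_le (n : ℕ) (hn : 0 < n) {η τ : ℝ} (hη : 0 < η) (hτ : 0 < τ) :
    ∃ t : ℝ, 0 < t ∧ t ≤ τ ∧ ((1 + t) ^ n - 1) / n ≤ (1 + η) * t := by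
  have hd : HasDerivAt (fun t : ℝ => (1 + t) ^ n) n 0 := by
    have := ((hasDerivAt_id' (0 : ℝ)).const_add 1).fun_pow n
    simpa using this
  have h1 := (hasDerivWithinAt_iff_tendsto_slope' (s := Ioi (0 : ℝ)) (by simp)).1
    hd.hasDerivWithinAt
  have hn' : (0 : ℝ) < n := by exact_mod_cast hn
  have h2 := h1.eventually (gt_mem_nhds (show (n : ℝ) < n * (1 + η) by nlinarith))
  have h3 : ∀ᶠ t : ℝ in 𝓝[>] 0, t < τ := (gt_mem_nhds hτ).filter_mono nhdsWithin_le_nhds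
  obtain ⟨t, ht1, ht2, ht3⟩ := (h2.and (h3.and self_mem_nhdsWithin)).exists
  have ht0 : 0 < t := ht3
  refine ⟨t, ht0, ht2.le, ?_⟩
  rw [slope_def_field, sub_zero, div_lt_iff₀ ht0] at ht1
  simp only [add_zero, one_pow] at ht1
  rw [div_le_iff₀ hn']
  nlinarith

/-- The area formula for the radial projection, for sets. -/
theorem HasNormal.lintegral_raySum_indicator_one {M : Set E} {ν : E → E} (h : HasNormal M ν)
    (hM : MeasurableSet M) (hν : Measurable ν) (hinj : RadiallyInjective M)
    (hfin : μHE[finrank ℝ E - 1] M < ⊤) :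
    ∫⁻ θ, raySum (M.indicator 1) θ ∂(volume : Measure E).toSphere = supportMeasure ν M := by
  rcases M.eq_empty_or_nonempty with rfl | hne
  · simp [raySum]
  set m := μHE[finrank ℝ E - 1] M
  set Λ : Set E → ℝ≥0∞ := fun C =>
    ∫⁻ θ, raySum (C.indicator 1) θ ∂(volume : Measure E).toSphere with hΛ
  have hn : 0 < finrank ℝ E := finrank_pos
  have hn' : (0 : ℝ) < finrank ℝ E := by exact_mod_cast hn
  -- On each piece the volume of a thin frustum is known exactly from polar coordinates and up to
  -- `η` from flatness; cancel `t` and sum over the pieces. Since `m` is finite, the errors vanish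
  -- with `η`.
  have hbound : ∀ η : ℝ≥0, 0 < η → Λ M ≤ supportMeasure ν M + η * m ∧
      supportMeasure ν M ≤ (1 + η) * Λ M + η * m := by
    intro η hη
    obtain ⟨B, τ, hτ, hBm, hBd, hBU, hB⟩ := h.exists_frustum_partition hM hν hne
      (show (0 : ℝ) < η by exact_mod_cast hη)
    have hBinj : ∀ k, RadiallyInjective (B k) := fun k =>
      hinj.mono (hBU ▸ subset_iUnion B k)
    have hk : ∀ k, Λ (B k) ≤ supportMeasure ν (B k) + η * μHE[finrank ℝ E - 1] (B k) ∧
        supportMeasure ν (B k) ≤ (1 + η) * Λ (B k) + η * μHE[finrank ℝ E - 1] (B k) := by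
      intro k
      obtain ⟨t, ht0, htτ, ht⟩ := exists_pow_sub_one_le (finrank ℝ E) hn
        (show (0 : ℝ) < η by exact_mod_cast hη) (hτ k)
      obtain ⟨h1, h2⟩ := hB k (B k) subset_rfl (hBm k) t ht0 htτ
      rw [(hBinj k).volume_frustum (hBm k) ht0, ENNReal.ofReal_coe_nnreal] at h1 h2
      have ht0' : ENNReal.ofReal t ≠ 0 := by simpa using ht0
      have h3 : t ≤ ((1 + t) ^ finrank ℝ E - 1) / finrank ℝ E := by
        rw [le_div_iff₀ hn']
        have := one_add_mul_le_pow (show (-2 : ℝ) ≤ t by linarith) (finrank ℝ E)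
        linarith
      constructor
      · rw [← ENNReal.mul_le_mul_iff_right ht0' ENNReal.ofReal_ne_top]
        exact (mul_le_mul_left (ENNReal.ofReal_le_ofReal h3) _).trans h1
      · rw [← ENNReal.mul_le_mul_iff_right ht0' ENNReal.ofReal_ne_top]
        refine h2.trans ?_
        rw [mul_add]
        refine add_le_add_left ?_ _
        rw [← mul_assoc]
        refine mul_le_mul_left ?_ _
        refine (ENNReal.ofReal_le_ofReal ht).trans_eq ?_
        rw [mul_comm, ENNReal.ofReal_mul ht0.le, ENNReal.ofReal_add zero_le_one (by positivity),
          ENNReal.ofReal_one, ENNReal.ofReal_coe_nnreal]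
    have hΛs : Λ M = ∑' k, Λ (B k) := by
      simp only [hΛ]
      rw [indicator_partition hBd hBU]
      rw [← lintegral_tsum fun k => ((hBinj k).measurable_raySum (hBm k)).aemeasurable]
      exact lintegral_congr fun θ => raySum_tsum (fun k => measurable_one.indicator (hBm k)) θ
    rw [hΛs, measure_eq_tsum_of_partition (μ := supportMeasure ν) hBm hBd hBU,
      show m = _ from measure_eq_tsum_of_partition (μ := μHE[finrank ℝ E - 1]) hBm hBd hBU,
      ← ENNReal.tsum_mul_left, ← ENNReal.tsum_mul_left, ← ENNReal.tsum_add, ← ENNReal.tsum_add]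
    exact ⟨ENNReal.tsum_le_tsum fun k => (hk k).1, ENNReal.tsum_le_tsum fun k => (hk k).2⟩
  change Λ M = _
  apply le_antisymm
  · refine ENNReal.le_of_forall_pos_le_add fun ε hε _ => ?_
    obtain ⟨η, hη0, hη⟩ := ENNReal.exists_nnreal_pos_mul_lt hfin.ne
      (show (ε : ℝ≥0∞) ≠ 0 by exact_mod_cast hε.ne')
    exact (hbound η hη0).1.trans (by gcongr)
  · by_cases hΛtop : Λ M = ⊤
    · rw [hΛtop]; exact le_top
    refine ENNReal.le_of_forall_pos_le_add fun ε hε _ => ?_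
    obtain ⟨η, hη0, hη⟩ := ENNReal.exists_nnreal_pos_mul_lt
      (ENNReal.add_ne_top.2 ⟨hΛtop, hfin.ne⟩) (show (ε : ℝ≥0∞) ≠ 0 by exact_mod_cast hε.ne')
    refine (hbound η hη0).2.trans ?_
    calc _ = Λ M + η * (Λ M + m) := by ring
      _ ≤ _ := by gcongr

theorem raySum_add {F G : E → ℝ≥0∞} (hF : Measurable F) (θ : sphere (0 : E) 1) :
    raySum (fun y => F y + G y) θ = raySum F θ + raySum G θ := by
  simp only [raySum, mul_add]
  exact lintegral_add_left (measurable_raySum_integrand hF θ) _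

theorem raySum_const_mul {G : E → ℝ≥0∞} (hG : Measurable G) (c : ℝ≥0∞) (θ : sphere (0 : E) 1) :
    raySum (fun y => c * G y) θ = c * raySum G θ := by
  simp only [raySum, mul_left_comm _ c]
  exact lintegral_const_mul _ (measurable_raySum_integrand hG θ)

/-- The area formula for the radial projection of a radially injective set. -/
theorem HasNormal.lintegral_raySum_of_injective {M : Set E} {ν : E → E} (h : HasNormal M ν)
    (hM : MeasurableSet M) (hν : Measurable ν) (hinj : RadiallyInjective M)
    (hfin : μHE[finrank ℝ E - 1] M < ⊤) {F : E → ℝ≥0∞} (hF : Measurable F) :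
    Measurable (raySum (M.indicator F)) ∧
    ∫⁻ θ, raySum (M.indicator F) θ ∂(volume : Measure E).toSphere =
      ∫⁻ y in M, F y ∂(supportMeasure ν) := by
  refine Measurable.ennreal_induction (motive := fun F => Measurable (raySum (M.indicator F)) ∧
    ∫⁻ θ, raySum (M.indicator F) θ ∂(volume : Measure E).toSphere =
      ∫⁻ y in M, F y ∂(supportMeasure ν)) ?_ ?_ ?_ hF
  · intro c s hs
    have h1 : M.indicator (s.indicator fun _ => c) = fun y => c * (M ∩ s).indicator 1 y := by
      rw [indicator_indicator]
      ext y
      by_cases hy : y ∈ M ∩ s <;> simp [hy]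
    have h2 : raySum (M.indicator (s.indicator fun _ => c)) =
        fun θ => c * raySum ((M ∩ s).indicator 1) θ := by
      rw [h1]
      ext θ
      exact raySum_const_mul (measurable_one.indicator (hM.inter hs)) c θ
    have hinj' := hinj.mono (inter_subset_left (t := s))
    have hmeas := hinj'.measurable_raySum (hM.inter hs)
    rw [h2]
    refine ⟨hmeas.const_mul c, ?_⟩
    rw [lintegral_const_mul _ hmeas, (h.mono inter_subset_left).lintegral_raySum_indicator_one
      (hM.inter hs) hν hinj' ((measure_mono inter_subset_left).trans_lt hfin),
      lintegral_indicator hs, setLIntegral_const, Measure.restrict_apply hs, inter_comm]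
  · intro f g _ hf hg hf' hg'
    have h1 : raySum (M.indicator (f + g)) =
        fun θ => raySum (M.indicator f) θ + raySum (M.indicator g) θ := by
      ext θ
      rw [indicator_add']
      exact raySum_add (hf.indicator hM) θ
    rw [h1]
    refine ⟨hf'.1.add hg'.1, ?_⟩
    rw [lintegral_add_left hf'.1, hf'.2, hg'.2]
    exact (lintegral_add_left hf _).symm
  · intro f hf hmono hf'
    have hind : M.indicator (fun y => ⨆ i, f i y) = fun y => ⨆ i, M.indicator (f i) y := by
      ext y
      by_cases hy : y ∈ M <;> simp [hy]
    have hmono' : Monotone fun i => M.indicator (f i) := fun i j hij =>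
      fun y => indicator_le_indicator (hmono hij y)
    have h1 : raySum (M.indicator fun y => ⨆ i, f i y) =
        fun θ => ⨆ i, raySum (M.indicator (f i)) θ := by
      ext θ
      rw [hind]
      simp only [raySum, ENNReal.mul_iSup]
      refine lintegral_iSup (fun i => measurable_raySum_integrand ((hf i).indicator hM) θ) ?_
      intro i j hij r
      exact mul_le_mul_right (hmono' hij _) _
    rw [h1]
    refine ⟨Measurable.iSup fun i => (hf' i).1, ?_⟩
    rw [lintegral_iSup (fun i => (hf' i).1), lintegral_iSup hf hmono]
    · exact iSup_congr fun i => (hf' i).2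
    · intro i j hij θ
      exact lintegral_mono fun r => mul_le_mul_right (hmono' hij _) _

/-- A Sard-type statement, used to show that almost no ray is tangent to `M`. The tangential part is
cut into pieces of finite measure, which `HasNormal.volume_coneOf_eq_zero` requires. -/
theorem HasNormal.volume_coneOf_tangential {M : Set E} {ν : E → E} (h : HasNormal M ν)
    (hM : MeasurableSet M) (hν : Measurable ν) :
    volume (coneOf (M ∩ {y | ⟪ν y, y⟫ = 0})) = 0 := by
  set Z := M ∩ {y | ⟪ν y, y⟫ = 0} with hZ
  have hZm : MeasurableSet Z := hM.inter (measurableSet_eq_fun (by fun_prop) (by fun_prop))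
  rcases Z.eq_empty_or_nonempty with h0 | hne
  · rw [h0]; simp [coneOf]
  have hZn : HasNormal Z ν := h.mono inter_subset_left
  obtain ⟨B, hBm, hBd, hBU, hBfin, -⟩ := hZn.exists_finite_partition hZm hν hne
  have hsub : coneOf Z ⊆ ⋃ k, coneOf (B k) := by
    rintro _ ⟨r, hr, y, hy, rfl⟩
    rw [← hBU] at hy
    obtain ⟨k, hk⟩ := mem_iUnion.1 hy
    exact mem_iUnion.2 ⟨k, r, hr, y, hk, rfl⟩
  refine measure_mono_null hsub (measure_iUnion_null fun k => ?_)
  have hBZ : B k ⊆ Z := hBU ▸ subset_iUnion B k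
  exact (hZn.mono hBZ).volume_coneOf_eq_zero (hBm k) hν (fun y hy => (hBZ hy).2) (hBfin k)

/-- The area formula for the radial projection. -/
theorem HasNormal.lintegral_raySum {M : Set E} {ν : E → E} (h : HasNormal M ν)
    (hM : MeasurableSet M) (hν : Measurable ν) {F : E → ℝ≥0∞} (hF : Measurable F) :
    AEMeasurable (raySum (M.indicator F)) (volume : Measure E).toSphere ∧
    ∫⁻ θ, raySum (M.indicator F) θ ∂(volume : Measure E).toSphere =
      ∫⁻ y in M, F y ∂(supportMeasure ν) := by
  have hin : MeasurableSet {y | ⟪ν y, y⟫ = 0} := measurableSet_eq_fun (by fun_prop) (by fun_prop)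
  -- The tangential part `Z` contributes nothing to either side: almost every ray misses it, and the
  -- support density vanishes on it. The rest is a countable union of radially injective pieces.
  set Z := M ∩ {y | ⟪ν y, y⟫ = 0} with hZ
  set T := M \ {y | ⟪ν y, y⟫ = 0} with hT
  have hZm : MeasurableSet Z := hM.inter hin
  have hTm : MeasurableSet T := hM.diff hin
  have hTpart : AEMeasurable (raySum (T.indicator F)) (volume : Measure E).toSphere ∧
      ∫⁻ θ, raySum (T.indicator F) θ ∂(volume : Measure E).toSphere =
        ∫⁻ y in T, F y ∂(supportMeasure ν) := by
    rcases T.eq_empty_or_nonempty with h0 | hne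
    · have : raySum ((∅ : Set E).indicator F) = fun _ => 0 := by ext θ; simp [raySum]
      rw [h0, this]
      simp
    have hTn : HasNormal T ν := h.mono sdiff_subset
    obtain ⟨B, hBm, hBd, hBU, hBfin, hBinj⟩ := hTn.exists_finite_partition hTm hν hne
    have hBinj' := hBinj fun y hy => hy.2
    have hk := fun k => (hTn.mono (hBU ▸ subset_iUnion B k)).lintegral_raySum_of_injective (hBm k)
      hν (hBinj' k) (hBfin k) hF
    have h1 : raySum (T.indicator F) = fun θ => ∑' k, raySum ((B k).indicator F) θ := by
      rw [indicator_partition hBd hBU]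
      ext θ
      exact raySum_tsum (fun k => hF.indicator (hBm k)) θ
    rw [h1]
    refine ⟨(Measurable.tsum fun k => (hk k).1).aemeasurable, ?_⟩
    rw [lintegral_tsum fun k => (hk k).1.aemeasurable, ← hBU, lintegral_iUnion hBm hBd]
    exact tsum_congr fun k => (hk k).2
  have hcone : volume (coneOf Z) = 0 := h.volume_coneOf_tangential hM hν
  have hae : raySum (M.indicator F) =ᵐ[(volume : Measure E).toSphere] raySum (T.indicator F) := by
    filter_upwards [ae_ray_notMem hcone] with θ hθ
    refine lintegral_congr fun r => ?_
    congr 1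
    have h1 := hθ r r.2
    by_cases hr : (r : ℝ) • (θ : E) ∈ M
    · have : (r : ℝ) • (θ : E) ∈ T := ⟨hr, fun h0 => h1 ⟨hr, h0⟩⟩
      simp [hr, this]
    · have : (r : ℝ) • (θ : E) ∉ T := fun h0 => hr h0.1
      simp [hr, this]
  refine ⟨hTpart.1.congr hae.symm, ?_⟩
  rw [lintegral_congr_ae hae, hTpart.2]
  have hsZ : supportMeasure ν Z = 0 := by
    rw [supportMeasure, withDensity_apply _ hZm, setLIntegral_congr_fun hZm
      (g := fun _ => 0), lintegral_zero]
    intro y hy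
    simp [show ⟪ν y, y⟫ = 0 from hy.2]
  have hMZ : M = T ∪ Z := by rw [hT, hZ, sdiff_union_inter]
  refine setLIntegral_congr ?_
  rw [hMZ]
  exact (union_ae_eq_left_of_ae_eq_empty (ae_eq_empty.2 hsZ)).symm

end AreaFormula

/-! ### The one-dimensional divergence inequality on a ray. -/

section Ray

/-- The function `r ^ n * e^{-f r}`. -/
noncomputable def rayFlux (n : ℕ) (f : ℝ → ℝ) (r : ℝ) : ℝ := r ^ n * Real.exp (-f r)

/-- The function `r ^ (n - 1) * e^{-f r} * (n + f 0 - f r)`, an upper bound for the derivative of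
`rayFlux n f` if `f` is convex. -/
noncomputable def rayBound (n : ℕ) (f : ℝ → ℝ) (r : ℝ) : ℝ :=
  r ^ (n - 1) * (Real.exp (-f r) * (n + f 0 - f r))

theorem rayFlux_nonneg {n : ℕ} {f : ℝ → ℝ} {r : ℝ} (hr : 0 ≤ r) : 0 ≤ rayFlux n f r :=
  mul_nonneg (pow_nonneg hr n) (Real.exp_pos _).le

theorem subgradient_rightDeriv {D : Set ℝ} {f : ℝ → ℝ} (hf : ConvexOn ℝ D f) {r s : ℝ}
    (hr : r ∈ interior D) (hs : s ∈ D) : f r + derivWithin f (Ioi r) r * (s - r) ≤ f s := by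
  rcases lt_trichotomy s r with h | rfl | h
  · have h1 := (hf.slope_le_leftDeriv_of_mem_interior hs hr h).trans
      (hf.leftDeriv_le_rightDeriv_of_mem_interior hr)
    rw [slope_def_field, div_le_iff₀ (sub_pos.2 h)] at h1
    linarith
  · simp
  · have h1 := hf.rightDeriv_le_slope_of_mem_interior hr hs h
    rw [slope_def_field, le_div_iff₀ (sub_pos.2 h)] at h1
    linarith

theorem hasDerivWithinAt_rayFlux {D : Set ℝ} {f : ℝ → ℝ} (hf : ConvexOn ℝ D f) {n : ℕ}
    (hn : 1 ≤ n) {r : ℝ} (hr : r ∈ interior D) :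
    HasDerivWithinAt (rayFlux n f)
      (r ^ (n - 1) * (Real.exp (-f r) * (n - r * derivWithin f (Ioi r) r))) (Ioi r) r := by
  have h1 := hf.hasDerivWithinAt_rightDeriv_of_mem_interior hr
  have h2 := ((hasDerivWithinAt_id r (Ioi r)).fun_pow n).fun_mul h1.fun_neg.exp
  refine h2.congr_deriv ?_
  obtain ⟨m, rfl⟩ : ∃ m, n = m + 1 := ⟨n - 1, by omega⟩
  simp only [id, Nat.add_sub_cancel]
  ring

/-- The subgradient inequality at `r`, tested at `0`, reads `f r - r f'(r) ≤ f 0`. The only loss is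
the gap at `0` between `f` and its supporting line at `r`; the equality case rests on this. -/
theorem rayFlux_deriv_le {D : Set ℝ} {f : ℝ → ℝ} (hf : ConvexOn ℝ D f) (n : ℕ) {r : ℝ}
    (h0 : 0 ∈ D) (hr0 : 0 ≤ r) (hr : r ∈ interior D) :
    r ^ (n - 1) * (Real.exp (-f r) * (n - r * derivWithin f (Ioi r) r)) ≤ rayBound n f r := by
  have := subgradient_rightDeriv hf hr h0
  unfold rayBound
  refine mul_le_mul_of_nonneg_left (mul_le_mul_of_nonneg_left ?_ (Real.exp_pos _).le)
    (pow_nonneg hr0 _)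
  linarith

/-- A ray in the domain of a convex function, together with its intersection `A` with a set whose
boundary points lie in `P`. -/
structure IsRay (n : ℕ) (f : ℝ → ℝ) (D A P : Set ℝ) : Prop where
  one_le : 1 ≤ n
  convexOn : ConvexOn ℝ D f
  zero_mem : 0 ∈ D
  bddBelow : ∃ C, ∀ r ∈ D, C ≤ f r
  integrableOn : IntegrableOn (rayBound n f) (D ∩ Ioi 0)
  measurableSet : MeasurableSet A
  mem_interior : ∀ r ∈ D, 0 < r → r ∉ P → r ∈ interior A ∨ r ∈ interior Aᶜ
  finite : ∀ a b : ℝ, 0 < a → b ∈ D → (P ∩ Ioo a b).Finite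

namespace IsRay

variable {n : ℕ} {f : ℝ → ℝ} {D A P : Set ℝ}

theorem ordConnected (h : IsRay n f D A P) : D.OrdConnected := h.convexOn.1.ordConnected

theorem Ioo_subset_interior (h : IsRay n f D A P) {b : ℝ} (hb : b ∈ D) :
    Ioo 0 b ⊆ interior D :=
  interior_maximal (Ioo_subset_Icc_self.trans (h.ordConnected.out h.zero_mem hb)) isOpen_Ioo

theorem Icc_subset (h : IsRay n f D A P) {a b : ℝ} (ha : 0 < a) (hb : b ∈ D) :
    Icc a b ⊆ D ∩ Ioi 0 := fun _ hr =>
  ⟨h.ordConnected.out h.zero_mem hb ⟨(ha.trans_le hr.1).le, hr.2⟩, ha.trans_le hr.1⟩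

theorem continuousOn_interior (h : IsRay n f D A P) : ContinuousOn f (interior D) :=
  h.convexOn.continuousOn_interior

theorem continuousOn_rayFlux (h : IsRay n f D A P) :
    ContinuousOn (rayFlux n f) (interior D) := by
  have := h.continuousOn_interior
  unfold rayFlux
  fun_prop

theorem continuousOn_rayBound (h : IsRay n f D A P) :
    ContinuousOn (rayBound n f) (interior D) := by
  have := h.continuousOn_interior
  unfold rayBound
  fun_prop

theorem rayFlux_sub_le_of_interior (h : IsRay n f D A P) {a b : ℝ} (ha : 0 < a) (hab : a ≤ b)
    (hb : b ∈ interior D) :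
    rayFlux n f b - rayFlux n f a ≤ ∫ r in a..b, rayBound n f r := by
  have hbD := interior_subset hb
  have hsub : Icc a b ⊆ interior D := fun r hr => by
    rcases hr.2.lt_or_eq with h1 | rfl
    · exact h.Ioo_subset_interior hbD ⟨ha.trans_le hr.1, h1⟩
    · exact hb
  refine intervalIntegral.sub_le_integral_of_hasDeriv_right_of_le hab
    (h.continuousOn_rayFlux.mono hsub) (fun r hr => hasDerivWithinAt_rayFlux h.convexOn h.one_le
      (hsub (Ioo_subset_Icc_self hr))) (h.integrableOn.mono_set (h.Icc_subset ha hbD))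
      fun r hr => rayFlux_deriv_le h.convexOn n h.zero_mem (ha.trans hr.1).le
        (hsub (Ioo_subset_Icc_self hr))

/-- At an endpoint `b` of `D` the function `f` may jump upwards, so the flux need not be continuous
there. The chord `l` lies above `f` and is continuous with `l b = f b`, so the bound passes to the
limit `s → b`. -/
theorem rayFlux_sub_le (h : IsRay n f D A P) {a b : ℝ} (ha : 0 < a) (hab : a < b) (hb : b ∈ D) :
    rayFlux n f b - rayFlux n f a ≤ ∫ r in a..b, rayBound n f r := by
  set l : ℝ → ℝ := fun s => ((b - s) * f a + (s - a) * f b) / (b - a) with hl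
  have hba : 0 < b - a := sub_pos.2 hab
  have haD : a ∈ D := (h.Icc_subset ha hb ⟨le_rfl, hab.le⟩).1
  have h1 : ∀ s ∈ Ioo a b, s ^ n * Real.exp (-l s) - rayFlux n f a ≤
      ∫ r in a..s, rayBound n f r := by
    intro s hs
    have h2 := h.rayFlux_sub_le_of_interior ha hs.1.le
      (h.Ioo_subset_interior hb ⟨ha.trans hs.1, hs.2⟩)
    refine le_trans (sub_le_sub_right ?_ _) h2
    have h3 : f s ≤ l s := by
      have := h.convexOn.2 haD hb
        (div_nonneg (sub_nonneg.2 hs.2.le) hba.le) (div_nonneg (sub_nonneg.2 hs.1.le) hba.le)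
        (by field_simp; ring)
      have h4 : ((b - s) / (b - a)) • a + ((s - a) / (b - a)) • b = s := by
        simp only [smul_eq_mul]; field_simp; ring
      rw [h4] at this
      refine this.trans_eq ?_
      simp only [smul_eq_mul, hl]; field_simp
    unfold rayFlux
    have hs0 : 0 < s := ha.trans hs.1
    gcongr
  have h2 : Tendsto (fun s => s ^ n * Real.exp (-l s) - rayFlux n f a) (𝓝[Ioo a b] b)
      (𝓝 (b ^ n * Real.exp (-l b) - rayFlux n f a)) := by
    have : Continuous fun s => s ^ n * Real.exp (-l s) - rayFlux n f a := by
      simp only [hl]; fun_prop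
    exact (this.tendsto b).mono_left nhdsWithin_le_nhds
  have h3 : Tendsto (fun s => ∫ r in a..s, rayBound n f r) (𝓝[Ioo a b] b)
      (𝓝 (∫ r in a..b, rayBound n f r)) := by
    have hint : IntegrableOn (rayBound n f) (uIcc a b) := by
      rw [uIcc_of_le hab.le]; exact h.integrableOn.mono_set (h.Icc_subset ha hb)
    have := intervalIntegral.continuousOn_primitive_interval hint b right_mem_uIcc
    rw [uIcc_of_le hab.le] at this
    exact this.mono_left (nhdsWithin_mono _ Ioo_subset_Icc_self)
  have h4 : l b = f b := by simp only [hl]; field_simp; ring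
  rw [h4] at h2
  have : (𝓝[Ioo a b] b).NeBot := right_nhdsWithin_Ioo_neBot hab
  exact le_of_tendsto_of_tendsto h2 h3 (eventually_nhdsWithin_of_forall h1)

end IsRay

open Classical in
/-- `1` if `A` occupies a left neighbourhood of `r`, `0` otherwise. -/
noncomputable def leftInd (A : Set ℝ) (r : ℝ) : ℝ := if ∀ᶠ s in 𝓝[<] r, s ∈ A then 1 else 0

open Classical in
/-- `1` if `A` occupies a right neighbourhood of `r`, `0` otherwise. -/
noncomputable def rightInd (A : Set ℝ) (r : ℝ) : ℝ := if ∀ᶠ s in 𝓝[>] r, s ∈ A then 1 else 0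

theorem rightInd_nonneg (A : Set ℝ) (r : ℝ) : 0 ≤ rightInd A r := by
  unfold rightInd; split_ifs <;> norm_num

theorem rightInd_le_one (A : Set ℝ) (r : ℝ) : rightInd A r ≤ 1 := by
  unfold rightInd; split_ifs <;> norm_num

theorem leftInd_eq_one {A : Set ℝ} {r : ℝ} (h : A ∈ 𝓝[<] r) : leftInd A r = 1 := if_pos h

theorem rightInd_eq_one {A : Set ℝ} {r : ℝ} (h : A ∈ 𝓝[>] r) : rightInd A r = 1 := if_pos h

theorem leftInd_eq_zero {A : Set ℝ} {r : ℝ} (h : ∀ᶠ s in 𝓝[<] r, s ∉ A) : leftInd A r = 0 := by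
  rw [leftInd, if_neg]
  intro h'
  exact (h.and h').exists.elim fun s hs => hs.1 hs.2

theorem rightInd_eq_zero {A : Set ℝ} {r : ℝ} (h : ∀ᶠ s in 𝓝[>] r, s ∉ A) : rightInd A r = 0 := by
  rw [rightInd, if_neg]
  intro h'
  exact (h.and h').exists.elim fun s hs => hs.1 hs.2

/-- The contribution of `r` to the boundary sum on a ray. -/
noncomputable def rayJump (n : ℕ) (f : ℝ → ℝ) (A : Set ℝ) (r : ℝ) : ℝ :=
  (leftInd A r - rightInd A r) * rayFlux n f r

theorem rayJump_eq_zero {n : ℕ} {f : ℝ → ℝ} {A : Set ℝ} {r : ℝ}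
    (h : r ∈ interior A ∨ r ∈ interior Aᶜ) : rayJump n f A r = 0 := by
  rcases h with h | h
  · have h1 : ∀ᶠ s in 𝓝 r, s ∈ A := mem_interior_iff_mem_nhds.1 h
    rw [rayJump, leftInd, rightInd, if_pos (h1.filter_mono nhdsWithin_le_nhds),
      if_pos (h1.filter_mono nhdsWithin_le_nhds)]
    simp
  · have h1 : ∀ᶠ s in 𝓝 r, s ∉ A := mem_interior_iff_mem_nhds.1 h
    rw [rayJump, leftInd_eq_zero (h1.filter_mono nhdsWithin_le_nhds),
      rightInd_eq_zero (h1.filter_mono nhdsWithin_le_nhds)]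
    simp

/-- The defect in the one-dimensional divergence inequality. -/
noncomputable def rayDefect (n : ℕ) (f : ℝ → ℝ) (A : Set ℝ) (a b : ℝ) : ℝ :=
  (∫ r in a..b, A.indicator (rayBound n f) r) -
    (leftInd A b * rayFlux n f b - rightInd A a * rayFlux n f a +
      ∑' r, (Ioo a b).indicator (rayJump n f A) r)

namespace IsRay

variable {n : ℕ} {f : ℝ → ℝ} {D A P : Set ℝ}

theorem intervalIntegrable_indicator (h : IsRay n f D A P) {a b : ℝ} (ha : 0 < a) (hab : a ≤ b)
    (hb : b ∈ D) : IntervalIntegrable (A.indicator (rayBound n f)) volume a b := by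
  rw [intervalIntegrable_iff_integrableOn_Icc_of_le hab]
  exact (h.integrableOn.mono_set (h.Icc_subset ha hb)).indicator h.measurableSet

theorem summable_of_subset
    (hs : Summable ((D ∩ Ioi 0).indicator (rayJump n f A))) {S : Set ℝ} (hS : S ⊆ D ∩ Ioi 0) :
    Summable (S.indicator (rayJump n f A)) := by
  have := hs.indicator S
  rwa [indicator_indicator, inter_eq_left.2 hS] at this

/-- The jump at `c`, counted in the sum over `(a, b)`, splits into the left term closing `(a, c)`
and the right term opening `(c, b)`. -/
theorem rayDefect_add (h : IsRay n f D A P)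
    (hs : Summable ((D ∩ Ioi 0).indicator (rayJump n f A))) {a c b : ℝ} (ha : 0 < a) (hac : a < c)
    (hcb : c < b) (hb : b ∈ D) :
    rayDefect n f A a b = rayDefect n f A a c + rayDefect n f A c b := by
  have hsub := h.Icc_subset ha hb
  have hcD : c ∈ D := (hsub ⟨hac.le, hcb.le⟩).1
  have h1 := intervalIntegral.integral_add_adjacent_intervals
    (h.intervalIntegrable_indicator ha hac.le hcD)
    (h.intervalIntegrable_indicator (ha.trans hac) hcb.le hb)
  have h2 : (Ioo a b).indicator (rayJump n f A) = fun r =>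
      (Ioo a c).indicator (rayJump n f A) r + (({c} : Set ℝ).indicator (rayJump n f A) r +
        (Ioo c b).indicator (rayJump n f A) r) := by
    ext r
    rcases lt_trichotomy r c with hr | rfl | hr
    · by_cases har : a < r
      · simp [indicator, hr, har, hr.trans hcb, hr.not_gt, hr.ne]
      · simp [indicator, har, hr.not_gt, hr.ne]
    · simp [indicator, hac, hcb]
    · by_cases hrb : r < b
      · simp [indicator, hr, hrb, hac.trans hr, hr.not_gt, hr.ne']
      · simp [indicator, hrb, hr.not_gt, hr.ne']
  have h3 : ∑' r, (Ioo a b).indicator (rayJump n f A) r =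
      ∑' r, (Ioo a c).indicator (rayJump n f A) r + (rayJump n f A c +
        ∑' r, (Ioo c b).indicator (rayJump n f A) r) := by
    have s1 := summable_of_subset hs (S := Ioo a c) fun r hr =>
      hsub ⟨hr.1.le, (hr.2.trans hcb).le⟩
    have s2 := summable_of_subset hs (S := Ioo c b) fun r hr =>
      hsub ⟨(hac.trans hr.1).le, hr.2.le⟩
    have s3 := summable_of_subset hs (S := {c}) (by
      rintro r rfl; exact hsub ⟨hac.le, hcb.le⟩)
    rw [h2, s1.tsum_add (s3.add s2), s3.tsum_add s2,
      tsum_eq_single c (f := ({c} : Set ℝ).indicator (rayJump n f A))]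
    · simp
    · intro r hr; simp [hr]
  rw [rayDefect, rayDefect, rayDefect, ← h1, h3, rayJump]
  ring

/-- Without boundary points the connected interval lies in `A`, where this is `rayFlux_sub_le`, or
in the complement, where every term is `0`. -/
theorem rayDefect_nonneg_of_disjoint (h : IsRay n f D A P) {a b : ℝ} (ha : 0 < a) (hab : a < b)
    (hb : b ∈ D) (hP : P ∩ Ioo a b = ∅) : 0 ≤ rayDefect n f A a b := by
  have hsub := h.Icc_subset ha hb
  have hint : ∀ r ∈ Ioo a b, r ∈ interior A ∨ r ∈ interior Aᶜ := fun r hr =>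
    h.mem_interior r (hsub (Ioo_subset_Icc_self hr)).1 (ha.trans hr.1) fun hrP => by
      have : r ∈ P ∩ Ioo a b := ⟨hrP, hr⟩
      rw [hP] at this; exact this
  have hsum : ∑' r, (Ioo a b).indicator (rayJump n f A) r = 0 := by
    rw [← tsum_zero (β := ℝ)]
    refine tsum_congr fun r => ?_
    by_cases hr : r ∈ Ioo a b
    · rw [indicator_of_mem hr, rayJump_eq_zero (hint r hr)]
    · rw [indicator_of_notMem hr]
  have hor : Ioo a b ⊆ A ∨ Ioo a b ⊆ Aᶜ := by
    have hpc : IsPreconnected (Ioo a b) := isPreconnected_Ioo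
    rcases isPreconnected_iff_subset_of_disjoint.1 hpc _ _ isOpen_interior isOpen_interior
      (fun r hr => hint r hr) (by
        rw [eq_empty_iff_forall_notMem]
        rintro r ⟨-, h1, h2⟩
        exact interior_subset h2 (interior_subset h1)) with h1 | h1
    · exact Or.inl (h1.trans interior_subset)
    · exact Or.inr (h1.trans interior_subset)
  have hleft : Ioo a b ∈ 𝓝[<] b := Ioo_mem_nhdsLT hab
  have hright : Ioo a b ∈ 𝓝[>] a := Ioo_mem_nhdsGT hab
  rw [rayDefect, hsum]
  rcases hor with hA | hA
  · rw [leftInd_eq_one (mem_of_superset hleft hA), rightInd_eq_one (mem_of_superset hright hA),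
      intervalIntegral.integral_congr_Ioo_of_le hab.le
        (g := rayBound n f) (fun r hr => indicator_of_mem (hA hr) _)]
    linarith [h.rayFlux_sub_le ha hab hb]
  · rw [leftInd_eq_zero (mem_of_superset hleft hA), rightInd_eq_zero (mem_of_superset hright hA),
      intervalIntegral.integral_congr_Ioo_of_le hab.le
        (g := fun _ => 0) (fun r hr => indicator_of_notMem (hA hr) _)]
    simp

/-- Additivity allows cutting the interval at its finitely many boundary points. -/
theorem rayDefect_nonneg (h : IsRay n f D A P)
    (hs : Summable ((D ∩ Ioi 0).indicator (rayJump n f A))) {a b : ℝ} (ha : 0 < a) (hab : a < b)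
    (hb : b ∈ D) : 0 ≤ rayDefect n f A a b := by
  have key : ∀ F : Finset ℝ, ∀ a b : ℝ, 0 < a → a < b → b ∈ D → P ∩ Ioo a b ⊆ F →
      0 ≤ rayDefect n f A a b := by
    intro F
    induction F using Finset.induction_on with
    | empty =>
      intro a b ha hab hb hP
      exact h.rayDefect_nonneg_of_disjoint ha hab hb (subset_empty_iff.1 (by simpa using hP))
    | insert c F _ ih =>
      intro a b ha hab hb hP
      by_cases hc : c ∈ Ioo a b
      · rw [h.rayDefect_add hs ha hc.1 hc.2 hb]
        have hcD : c ∈ D := (h.Icc_subset ha hb (Ioo_subset_Icc_self hc)).1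
        refine add_nonneg (ih a c ha hc.1 hcD fun r hr => ?_)
          (ih c b (ha.trans hc.1) hc.2 hb fun r hr => ?_)
        · have h1 := hP ⟨hr.1, hr.2.1, hr.2.2.trans hc.2⟩
          simpa [hr.2.2.ne] using h1
        · have h1 := hP ⟨hr.1, hc.1.trans hr.2.1, hr.2.2⟩
          simpa [hr.2.1.ne'] using h1
      · refine ih a b ha hab hb fun r hr => ?_
        have h1 := hP hr
        have h2 : r ≠ c := by rintro rfl; exact hc hr.2
        simpa [h2] using h1
  exact key (h.finite a b ha hb).toFinset a b ha hab hb (by simp)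

theorem rayDefect_mono (h : IsRay n f D A P)
    (hs : Summable ((D ∩ Ioi 0).indicator (rayJump n f A))) {a a' b' b : ℝ} (ha : 0 < a)
    (haa : a ≤ a') (hab : a' < b') (hbb : b' ≤ b) (hb : b ∈ D) :
    rayDefect n f A a' b' ≤ rayDefect n f A a b := by
  have hb'D : b' ∈ D := (h.Icc_subset ha hb ⟨(haa.trans_lt hab).le, hbb⟩).1
  have h1 : rayDefect n f A a' b' ≤ rayDefect n f A a b' := by
    rcases haa.lt_or_eq with h2 | rfl
    · rw [h.rayDefect_add hs ha h2 hab hb'D]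
      linarith [h.rayDefect_nonneg hs ha h2 (h.Icc_subset ha hb'D ⟨haa, hab.le⟩).1]
    · exact le_rfl
  refine h1.trans ?_
  rcases hbb.lt_or_eq with h2 | rfl
  · rw [h.rayDefect_add hs ha (haa.trans_lt hab) h2 hb]
    linarith [h.rayDefect_nonneg hs (ha.trans_le (haa.trans hab.le)) h2 hb]
  · exact le_rfl

/-- The point `b` is included because `D` may contain its right end. Adding its jump cancels the
left term at `b` and leaves a nonpositive right term; the term at `a` is at most the flux there. -/
theorem tsum_Ioc_le (h : IsRay n f D A P)
    (hs : Summable ((D ∩ Ioi 0).indicator (rayJump n f A))) {a b : ℝ} (ha : 0 < a)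
    (hab : a < b) (hb : b ∈ D) :
    ∑' r, (Ioc a b).indicator (rayJump n f A) r + rayDefect n f A a b ≤
      (∫ r in Ioc a b, A.indicator (rayBound n f) r) + rayFlux n f a := by
  have hsub := h.Icc_subset ha hb
  have h2 : (Ioc a b).indicator (rayJump n f A) = fun r =>
      (Ioo a b).indicator (rayJump n f A) r + (({b} : Set ℝ).indicator (rayJump n f A) r) := by
    ext r
    rcases lt_trichotomy r b with hr | rfl | hr
    · by_cases har : a < r
      · simp [indicator, hr, har, hr.le, hr.ne]
      · simp [indicator, har, hr.ne]
    · simp [indicator, hab]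
    · simp [indicator, hr.not_gt, hr.not_ge, hr.ne']
  have h3 : ∑' r, (Ioc a b).indicator (rayJump n f A) r =
      ∑' r, (Ioo a b).indicator (rayJump n f A) r + rayJump n f A b := by
    have s1 := summable_of_subset hs (S := Ioo a b) fun r hr => hsub (Ioo_subset_Icc_self hr)
    have s3 := summable_of_subset hs (S := {b}) (by
      rintro r rfl; exact hsub ⟨hab.le, le_rfl⟩)
    rw [h2, s1.tsum_add s3, tsum_eq_single b (f := ({b} : Set ℝ).indicator (rayJump n f A))]
    · simp
    · intro r hr; simp [hr]
  rw [h3, rayDefect, intervalIntegral.integral_of_le hab.le, rayJump]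
  have h4 := mul_nonneg (rightInd_nonneg A b) (rayFlux_nonneg (n := n) (f := f) (ha.trans hab).le)
  have h5 := mul_le_of_le_one_left (rayFlux_nonneg (n := n) (f := f) ha.le) (rightInd_le_one A a)
  linarith

end IsRay

/-- Used to exhaust the domain of a ray whether its right end is attained, not attained or infinite:
a constant sequence at a maximum, otherwise the running maxima of a dense sequence. -/
theorem exists_monotone_cofinal_seq {S : Set ℝ} (hS : S.Nonempty) :
    ∃ u : ℕ → ℝ, Monotone u ∧ (∀ k, u k ∈ S) ∧ ∀ s ∈ S, ∃ k, s ≤ u k := by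
  by_cases hmax : ∃ m ∈ S, ∀ s ∈ S, s ≤ m
  · obtain ⟨m, hm, h⟩ := hmax
    exact ⟨fun _ => m, monotone_const, fun _ => hm, fun s hs => ⟨0, h s hs⟩⟩
  · push Not at hmax
    have : Nonempty S := hS.to_subtype
    refine ⟨fun k => (partialSups (TopologicalSpace.denseSeq S) k : S), fun i j hij =>
      Subtype.coe_le_coe.2 ((partialSups _).monotone hij), fun k => Subtype.coe_prop _, fun s hs => ?_⟩
    obtain ⟨t, ht, hst⟩ := hmax s hs
    obtain ⟨k, hk⟩ := (TopologicalSpace.denseRange_denseSeq S).exists_mem_open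
      (isOpen_lt (continuous_const (y := s)) continuous_subtype_val) ⟨⟨t, ht⟩, hst⟩
    refine ⟨k, (le_of_lt hk).trans ?_⟩
    exact le_partialSups (TopologicalSpace.denseSeq S) k

namespace IsRay

variable {n : ℕ} {f : ℝ → ℝ} {D A P : Set ℝ}

/-- The lower bound on `f` keeps `e^{-f}` bounded, and `r ^ n → 0` because `n ≥ 1`; hence the apex
of the rays contributes no flux. -/
theorem tendsto_rayFlux (h : IsRay n f D A P) {a : ℕ → ℝ} (ha : Tendsto a atTop (𝓝 0))
    (ha0 : ∀ k, 0 < a k) (haD : ∀ k, a k ∈ D) :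
    Tendsto (fun k => rayFlux n f (a k)) atTop (𝓝 0) := by
  obtain ⟨C, hC⟩ := h.bddBelow
  have h1 : Tendsto (fun k => a k ^ n * Real.exp (-C)) atTop (𝓝 0) := by
    have := (ha.pow n).mul_const (Real.exp (-C))
    rwa [zero_pow (by have := h.one_le; omega), zero_mul] at this
  refine squeeze_zero (fun k => rayFlux_nonneg (ha0 k).le) (fun k => ?_) h1
  unfold rayFlux
  have := (ha0 k).le
  gcongr
  exact hC _ (haD k)

/-- The one-dimensional divergence inequality on a ray. -/
theorem tsum_rayJump_add_le (h : IsRay n f D A P)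
    (hs : Summable ((D ∩ Ioi 0).indicator (rayJump n f A))) :
    ∑' r, (D ∩ Ioi 0).indicator (rayJump n f A) r ≤
      (∫ r in D ∩ Ioi 0, A.indicator (rayBound n f) r) ∧
    ∀ a b : ℝ, 0 < a → a < b → b ∈ D →
      ∑' r, (D ∩ Ioi 0).indicator (rayJump n f A) r + rayDefect n f A a b ≤
        (∫ r in D ∩ Ioi 0, A.indicator (rayBound n f) r) := by
  rcases (D ∩ Ioi 0).eq_empty_or_nonempty with hemp | hne
  · rw [hemp]
    refine ⟨by simp, fun a b ha hab hb => ?_⟩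
    have : b ∈ D ∩ Ioi 0 := ⟨hb, ha.trans hab⟩
    rw [hemp] at this; exact this.elim
  obtain ⟨u, hu, huD, hucof⟩ := exists_monotone_cofinal_seq hne
  have hu0 : 0 < u 0 := (huD 0).2
  -- With `k + 2` the sequence decreases to `0` and stays strictly below `u 0`, also at `k = 0`.
  set a : ℕ → ℝ := fun k => u 0 / (k + 2) with ha
  have ha0 : ∀ k, 0 < a k := fun k => by positivity
  have hau : ∀ k, a k < u k := fun k => by
    refine lt_of_lt_of_le ?_ (hu (Nat.zero_le k))
    rw [ha]; simp only
    rw [div_lt_iff₀ (by positivity)]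
    have : (0 : ℝ) ≤ k := by positivity
    nlinarith
  have hanti : ∀ i j, i ≤ j → a j ≤ a i := fun i j hij => by
    simp only [ha]
    gcongr
  have haD : ∀ k, a k ∈ D := fun k => (h.Icc_subset (ha0 k) (huD k).1 ⟨le_rfl, (hau k).le⟩).1
  have hat : Tendsto a atTop (𝓝 0) := by
    have h1 : Tendsto (fun k : ℕ => (k : ℝ) + 2) atTop atTop :=
      tendsto_atTop_add_const_right _ _ tendsto_natCast_atTop_atTop
    exact tendsto_const_nhds.div_atTop h1
  have hmono : Monotone fun k => Ioc (a k) (u k) := fun i j hij =>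
    Ioc_subset_Ioc (hanti i j hij) (hu hij)
  have hev : ∀ r ∈ D ∩ Ioi 0, ∀ᶠ k in atTop, r ∈ Ioc (a k) (u k) := by
    intro r hr
    obtain ⟨k₀, hk₀⟩ := hucof r hr
    filter_upwards [hat.eventually (gt_mem_nhds (show (0 : ℝ) < r from hr.2)),
      eventually_ge_atTop k₀] with k h1 h2
    exact ⟨h1, hk₀.trans (hu h2)⟩
  have hsubk : ∀ k, Ioc (a k) (u k) ⊆ D ∩ Ioi 0 := fun k =>
    Ioc_subset_Icc_self.trans (h.Icc_subset (ha0 k) (huD k).1)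
  have hU : (⋃ k, Ioc (a k) (u k)) = D ∩ Ioi 0 := by
    refine Subset.antisymm (iUnion_subset hsubk) fun r hr => ?_
    exact mem_iUnion.2 (hev r hr).exists
  have hint : IntegrableOn (A.indicator (rayBound n f)) (D ∩ Ioi 0) :=
    h.integrableOn.indicator h.measurableSet
  have hlim1 : Tendsto (fun k => ∫ r in Ioc (a k) (u k), A.indicator (rayBound n f) r) atTop
      (𝓝 (∫ r in D ∩ Ioi 0, A.indicator (rayBound n f) r)) := by
    have := tendsto_setIntegral_of_monotone (fun k => measurableSet_Ioc) hmono (hU ▸ hint)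
    rwa [hU] at this
  have hlim2 : Tendsto (fun k => ∑' r, (Ioc (a k) (u k)).indicator (rayJump n f A) r) atTop
      (𝓝 (∑' r, (D ∩ Ioi 0).indicator (rayJump n f A) r)) := by
    refine tendsto_tsum_of_dominated_convergence hs.norm (fun r => ?_)
      (Eventually.of_forall fun k r => ?_)
    · by_cases hr : r ∈ D ∩ Ioi 0
      · refine tendsto_const_nhds.congr' ?_
        filter_upwards [hev r hr] with k hk
        rw [indicator_of_mem hk, indicator_of_mem hr]
      · refine tendsto_const_nhds.congr fun k => ?_
        rw [indicator_of_notMem hr, indicator_of_notMem fun hk => hr (hsubk k hk)]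
    · exact norm_indicator_le_of_subset (hsubk k) _ _
  have hlim3 := h.tendsto_rayFlux hat ha0 haD
  have hlim := hlim1.add hlim3
  rw [add_zero] at hlim
  have hge := fun k => h.tsum_Ioc_le hs (ha0 k) (hau k) (huD k).1
  constructor
  · refine le_of_tendsto_of_tendsto hlim2 hlim (Eventually.of_forall fun k => ?_)
    have := h.rayDefect_nonneg hs (ha0 k) (hau k) (huD k).1
    have := hge k
    simp only
    linarith
  · intro a' b' ha' hab' hb'
    refine le_of_tendsto_of_tendsto (hlim2.add_const _) hlim ?_
    have hb'0 : b' ∈ D ∩ Ioi 0 := ⟨hb', ha'.trans hab'⟩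
    have ha'D : a' ∈ D ∩ Ioi 0 := h.Icc_subset ha' hb' ⟨le_rfl, hab'.le⟩
    filter_upwards [hev b' hb'0, hev a' ha'D] with k h1 h2
    have := h.rayDefect_mono hs (ha0 k) h2.1.le hab' h1.2 (huD k).1
    have := hge k
    linarith

/-- In the case of equality, `f` is affine up to the interior points of `A`. -/
theorem affine_of_tsum_eq (h : IsRay n f D A P)
    (hs : Summable ((D ∩ Ioi 0).indicator (rayJump n f A)))
    (heq : ∑' r, (D ∩ Ioi 0).indicator (rayJump n f A) r =
      (∫ r in D ∩ Ioi 0, A.indicator (rayBound n f) r))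
    {r : ℝ} (hr0 : 0 < r) (hrD : r ∈ interior D) (hrA : r ∈ interior A) {t : ℝ}
    (ht0 : 0 ≤ t) (ht1 : t ≤ 1) : f (t * r) = (1 - t) * f 0 + t * f r := by
  have hnhds : interior A ∩ interior D ∈ 𝓝 r :=
    (isOpen_interior.inter isOpen_interior).mem_nhds ⟨hrA, hrD⟩
  obtain ⟨l, u, hlu, hsub⟩ := mem_nhds_iff_exists_Ioo_subset.1 hnhds
  -- No slack is left on the whole ray, so the defect of every subinterval is `0` and the flux is
  -- the primitive of `rayBound` to the right of `r`. Differentiating at `r` gives equality in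
  -- `rayFlux_deriv_le`.
  have hdef : ∀ b ∈ Ioo r u, rayFlux n f b - rayFlux n f r = ∫ s in r..b, rayBound n f s := by
    intro b hb
    have hIoo : Ioo r b ⊆ interior A := fun s hs =>
      (hsub ⟨hlu.1.trans hs.1, hs.2.trans hb.2⟩).1
    have hbD : b ∈ D := interior_subset (hsub ⟨hlu.1.trans hb.1, hb.2⟩).2
    have h1 := (h.tsum_rayJump_add_le hs).2 r b hr0 hb.1 hbD
    rw [heq] at h1
    have h2 : rayDefect n f A r b = 0 :=
      le_antisymm (by linarith) (h.rayDefect_nonneg hs hr0 hb.1 hbD)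
    have hsum : ∑' s, (Ioo r b).indicator (rayJump n f A) s = 0 := by
      rw [← tsum_zero (β := ℝ)]
      refine tsum_congr fun s => ?_
      by_cases hs : s ∈ Ioo r b
      · rw [indicator_of_mem hs, rayJump_eq_zero (Or.inl (hIoo hs))]
      · rw [indicator_of_notMem hs]
    have hA : Ioo r b ⊆ A := hIoo.trans interior_subset
    rw [rayDefect, hsum, leftInd_eq_one (mem_of_superset (Ioo_mem_nhdsLT hb.1) hA),
      rightInd_eq_one (mem_of_superset (Ioo_mem_nhdsGT hb.1) hA),
      intervalIntegral.integral_congr_Ioo_of_le hb.1.le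
        (g := rayBound n f) (fun s hs => indicator_of_mem (hA hs) _)] at h2
    linarith
  have hcont : ContinuousAt (rayBound n f) r :=
    h.continuousOn_rayBound.continuousAt (isOpen_interior.mem_nhds hrD)
  have hFTC : HasDerivWithinAt (fun b => ∫ s in r..b, rayBound n f s) (rayBound n f r)
      (Ioi r) r := by
    refine (intervalIntegral.integral_hasDerivWithinAt_right (s := Ici r) (t := Ioi r) (by simp) ?_
      hcont.continuousWithinAt).mono Ioi_subset_Ici_self
    exact (h.continuousOn_rayBound.stronglyMeasurableAtFilter isOpen_interior r hrD).filter_mono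
      nhdsWithin_le_nhds
  have hflux : HasDerivWithinAt (rayFlux n f) (rayBound n f r) (Ioi r) r := by
    refine (hFTC.add_const (rayFlux n f r)).congr_of_eventuallyEq ?_ (by simp)
    filter_upwards [Ioo_mem_nhdsGT hlu.2] with b hb
    rw [← hdef b hb]; ring
  have huniq := (uniqueDiffWithinAt_Ioi r).eq_deriv _ hflux
    (hasDerivWithinAt_rayFlux h.convexOn h.one_le hrD)
  set c := derivWithin f (Ioi r) r with hc
  -- The supporting line at `r` passes through `(0, f 0)`; on `[0, r]` it lies below `f` and is also
  -- the chord above `f`.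
  have h0 : f 0 = f r - r * c := by
    unfold rayBound at huniq
    have h1 : (0 : ℝ) < r ^ (n - 1) := by positivity
    have h2 := mul_left_cancel₀ (Real.exp_pos _).ne' (mul_left_cancel₀ h1.ne' huniq)
    linarith
  have hrD' := interior_subset hrD
  have htrD : t * r ∈ D := h.ordConnected.out h.zero_mem hrD' ⟨by positivity, by nlinarith⟩
  apply le_antisymm
  · have := h.convexOn.2 h.zero_mem hrD' (sub_nonneg.2 ht1) ht0 (by ring)
    simpa using this
  · have := subgradient_rightDeriv h.convexOn hrD htrD
    rw [← hc] at this
    rw [h0]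
    linarith

end IsRay

end Ray

/-! ### Measurability and integrability of `φ` and `e^{-φ}`. -/

section ConvexFun

open Metric

variable {n : ℕ} {φ : Rn n → EReal}

theorem mem_dom {x : Rn n} : x ∈ dom φ ↔ φ x < ⊤ := Iff.rfl

theorem notMem_dom {x : Rn n} : x ∉ dom φ ↔ φ x = ⊤ := by
  rw [mem_dom, not_lt_top_iff]

theorem expNeg_nonneg (y : Rn n) : 0 ≤ expNeg φ y := ENNReal.toReal_nonneg

theorem expNeg_of_notMem {y : Rn n} (hy : y ∉ dom φ) : expNeg φ y = 0 := by
  simp [expNeg, notMem_dom.1 hy]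

namespace IsConvexFun

theorem coe_toReal (hφ : IsConvexFun φ) {x : Rn n} (hx : x ∈ dom φ) :
    ((φ x).toReal : EReal) = φ x := EReal.coe_toReal hx.ne (hφ.ne_bot x)

theorem combo_le (hφ : IsConvexFun φ) {x y : Rn n} (hx : x ∈ dom φ) (hy : y ∈ dom φ) {a b : ℝ}
    (ha : 0 ≤ a) (hb : 0 ≤ b) (hab : a + b = 1) :
    φ (a • x + b • y) ≤ ((a * (φ x).toReal + b * (φ y).toReal : ℝ) : EReal) := by
  have := hφ.le_combo x y a b ha hb hab
  rwa [← hφ.coe_toReal hx, ← hφ.coe_toReal hy, ← EReal.coe_mul, ← EReal.coe_mul,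
    ← EReal.coe_add] at this

theorem convex_dom (hφ : IsConvexFun φ) : Convex ℝ (dom φ) := fun _ hx _ hy _ _ ha hb hab =>
  (hφ.combo_le hx hy ha hb hab).trans_lt (EReal.coe_lt_top _)

theorem convexOn (hφ : IsConvexFun φ) : ConvexOn ℝ (dom φ) fun x => (φ x).toReal := by
  refine ⟨hφ.convex_dom, fun x hx y hy a b ha hb hab => ?_⟩
  have := hφ.combo_le hx hy ha hb hab
  rwa [← hφ.coe_toReal (hφ.convex_dom hx hy ha hb hab), EReal.coe_le_coe_iff] at this

theorem exp_neg_eq (hφ : IsConvexFun φ) {x : Rn n} (hx : x ∈ dom φ) :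
    EReal.exp (-φ x) = ENNReal.ofReal (Real.exp (-(φ x).toReal)) := by
  rw [← EReal.exp_coe, EReal.coe_neg, hφ.coe_toReal hx]

theorem exp_neg_ne_top (hφ : IsConvexFun φ) (x : Rn n) : EReal.exp (-φ x) ≠ ⊤ := by
  simpa using hφ.ne_bot x

theorem ofReal_expNeg (hφ : IsConvexFun φ) (x : Rn n) :
    ENNReal.ofReal (expNeg φ x) = EReal.exp (-φ x) := ENNReal.ofReal_toReal (hφ.exp_neg_ne_top x)

theorem expNeg_eq (hφ : IsConvexFun φ) {x : Rn n} (hx : x ∈ dom φ) :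
    expNeg φ x = Real.exp (-(φ x).toReal) := by
  rw [expNeg, hφ.exp_neg_eq hx, ENNReal.toReal_ofReal (Real.exp_pos _).le]

theorem expNeg_pos_iff (hφ : IsConvexFun φ) {x : Rn n} : 0 < expNeg φ x ↔ x ∈ dom φ := by
  refine ⟨fun h => ?_, fun h => (hφ.expNeg_eq h).symm ▸ Real.exp_pos _⟩
  by_contra hx
  exact h.ne' (expNeg_of_notMem hx)

theorem continuousOn_interior (hφ : IsConvexFun φ) :
    ContinuousOn (fun x => (φ x).toReal) (interior (dom φ)) := hφ.convexOn.continuousOn_interior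

/-- The frontier of a convex set is null. As `φ` is not controlled on the boundary of its domain,
all measurability comes from its continuity inside, up to this null set. -/
theorem ae_mem_interior_or (hφ : IsConvexFun φ) :
    ∀ᵐ x : Rn n, x ∈ interior (dom φ) ∨ x ∉ dom φ := by
  have h0 : volume (frontier (dom φ)) = 0 := hφ.convex_dom.addHaar_frontier volume
  have h1 : ∀ᵐ x : Rn n, x ∉ frontier (dom φ) := by rw [ae_iff]; simpa using h0
  filter_upwards [h1] with x hx
  by_contra! h
  exact hx ⟨subset_closure h.2, h.1⟩

theorem aemeasurable_toReal (hφ : IsConvexFun φ) : AEMeasurable fun x => (φ x).toReal := by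
  classical
  refine ⟨(interior (dom φ)).piecewise (fun x => (φ x).toReal) 0,
    hφ.continuousOn_interior.measurable_piecewise continuousOn_const
      isOpen_interior.measurableSet, ?_⟩
  filter_upwards [hφ.ae_mem_interior_or] with x hx
  rcases hx with hx | hx
  · simp [hx]
  · have : x ∉ interior (dom φ) := fun h => hx (interior_subset h)
    simp [this, notMem_dom.1 hx]

theorem aemeasurable_expNeg (hφ : IsConvexFun φ) : AEMeasurable (expNeg φ) := by
  classical
  have hc : ContinuousOn (fun x => Real.exp (-(φ x).toReal)) (interior (dom φ)) :=
    hφ.continuousOn_interior.neg.rexp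
  refine ⟨(interior (dom φ)).piecewise (fun x => Real.exp (-(φ x).toReal)) 0,
    hc.measurable_piecewise continuousOn_const isOpen_interior.measurableSet, ?_⟩
  filter_upwards [hφ.ae_mem_interior_or] with x hx
  rcases hx with hx | hx
  · simp [hx, hφ.expNeg_eq (interior_subset hx)]
  · have : x ∉ interior (dom φ) := fun h => hx (interior_subset h)
    simp [this, expNeg_of_notMem hx]

theorem aemeasurable_exp_neg (hφ : IsConvexFun φ) : AEMeasurable fun x => EReal.exp (-φ x) := by
  simp_rw [← hφ.ofReal_expNeg]
  exact hφ.aemeasurable_expNeg.ennreal_ofReal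

theorem integrable_expNeg (hφ : IsConvexFun φ) (hfin : ∫⁻ x, EReal.exp (-φ x) < ⊤) :
    Integrable (expNeg φ) := by
  refine ⟨hφ.aemeasurable_expNeg.aestronglyMeasurable, ?_⟩
  rw [hasFiniteIntegral_iff_ofReal (Eventually.of_forall expNeg_nonneg)]
  simpa only [hφ.ofReal_expNeg] using hfin

theorem nonempty_interior_dom (hφ : IsConvexFun φ) (hpos : 0 < ∫⁻ x, EReal.exp (-φ x)) :
    (interior (dom φ)).Nonempty := by
  by_contra h
  rw [not_nonempty_iff_eq_empty] at h
  refine hpos.ne' (lintegral_eq_zero_of_ae_eq_zero ?_)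
  filter_upwards [hφ.ae_mem_interior_or] with x hx
  rw [h] at hx
  simp [notMem_dom.1 (hx.resolve_left (notMem_empty x))]

/-- Let `φ < φ p + 1` on a ball of radius `r` about an interior point `p`. By convexity `φ ≤ (φ y +
φ p + 1) / 2` on the ball of radius `r / 2` about the midpoint of `y` and `p`, so a very negative `φ
y` would make the integral too large. -/
theorem exists_lower_bound (hφ : IsConvexFun φ) (hpos : 0 < ∫⁻ x, EReal.exp (-φ x))
    (hfin : ∫⁻ x, EReal.exp (-φ x) < ⊤) : ∃ C : ℝ, 0 ≤ C ∧ ∀ y ∈ dom φ, -C ≤ (φ y).toReal := by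
  obtain ⟨p, hp⟩ := hφ.nonempty_interior_dom hpos
  set f : Rn n → ℝ := fun x => (φ x).toReal with hf
  have hcp : ContinuousAt f p := hφ.continuousOn_interior.continuousAt
    (isOpen_interior.mem_nhds hp)
  obtain ⟨r, hr, hball⟩ := Metric.mem_nhds_iff.1 (inter_mem (isOpen_interior.mem_nhds hp)
    (hcp.eventually (gt_mem_nhds (lt_add_one (f p)))))
  set I := (∫⁻ x, EReal.exp (-φ x)).toReal with hI
  set v := (volume : Measure (Rn n)).real (ball 0 (r / 2)) with hv
  have hv0 : 0 < v := ENNReal.toReal_pos (measure_ball_pos _ _ (half_pos hr)).ne'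
    measure_ball_lt_top.ne
  have hI0 : 0 < I := ENNReal.toReal_pos hpos.ne' hfin.ne
  set C := 2 * Real.log (I / v) + (f p + 1) with hC
  refine ⟨max C 0, le_max_right _ _, fun y hy => ?_⟩
  suffices -C ≤ f y from (neg_le_neg (le_max_left _ _)).trans this
  set c := (1 / 2 : ℝ) • y + (1 / 2 : ℝ) • p with hc
  have key : ∀ w ∈ ball c (r / 2), ENNReal.ofReal (Real.exp (-((f y + (f p + 1)) / 2))) ≤
      EReal.exp (-φ w) := by
    intro w hw
    set q := (2 : ℝ) • w - y with hq
    have hqb : q ∈ ball p r := by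
      have h1 : q - p = (2 : ℝ) • (w - c) := by rw [hq, hc]; module
      rw [mem_ball, dist_eq_norm, h1, norm_smul, ← dist_eq_norm]
      rw [mem_ball] at hw
      norm_num
      linarith
    obtain ⟨hq1, hq2⟩ := hball hqb
    have hq2 : f q < f p + 1 := hq2
    have hw' : w = (1 / 2 : ℝ) • y + (1 / 2 : ℝ) • q := by rw [hq]; module
    have h2 := hφ.combo_le hy (interior_subset hq1) (a := 1 / 2) (b := 1 / 2) (by norm_num)
      (by norm_num) (by norm_num)
    rw [← hw'] at h2
    rw [← EReal.exp_coe, EReal.exp_le_exp_iff, EReal.coe_neg, EReal.neg_le_neg_iff]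
    refine h2.trans (EReal.coe_le_coe_iff.2 ?_)
    change 1 / 2 * f y + 1 / 2 * f q ≤ _
    linarith
  have h3 : ENNReal.ofReal (Real.exp (-((f y + (f p + 1)) / 2))) *
      volume (ball c (r / 2)) ≤ ∫⁻ x, EReal.exp (-φ x) := by
    rw [← setLIntegral_const]
    exact (setLIntegral_mono' measurableSet_ball key).trans (setLIntegral_le_lintegral _ _)
  rw [Measure.addHaar_ball_center] at h3
  have h4 := ENNReal.toReal_mono hfin.ne h3
  rw [ENNReal.toReal_mul, ENNReal.toReal_ofReal (Real.exp_pos _).le] at h4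
  have h5 : Real.exp (-((f y + (f p + 1)) / 2)) ≤ I / v := by
    rw [le_div_iff₀ hv0]; exact h4
  have h6 := (Real.le_log_iff_exp_le (by positivity)).2 h5
  rw [hC]
  linarith

/-- One half of the exponent is spent on bounding `|φ| e^{-φ / 2}`, by means of the lower bound of
`φ`. By convexity the other half, `e^{-φ(y) / 2}`, is at most a constant times `e^{-φ}` at the
midpoint of `y` and `p`, which is integrable in `y`. -/
theorem integrable_toReal_mul_expNeg (hφ : IsConvexFun φ) (hpos : 0 < ∫⁻ x, EReal.exp (-φ x))
    (hfin : ∫⁻ x, EReal.exp (-φ x) < ⊤) : Integrable fun y => (φ y).toReal * expNeg φ y := by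
  obtain ⟨p, hp⟩ := hφ.nonempty_interior_dom hpos
  obtain ⟨C, hC0, hC⟩ := hφ.exists_lower_bound hpos hfin
  have hpd := interior_subset hp
  have h1 : Integrable fun y : Rn n => expNeg φ ((1 / 2 : ℝ) • y + (1 / 2 : ℝ) • p) :=
    ((hφ.integrable_expNeg hfin).comp_add_right ((1 / 2 : ℝ) • p)).comp_smul (by norm_num)
  refine (h1.const_mul ((2 + C * Real.exp (C / 2)) * Real.exp ((φ p).toReal / 2))).mono'
    (hφ.aemeasurable_toReal.mul hφ.aemeasurable_expNeg).aestronglyMeasurable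
    (Eventually.of_forall fun y => ?_)
  by_cases hy : y ∈ dom φ
  swap
  · rw [expNeg_of_notMem hy, mul_zero, norm_zero]
    have := expNeg_nonneg (φ := φ) ((1 / 2 : ℝ) • y + (1 / 2 : ℝ) • p)
    positivity
  have hd := hφ.convex_dom hy hpd (a := 1 / 2) (b := 1 / 2) (by norm_num) (by norm_num)
    (by norm_num)
  have hc := hφ.convexOn.2 hy hpd (show (0 : ℝ) ≤ 1 / 2 by norm_num)
    (show (0 : ℝ) ≤ 1 / 2 by norm_num) (by norm_num)
  rw [hφ.expNeg_eq hy, hφ.expNeg_eq hd, norm_mul, Real.norm_eq_abs, Real.norm_eq_abs,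
    Real.abs_exp, mul_assoc, ← Real.exp_add]
  have hs := hC y hy
  set s := (φ y).toReal
  have h2 : Real.exp (-(s / 2)) ≤ Real.exp ((φ p).toReal / 2 +
      -(φ ((1 / 2 : ℝ) • y + (1 / 2 : ℝ) • p)).toReal) := by
    apply Real.exp_le_exp.2
    simp only [smul_eq_mul] at hc
    linarith
  refine le_trans ?_ (mul_le_mul_of_nonneg_left h2 (by positivity))
  have h3 : Real.exp (-s) = Real.exp (-(s / 2)) * Real.exp (-(s / 2)) := by
    rw [← Real.exp_add]; ring_nf
  rw [h3, ← mul_assoc]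
  refine mul_le_mul_of_nonneg_right ?_ (Real.exp_pos _).le
  rcases le_total 0 s with h0 | h0
  · rw [abs_of_nonneg h0]
    have h4 := Real.add_one_le_exp (s / 2)
    have h5 : Real.exp (s / 2) * Real.exp (-(s / 2)) = 1 := by rw [← Real.exp_add]; simp
    have h6 := Real.exp_pos (-(s / 2))
    have h7 : 0 ≤ C * Real.exp (C / 2) := by positivity
    nlinarith
  · have h4 : Real.exp (-(s / 2)) ≤ Real.exp (C / 2) := Real.exp_le_exp.2 (by linarith)
    rw [abs_of_nonpos h0]
    have : -s * Real.exp (-(s / 2)) ≤ C * Real.exp (C / 2) :=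
      mul_le_mul (by linarith) h4 (Real.exp_pos _).le hC0
    linarith

theorem integrableOn_expMeasure (hφ : IsConvexFun φ) (hpos : 0 < ∫⁻ x, EReal.exp (-φ x))
    (hfin : ∫⁻ x, EReal.exp (-φ x) < ⊤) (A : Set (Rn n)) :
    IntegrableOn (fun y => (φ y).toReal) A (expMeasure φ) := by
  refine Integrable.integrableOn ?_
  rw [expMeasure, integrable_withDensity_iff_integrable_smul₀' hφ.aemeasurable_exp_neg
    (Eventually.of_forall fun x => (hφ.exp_neg_ne_top x).lt_top)]
  refine (hφ.integrable_toReal_mul_expNeg hpos hfin).congr (Eventually.of_forall fun y => ?_)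
  simp [expNeg, mul_comm]

theorem setIntegral_expMeasure (hφ : IsConvexFun φ) {A : Set (Rn n)} (hA : MeasurableSet A) :
    ∫ y in A, (φ y).toReal ∂(expMeasure φ) = ∫ y in A, (φ y).toReal * expNeg φ y := by
  rw [expMeasure, setIntegral_withDensity_eq_setIntegral_toReal_smul₀
    hφ.aemeasurable_exp_neg.restrict
    (Eventually.of_forall fun x => (hφ.exp_neg_ne_top x).lt_top) _ hA]
  refine integral_congr_ae (Eventually.of_forall fun y => ?_)
  simp [expNeg, mul_comm]

theorem expMeasure_apply (hφ : IsConvexFun φ) {A : Set (Rn n)} (hA : MeasurableSet A) :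
    expMeasure φ A = ∫⁻ y in A, ENNReal.ofReal (expNeg φ y) := by
  simp_rw [hφ.ofReal_expNeg]
  rw [expMeasure, withDensity_apply _ hA]

theorem expMeasure_real (hφ : IsConvexFun φ) {A : Set (Rn n)} (hA : MeasurableSet A) :
    (expMeasure φ).real A = ∫ y in A, expNeg φ y := by
  rw [Measure.real, hφ.expMeasure_apply hA, integral_eq_lintegral_of_nonneg_ae
    (Eventually.of_forall expNeg_nonneg) hφ.aemeasurable_expNeg.aestronglyMeasurable.restrict]

end IsConvexFun

end ConvexFun

/-! ### Polar coordinates for real-valued integrable functions. -/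

section PolarIntegral

open Metric

variable {E : Type*} [NormedAddCommGroup E] [InnerProductSpace ℝ E] [FiniteDimensional ℝ E]
  [MeasurableSpace E] [BorelSpace E] [Nontrivial E]

theorem integrable_volumeIoiPow_iff {k : ℕ} {g : ℝ → ℝ} :
    Integrable (fun r : Ioi (0 : ℝ) => g r) (Measure.volumeIoiPow k) ↔
      IntegrableOn (fun r => r ^ k * g r) (Ioi 0) := by
  rw [Measure.volumeIoiPow, integrable_withDensity_iff_integrable_smul' (by fun_prop)
    (Eventually.of_forall fun _ => ENNReal.ofReal_lt_top),
    integrableOn_iff_comap_subtypeVal measurableSet_Ioi]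
  refine integrable_congr (Eventually.of_forall fun r => ?_)
  have hr : (0 : ℝ) < r := r.2
  simp only [Function.comp_apply, smul_eq_mul]
  rw [ENNReal.toReal_ofReal (by positivity)]

theorem integral_volumeIoiPow {k : ℕ} {g : ℝ → ℝ} :
    ∫ r : Ioi (0 : ℝ), g r ∂(Measure.volumeIoiPow k) = ∫ r in Ioi (0 : ℝ), r ^ k * g r := by
  rw [Measure.volumeIoiPow, integral_withDensity_eq_integral_toReal_smul (by fun_prop)
    (Eventually.of_forall fun _ => ENNReal.ofReal_lt_top), ← integral_subtype_comap measurableSet_Ioi]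
  refine integral_congr_ae (Eventually.of_forall fun r => ?_)
  have hr : (0 : ℝ) < r := r.2
  simp only [smul_eq_mul]
  rw [ENNReal.toReal_ofReal (by positivity)]

/-- Integration in polar coordinates of an integrable function. -/
theorem integral_polar {g : E → ℝ} (hg : Integrable g) :
    (∀ᵐ θ : sphere (0 : E) 1 ∂(volume : Measure E).toSphere,
      IntegrableOn (fun r : ℝ => r ^ (finrank ℝ E - 1) * g (r • (θ : E))) (Ioi 0)) ∧
    Integrable (fun θ : sphere (0 : E) 1 =>
      ∫ r in Ioi (0 : ℝ), r ^ (finrank ℝ E - 1) * g (r • (θ : E))) (volume : Measure E).toSphere ∧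
    ∫ θ : sphere (0 : E) 1, (∫ r in Ioi (0 : ℝ), r ^ (finrank ℝ E - 1) * g (r • (θ : E)))
      ∂(volume : Measure E).toSphere = ∫ y, g y := by
  have h := ((volume : Measure E).measurePreserving_homeomorphUnitSphereProd).symm
    (e := (homeomorphUnitSphereProd E).toMeasurableEquiv)
  set G : sphere (0 : E) 1 × Ioi (0 : ℝ) → ℝ := fun p => g ((p.2 : ℝ) • (p.1 : E)) with hG
  have h1 : Integrable G
      ((volume : Measure E).toSphere.prod (Measure.volumeIoiPow (finrank ℝ E - 1))) := by
    have h2 : IntegrableOn g {0}ᶜ := hg.integrableOn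
    rw [integrableOn_iff_comap_subtypeVal (measurableSet_singleton _).compl,
      ← h.integrable_comp_emb (MeasurableEquiv.measurableEmbedding _)] at h2
    exact h2
  have h3 : ∫ p, G p ∂((volume : Measure E).toSphere.prod
      (Measure.volumeIoiPow (finrank ℝ E - 1))) = ∫ y, g y := by
    conv_rhs => rw [← restrict_compl_singleton (μ := (volume : Measure E)) 0]
    rw [← integral_subtype_comap (measurableSet_singleton _).compl,
      ← h.integral_comp (MeasurableEquiv.measurableEmbedding _)]
    rfl
  have h4 : ∀ θ : sphere (0 : E) 1, ∫ r, G (θ, r) ∂(Measure.volumeIoiPow (finrank ℝ E - 1)) =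
      ∫ r in Ioi (0 : ℝ), r ^ (finrank ℝ E - 1) * g (r • (θ : E)) := fun θ =>
    integral_volumeIoiPow (g := fun r => g (r • (θ : E)))
  simp_rw [← h4]
  refine ⟨?_, h1.integral_prod_left, ?_⟩
  · filter_upwards [h1.prod_right_ae] with θ hθ
    exact integrable_volumeIoiPow_iff.1 hθ
  · rw [← h3, integral_prod _ h1]

end PolarIntegral

/-! ### Rays issuing from an arbitrary point. -/

section Translate

open Metric

variable {E : Type*} [NormedAddCommGroup E] [InnerProductSpace ℝ E] [FiniteDimensional ℝ E]
  [MeasurableSpace E] [BorelSpace E] [Nontrivial E]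

theorem measurePreserving_add_left_euclideanHausdorffMeasure (d : ℕ) (x : E) :
    MeasurePreserving (fun w : E => x + w) (μHE[d]) (μHE[d]) :=
  (IsometryEquiv.addLeft x).measurePreserving_euclideanHausdorffMeasure d

theorem HasNormal.translate {M : Set E} {ν : E → E} (h : HasNormal M ν) (x : E) :
    HasNormal ((fun w => x + w) ⁻¹' M) (fun w => ν (x + w)) := by
  refine fun y hy => ⟨(h _ hy).1, fun ε hε => ?_⟩
  obtain ⟨r, hr, H⟩ := (h _ hy).2 ε hε
  refine ⟨r, hr, fun z hz hzr => ?_⟩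
  have := H _ hz (by simpa using hzr)
  simpa using this

/-- The area formula for the radial projection from `x`. -/
theorem HasNormal.lintegral_raySum_translate {M : Set E} {ν : E → E} (h : HasNormal M ν)
    (hM : MeasurableSet M) (hν : Measurable ν) {F : E → ℝ≥0∞} (hF : Measurable F) (x : E) :
    AEMeasurable (raySum fun w => M.indicator F (x + w)) (volume : Measure E).toSphere ∧
    ∫⁻ θ, raySum (fun w => M.indicator F (x + w)) θ ∂(volume : Measure E).toSphere =
      ∫⁻ y in M, F y * ENNReal.ofReal |⟪ν y, y - x⟫| ∂(μHE[finrank ℝ E - 1]) := by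
  have hmp := measurePreserving_add_left_euclideanHausdorffMeasure (finrank ℝ E - 1) x
  have hx : Measurable fun w : E => x + w := by fun_prop
  have h1 := (h.translate x).lintegral_raySum (hx hM) (hν.comp hx) (hF.comp hx)
  have h2 : ((fun w => x + w) ⁻¹' M).indicator (F ∘ fun w => x + w) =
      fun w => M.indicator F (x + w) := rfl
  rw [h2] at h1
  refine ⟨h1.1, h1.2.trans ?_⟩
  rw [supportMeasure, restrict_withDensity (hx hM), lintegral_withDensity_eq_lintegral_mul _
    (by fun_prop) (hF.comp hx)]
  rw [← hmp.setLIntegral_comp_preimage hM (by fun_prop)]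
  refine lintegral_congr fun w => ?_
  simp [mul_comm]

theorem ae_ray_add_notMem {N : Set E} (hN : μHE[finrank ℝ E - 1] N = 0) (x : E) :
    ∀ᵐ θ : sphere (0 : E) 1 ∂(volume : Measure E).toSphere,
      ∀ r : ℝ, 0 < r → x + r • (θ : E) ∉ N := by
  obtain ⟨N', hNN, hN', hN0⟩ := exists_measurable_superset_of_null hN
  have h0 : μHE[finrank ℝ E - 1] ((fun w => x + w) ⁻¹' N') = 0 := by
    rw [(measurePreserving_add_left_euclideanHausdorffMeasure (finrank ℝ E - 1) x).measure_preimage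
      hN'.nullMeasurableSet, hN0]
  filter_upwards [ae_ray_notMem (volume_coneOf_eq_zero h0)] with θ hθ r hr hN
  exact hθ r hr (hNN hN)

theorem HasNormal.ae_transversal {M : Set E} {ν : E → E} (h : HasNormal M ν)
    (hM : MeasurableSet M) (hν : Measurable ν) (x : E) :
    ∀ᵐ θ : sphere (0 : E) 1 ∂(volume : Measure E).toSphere,
      ∀ r : ℝ, 0 < r → x + r • (θ : E) ∈ M → ⟪ν (x + r • (θ : E)), (θ : E)⟫ ≠ 0 := by
  have hx : Measurable fun w : E => x + w := by fun_prop
  filter_upwards [ae_ray_notMem ((h.translate x).volume_coneOf_tangential (hx hM) (hν.comp hx))]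
    with θ hθ r hr hrM h0
  refine hθ r hr ⟨hrM, ?_⟩
  change ⟪ν (x + r • (θ : E)), r • (θ : E)⟫ = 0
  rw [inner_smul_right, h0, mul_zero]

theorem hasSum_raySum {G : E → ℝ} (hG : ∀ y, 0 ≤ G y) {θ : sphere (0 : E) 1}
    (h : raySum (fun y => ENNReal.ofReal (G y)) θ ≠ ⊤) :
    HasSum ((Ioi (0 : ℝ)).indicator fun r => r ^ finrank ℝ E * G (r • (θ : E)))
      (raySum (fun y => ENNReal.ofReal (G y)) θ).toReal := by
  have h1 : raySum (fun y => ENNReal.ofReal (G y)) θ =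
      ∑' r : Ioi (0 : ℝ), ENNReal.ofReal ((r : ℝ) ^ finrank ℝ E * G ((r : ℝ) • (θ : E))) := by
    rw [raySum, lintegral_count]
    refine tsum_congr fun r => ?_
    have hr : (0 : ℝ) < r := r.2
    rw [ENNReal.ofReal_mul (by positivity)]
  have hnn : ∀ r : Ioi (0 : ℝ), 0 ≤ (r : ℝ) ^ finrank ℝ E * G ((r : ℝ) • (θ : E)) := fun r => by
    have hr : (0 : ℝ) < r := r.2
    exact mul_nonneg (by positivity) (hG _)
  rw [h1] at h ⊢
  have h2 := ENNReal.hasSum_toReal h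
  simp only [ENNReal.toReal_ofReal (hnn _)] at h2
  have h3 := ENNReal.tsum_toReal_eq fun r : Ioi (0 : ℝ) =>
    (ENNReal.ofReal_ne_top (r := (r : ℝ) ^ finrank ℝ E * G ((r : ℝ) • (θ : E))))
  simp only [ENNReal.toReal_ofReal (hnn _)] at h3
  rw [h3]
  rw [← hasSum_subtype_iff_indicator]
  exact h2

theorem integral_polar_translate {g : E → ℝ} (hg : Integrable g) (x : E) :
    (∀ᵐ θ : sphere (0 : E) 1 ∂(volume : Measure E).toSphere,
      IntegrableOn (fun r : ℝ => r ^ (finrank ℝ E - 1) * g (x + r • (θ : E))) (Ioi 0)) ∧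
    Integrable (fun θ : sphere (0 : E) 1 =>
      ∫ r in Ioi (0 : ℝ), r ^ (finrank ℝ E - 1) * g (x + r • (θ : E)))
      (volume : Measure E).toSphere ∧
    ∫ θ : sphere (0 : E) 1, (∫ r in Ioi (0 : ℝ), r ^ (finrank ℝ E - 1) * g (x + r • (θ : E)))
      ∂(volume : Measure E).toSphere = ∫ y, g y := by
  have := integral_polar (hg.comp_add_left x)
  rwa [integral_add_left_eq_self] at this

/-- A property of almost all rays from `x` holds almost everywhere. -/
theorem ae_of_ae_sphere {p : E → Prop} (x : E)
    (h : ∀ᵐ θ : sphere (0 : E) 1 ∂(volume : Measure E).toSphere,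
      ∀ r : ℝ, 0 < r → p (x + r • (θ : E))) : ∀ᵐ y : E, p y := by
  suffices hw : ∀ᵐ w : E, p (x + w) by
    have := (measurePreserving_add_left (volume : Measure E) (-x)).quasiMeasurePreserving.ae hw
    simpa using this
  have hmp := (volume : Measure E).measurePreserving_homeomorphUnitSphereProd
  have h1 : ∀ᵐ q : sphere (0 : E) 1 × Ioi (0 : ℝ)
      ∂((volume : Measure E).toSphere.prod (Measure.volumeIoiPow (finrank ℝ E - 1))),
      ∀ r : ℝ, 0 < r → p (x + r • (q.1 : E)) :=
    Measure.quasiMeasurePreserving_fst.ae h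
  have h2 := hmp.quasiMeasurePreserving.ae h1
  rw [← restrict_compl_singleton (μ := (volume : Measure E)) 0,
    ← map_comap_subtype_coe (measurableSet_singleton (0 : E)).compl,
    (MeasurableEmbedding.subtype_coe (measurableSet_singleton (0 : E)).compl).ae_map_iff]
  filter_upwards [h2] with w hw
  have hw0 : 0 < ‖(w : E)‖ := norm_pos_iff.2 w.2
  have := hw ‖(w : E)‖ hw0
  simpa [smul_smul, hw0.ne'] using this

end Translate

/-! ### Exits and entries of a ray through the boundary of `A`. -/

section SingleRay

open Metric

variable {n : ℕ} {φ : Rn n → EReal} {A M : Set (Rn n)} {ν : Rn n → Rn n} {g : Rn n → ℝ}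

/-- A measurable subset `M` of the boundary of `A`, of full measure in the domain of `φ`, with
measurable exterior normals `ν`, and a measurable version `g` of `e^{-φ}` on it. -/
structure IsRegularBoundary (φ : Rn n → EReal) (A M : Set (Rn n)) (ν : Rn n → Rn n)
    (g : Rn n → ℝ) : Prop where
  measurableSet : MeasurableSet M
  measurable_normal : Measurable ν
  measurable_density : Measurable g
  subset_frontier : M ⊆ frontier A
  subset_dom : M ⊆ dom φ
  isExteriorNormal : ∀ y ∈ M, IsExteriorNormal A y (ν y)
  density_eq : ∀ y ∈ M, g y = expNeg φ y
  null : μHE[n - 1] ((frontier A ∩ dom φ) \ M) = 0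

theorem IsExteriorNormal.mem_of_inner_neg {y ν : Rn n} (h : IsExteriorNormal A y ν) {v : Rn n}
    (hv : ⟪v, ν⟫ < 0) : ∀ᶠ s : ℝ in 𝓝[>] 0, y + s • v ∈ A := by
  have hv0 : 0 < ‖v‖ := by
    rw [norm_pos_iff]; rintro rfl; simp at hv
  -- With this `ε` the direction `v` lies exactly on the boundary of the inner cone, where
  -- membership in `A` is still guaranteed.
  obtain ⟨r, hr, H⟩ := h.2 (-⟪v, ν⟫ / ‖v‖) (div_pos (neg_pos.2 hv) hv0)
  have h1 : ∀ᶠ s : ℝ in 𝓝[>] 0, s < r / ‖v‖ :=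
    (gt_mem_nhds (div_pos hr hv0)).filter_mono nhdsWithin_le_nhds
  filter_upwards [h1, self_mem_nhdsWithin] with s hs hs0
  have hs0 : 0 < s := hs0
  have hz : y + s • v - y = s • v := by simp
  have hn : ‖s • v‖ = s * ‖v‖ := by rw [norm_smul, Real.norm_of_nonneg hs0.le]
  refine (H (y + s • v) ?_ ?_).1 ?_
  · rw [ne_eq, add_eq_left, smul_eq_zero, not_or]
    exact ⟨hs0.ne', norm_pos_iff.1 hv0⟩
  · rw [hz, hn]; rwa [lt_div_iff₀ hv0] at hs
  · rw [hz, hn, real_inner_smul_left]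
    refine le_of_eq ?_
    field_simp

theorem IsExteriorNormal.notMem_of_inner_pos {y ν : Rn n} (h : IsExteriorNormal A y ν) {v : Rn n}
    (hv : 0 < ⟪v, ν⟫) : ∀ᶠ s : ℝ in 𝓝[>] 0, y + s • v ∉ A := by
  have hv0 : 0 < ‖v‖ := by
    rw [norm_pos_iff]; rintro rfl; simp at hv
  obtain ⟨r, hr, H⟩ := h.2 (⟪v, ν⟫ / ‖v‖) (div_pos hv hv0)
  have h1 : ∀ᶠ s : ℝ in 𝓝[>] 0, s < r / ‖v‖ :=
    (gt_mem_nhds (div_pos hr hv0)).filter_mono nhdsWithin_le_nhds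
  filter_upwards [h1, self_mem_nhdsWithin] with s hs hs0
  have hs0 : 0 < s := hs0
  have hz : y + s • v - y = s • v := by simp
  have hn : ‖s • v‖ = s * ‖v‖ := by rw [norm_smul, Real.norm_of_nonneg hs0.le]
  refine (H (y + s • v) ?_ ?_).2 ?_
  · rw [ne_eq, add_eq_left, smul_eq_zero, not_or]
    exact ⟨hs0.ne', norm_pos_iff.1 hv0⟩
  · rw [hz, hn]; rwa [lt_div_iff₀ hv0] at hs
  · rw [hz, hn, real_inner_smul_left]
    refine le_of_eq ?_
    field_simp

theorem eventually_nhdsLT_of_eventually_pos {p : ℝ → Prop} {r : ℝ}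
    (h : ∀ᶠ s : ℝ in 𝓝[>] 0, p (r - s)) : ∀ᶠ s in 𝓝[<] r, p s := by
  have h1 : Tendsto (fun s : ℝ => r - s) (𝓝[<] r) (𝓝[>] 0) := by
    refine tendsto_nhdsWithin_of_tendsto_nhds_of_eventually_within _ ?_ ?_
    · have : Tendsto (fun s : ℝ => r - s) (𝓝 r) (𝓝 (r - r)) := by
        exact (continuous_const.sub continuous_id).tendsto r
      rw [sub_self] at this
      exact this.mono_left nhdsWithin_le_nhds
    · filter_upwards [self_mem_nhdsWithin] with s hs
      exact sub_pos.2 (mem_Iio.1 hs)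
  filter_upwards [h1.eventually h] with s hs
  simpa using hs

theorem eventually_nhdsGT_of_eventually_pos {p : ℝ → Prop} {r : ℝ}
    (h : ∀ᶠ s : ℝ in 𝓝[>] 0, p (r + s)) : ∀ᶠ s in 𝓝[>] r, p s := by
  have h1 : Tendsto (fun s : ℝ => s - r) (𝓝[>] r) (𝓝[>] 0) := by
    refine tendsto_nhdsWithin_of_tendsto_nhds_of_eventually_within _ ?_ ?_
    · have : Tendsto (fun s : ℝ => s - r) (𝓝 r) (𝓝 (r - r)) := by
        exact (continuous_id.sub continuous_const).tendsto r
      rw [sub_self] at this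
      exact this.mono_left nhdsWithin_le_nhds
    · filter_upwards [self_mem_nhdsWithin] with s hs
      exact sub_pos.2 (mem_Ioi.1 hs)
  filter_upwards [h1.eventually h] with s hs
  simpa using hs

theorem IsExteriorNormal.leftInd_sub_rightInd_of_pos {x θ ν : Rn n} {r : ℝ}
    (h : IsExteriorNormal A (x + r • θ) ν) (hθ : 0 < ⟪ν, θ⟫) :
    leftInd {s : ℝ | x + s • θ ∈ A} r - rightInd {s : ℝ | x + s • θ ∈ A} r = 1 := by
  have h1 := h.mem_of_inner_neg (v := -θ) (by rw [inner_neg_left, real_inner_comm]; linarith)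
  have h2 := h.notMem_of_inner_pos (v := θ) (by rwa [real_inner_comm])
  rw [leftInd_eq_one, rightInd_eq_zero, sub_zero]
  · refine eventually_nhdsGT_of_eventually_pos (h2.mono fun s hs => ?_)
    rwa [mem_ofPred_eq, add_smul, ← add_assoc]
  · refine eventually_nhdsLT_of_eventually_pos (h1.mono fun s hs => ?_)
    rwa [sub_smul, ← add_sub_assoc, sub_eq_add_neg, ← smul_neg]

theorem IsExteriorNormal.leftInd_sub_rightInd_of_neg {x θ ν : Rn n} {r : ℝ}
    (h : IsExteriorNormal A (x + r • θ) ν) (hθ : ⟪ν, θ⟫ < 0) :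
    leftInd {s : ℝ | x + s • θ ∈ A} r - rightInd {s : ℝ | x + s • θ ∈ A} r = -1 := by
  have h1 := h.notMem_of_inner_pos (v := -θ) (by rw [inner_neg_left, real_inner_comm]; linarith)
  have h2 := h.mem_of_inner_neg (v := θ) (by rwa [real_inner_comm])
  rw [rightInd_eq_one, leftInd_eq_zero, zero_sub]
  · refine eventually_nhdsLT_of_eventually_pos (h1.mono fun s hs => ?_)
    rwa [mem_ofPred_eq, sub_smul, ← add_sub_assoc, sub_eq_add_neg, ← smul_neg]
  · refine eventually_nhdsGT_of_eventually_pos (h2.mono fun s hs => ?_)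
    rwa [add_smul, ← add_assoc]

/-- The open inner cone lies in the interior of `A` and the open outer cone in the interior of the
complement, so frontier points stay close to the tangent hyperplane. This turns exterior normals
into `HasNormal`. -/
theorem IsExteriorNormal.abs_inner_le {y ν : Rn n} (h : IsExteriorNormal A y ν) {ε : ℝ}
    (hε : 0 < ε) : ∃ r : ℝ, 0 < r ∧ ∀ z ∈ frontier A, ‖z - y‖ < r →
      |⟪ν, z - y⟫| ≤ ε * ‖z - y‖ := by
  obtain ⟨r, hr, H⟩ := h.2 ε hε
  refine ⟨r, hr, fun z hz hzr => ?_⟩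
  by_contra! hcon
  have hne : ∀ w : Rn n, ε * ‖w - y‖ < |⟪w - y, ν⟫| → w ≠ y := by
    rintro w hw rfl; simp at hw
  rw [real_inner_comm] at hcon
  have hball : ∀ᶠ w in 𝓝 z, ‖w - y‖ < r :=
    (isOpen_lt (by fun_prop) continuous_const).mem_nhds hzr
  rcases lt_abs.1 hcon with h1 | h1
  · have h2 : ∀ᶠ w in 𝓝 z, ε * ‖w - y‖ < ⟪w - y, ν⟫ :=
      (isOpen_lt (by fun_prop) (by fun_prop)).mem_nhds h1
    have : z ∈ interior Aᶜ := by
      rw [mem_interior_iff_mem_nhds]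
      filter_upwards [hball, h2] with w hw1 hw2
      exact (H w (hne w (hw2.trans_le (le_abs_self _))) hw1).2 hw2.le
    rw [interior_compl] at this
    exact this hz.1
  · have h2 : ∀ᶠ w in 𝓝 z, ε * ‖w - y‖ < -⟪w - y, ν⟫ :=
      (isOpen_lt (by fun_prop) (by fun_prop)).mem_nhds h1
    have : z ∈ interior A := by
      rw [mem_interior_iff_mem_nhds]
      filter_upwards [hball, h2] with w hw1 hw2
      exact (H w (hne w (hw2.trans_le (neg_le_abs _))) hw1).1 (by linarith)
    exact hz.2 this

namespace IsRegularBoundary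

theorem hasNormal (hb : IsRegularBoundary φ A M ν g) : HasNormal M ν := fun y hy =>
  ⟨(hb.isExteriorNormal y hy).1, fun ε hε => by
    obtain ⟨r, hr, H⟩ := (hb.isExteriorNormal y hy).abs_inner_le hε
    exact ⟨r, hr, fun z hz => H z (hb.subset_frontier hz)⟩⟩

theorem density_nonneg (hb : IsRegularBoundary φ A M ν g) {y : Rn n} (hy : y ∈ M) : 0 ≤ g y :=
  hb.density_eq y hy ▸ expNeg_nonneg y

end IsRegularBoundary

/-- The points of `M` at which the rays from `x` leave, if `s = 1`, or enter, if `s = -1`. -/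
def crossing (M : Set (Rn n)) (ν : Rn n → Rn n) (x : Rn n) (s : ℝ) : Set (Rn n) :=
  {y ∈ M | 0 < s * ⟪ν y, y - x⟫}

theorem mem_crossing_ray {x : Rn n} {s r : ℝ} (hr : 0 < r) {θ : Rn n} :
    x + r • θ ∈ crossing M ν x s ↔ x + r • θ ∈ M ∧ 0 < s * ⟪ν (x + r • θ), θ⟫ := by
  simp only [crossing, mem_ofPred_eq, add_sub_cancel_left, inner_smul_right]
  rw [mul_left_comm, mul_pos_iff_of_pos_left hr]

/-- The sum of `r ^ n * e^{-φ}` over the crossings of a ray from `x`. -/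
noncomputable def crossingSum (M : Set (Rn n)) (ν : Rn n → Rn n) (g : Rn n → ℝ) (x : Rn n) (s : ℝ)
    (θ : sphere (0 : Rn n) 1) : ℝ≥0∞ :=
  raySum (fun w => (crossing M ν x s).indicator (fun y => ENNReal.ofReal (g y)) (x + w)) θ

/-- The integrand on the right-hand side. -/
noncomputable def bulk (φ : Rn n → EReal) (x y : Rn n) : ℝ :=
  expNeg φ y * (n + (φ x).toReal - (φ y).toReal)

variable [Nontrivial (Rn n)]

theorem hasSum_crossing (hb : IsRegularBoundary φ A M ν g) {x : Rn n} {s : ℝ}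
    {θ : sphere (0 : Rn n) 1} (h : crossingSum M ν g x s θ ≠ ⊤) :
    HasSum ((Ioi (0 : ℝ)).indicator fun r => r ^ n *
      (crossing M ν x s).indicator g (x + r • (θ : Rn n))) (crossingSum M ν g x s θ).toReal := by
  have h1 : crossingSum M ν g x s θ = raySum (fun w => ENNReal.ofReal
      ((crossing M ν x s).indicator g (x + w))) θ := by
    rw [crossingSum]
    congr 1
    ext w
    by_cases hw : x + w ∈ crossing M ν x s <;> simp [hw]
  rw [h1] at h ⊢
  have h2 := hasSum_raySum (fun w => ?_) h
  · rwa [finrank_euclideanSpace_fin] at h2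
  · exact indicator_nonneg (fun y hy => hb.density_nonneg hy.1) _

theorem one_le_of_nontrivial_Rn : 1 ≤ n := by
  have := finrank_pos (R := ℝ) (M := Rn n)
  rwa [finrank_euclideanSpace_fin] at this

theorem IsConvexFun.convexOn_ray (hφ : IsConvexFun φ) (x θ : Rn n) :
    ConvexOn ℝ {r : ℝ | 0 ≤ r ∧ x + r • θ ∈ dom φ} fun r => (φ (x + r • θ)).toReal := by
  have hcomb : ∀ (r s a b : ℝ), a + b = 1 →
      x + (a • r + b • s) • θ = a • (x + r • θ) + b • (x + s • θ) := by
    intro r s a b hab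
    calc x + (a • r + b • s) • θ = (a + b) • x + (a • r + b • s) • θ := by rw [hab, one_smul]
      _ = _ := by simp only [smul_eq_mul]; module
  refine ⟨fun r hr s hs a b ha hb hab => ⟨?_, ?_⟩, fun r hr s hs a b ha hb hab => ?_⟩
  · have := hr.1
    have := hs.1
    simp only [smul_eq_mul]
    positivity
  · rw [hcomb r s a b hab]
    exact hφ.convex_dom hr.2 hs.2 ha hb hab
  · beta_reduce
    rw [hcomb r s a b hab]
    exact hφ.convexOn.2 hr.2 hs.2 ha hb hab

/-- The conditions satisfied by almost every direction `θ` of the rays from `x`. -/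
structure IsGoodDirection (φ : Rn n → EReal) (A M : Set (Rn n)) (ν : Rn n → Rn n)
    (g : Rn n → ℝ) (x : Rn n) (θ : sphere (0 : Rn n) 1) : Prop where
  mem : ∀ r : ℝ, 0 < r → x + r • (θ : Rn n) ∈ frontier A → x + r • (θ : Rn n) ∈ dom φ →
    x + r • (θ : Rn n) ∈ M
  transversal : ∀ r : ℝ, 0 < r → x + r • (θ : Rn n) ∈ M →
    ⟪ν (x + r • (θ : Rn n)), (θ : Rn n)⟫ ≠ 0
  outer_ne_top : crossingSum M ν g x 1 θ ≠ ⊤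
  inner_ne_top : crossingSum M ν g x (-1) θ ≠ ⊤
  integrableOn : IntegrableOn (fun r : ℝ => r ^ (n - 1) * bulk φ x (x + r • (θ : Rn n))) (Ioi 0)

namespace IsGoodDirection

variable {x : Rn n} {θ : sphere (0 : Rn n) 1}

theorem eq_crossing (h : IsGoodDirection φ A M ν g x θ) {r : ℝ} (hr : 0 < r)
    (hA : x + r • (θ : Rn n) ∈ frontier A) (hd : x + r • (θ : Rn n) ∈ dom φ) :
    (x + r • (θ : Rn n) ∈ crossing M ν x 1 ∧ x + r • (θ : Rn n) ∉ crossing M ν x (-1)) ∨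
    (x + r • (θ : Rn n) ∈ crossing M ν x (-1) ∧ x + r • (θ : Rn n) ∉ crossing M ν x 1) := by
  have hM := h.mem r hr hA hd
  simp only [mem_crossing_ray hr, hM, true_and, one_mul, neg_one_mul, neg_pos, not_lt]
  rcases lt_or_gt_of_ne (h.transversal r hr hM) with h1 | h1
  · exact Or.inr ⟨h1, h1.le⟩
  · exact Or.inl ⟨h1, h1.le⟩

/-- On `(a, b)` convexity gives `f ≤ max (f 0) (f b)`, so each crossing contributes at least `a ^ n
e^{-max (f 0) (f b)}` to a convergent sum. -/
theorem finite (h : IsGoodDirection φ A M ν g x θ) (hφ : IsConvexFun φ)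
    (hb : IsRegularBoundary φ A M ν g) (hx : x ∈ dom φ) {a b : ℝ} (ha : 0 < a)
    (hbd : x + b • (θ : Rn n) ∈ dom φ) :
    ({r : ℝ | x + r • (θ : Rn n) ∈ frontier A} ∩ Ioo a b).Finite := by
  rcases le_or_gt b a with hab | hab
  · rw [Ioo_eq_empty (not_lt.2 hab)]; simp
  have hb0 : 0 < b := ha.trans hab
  have hs := ((hasSum_crossing hb h.outer_ne_top).add (hasSum_crossing hb h.inner_ne_top)).summable
  set f : ℝ → ℝ := fun r => (φ (x + r • (θ : Rn n))).toReal with hf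
  have hfc := hφ.convexOn_ray x (θ : Rn n)
  set K := max (f 0) (f b) with hK
  set c := a ^ n * Real.exp (-K) with hc
  have hc0 : 0 < c := by positivity
  have hev := hs.tendsto_cofinite_zero.eventually (gt_mem_nhds hc0)
  rw [eventually_cofinite] at hev
  refine hev.subset ?_
  rintro r ⟨hrA, hra, hrb⟩
  have hr0 : 0 < r := ha.trans hra
  have hD0 : (0 : ℝ) ∈ {r : ℝ | 0 ≤ r ∧ x + r • (θ : Rn n) ∈ dom φ} := by simpa using hx
  have hDb : b ∈ {r : ℝ | 0 ≤ r ∧ x + r • (θ : Rn n) ∈ dom φ} := ⟨hb0.le, hbd⟩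
  have hseg : r ∈ segment ℝ 0 b := by
    rw [segment_eq_Icc hb0.le]; exact ⟨hr0.le, hrb.le⟩
  have hrd : x + r • (θ : Rn n) ∈ dom φ := (hfc.1.segment_subset hD0 hDb hseg).2
  have hfr : f r ≤ K := hfc.le_on_segment hD0 hDb hseg
  have hval : c ≤ r ^ n * expNeg φ (x + r • (θ : Rn n)) := by
    rw [hφ.expNeg_eq hrd, hc]
    have : Real.exp (-K) ≤ Real.exp (-f r) := Real.exp_le_exp.2 (neg_le_neg hfr)
    gcongr
  have hg := hb.density_eq _ (h.mem r hr0 hrA hrd)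
  simp only [mem_ofPred_eq, not_lt]
  rw [indicator_of_mem (mem_Ioi.2 hr0), indicator_of_mem (mem_Ioi.2 hr0)]
  rcases h.eq_crossing hr0 hrA hrd with ⟨h1, h2⟩ | ⟨h1, h2⟩
  · rw [indicator_of_mem h1, indicator_of_notMem h2, hg]; simpa using hval
  · rw [indicator_of_mem h1, indicator_of_notMem h2, hg]; simpa using hval

theorem mul_bulk_eq (hφ : IsConvexFun φ) {r : ℝ} (hr : x + r • (θ : Rn n) ∈ dom φ) :
    r ^ (n - 1) * bulk φ x (x + r • (θ : Rn n)) =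
      rayBound n (fun r => (φ (x + r • (θ : Rn n))).toReal) r := by
  rw [bulk, hφ.expNeg_eq hr, rayBound, zero_smul, add_zero]

theorem isRay (h : IsGoodDirection φ A M ν g x θ) (hφ : IsConvexFun φ)
    (hpos : 0 < ∫⁻ x, EReal.exp (-φ x)) (hfin : ∫⁻ x, EReal.exp (-φ x) < ⊤)
    (hA : MeasurableSet A) (hb : IsRegularBoundary φ A M ν g) (hx : x ∈ dom φ) :
    IsRay n (fun r => (φ (x + r • (θ : Rn n))).toReal)
      {r : ℝ | 0 ≤ r ∧ x + r • (θ : Rn n) ∈ dom φ} {r | x + r • (θ : Rn n) ∈ A}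
      {r | x + r • (θ : Rn n) ∈ frontier A} where
  one_le := one_le_of_nontrivial_Rn
  convexOn := hφ.convexOn_ray x θ
  zero_mem := by simpa using hx
  bddBelow := by
    obtain ⟨C, -, hC⟩ := hφ.exists_lower_bound hpos hfin
    exact ⟨-C, fun r hr => hC _ hr.2⟩
  integrableOn := by
    have hm : MeasurableSet ({r : ℝ | 0 ≤ r ∧ x + r • (θ : Rn n) ∈ dom φ} ∩ Ioi 0) :=
      (hφ.convexOn_ray x θ).1.ordConnected.measurableSet.inter measurableSet_Ioi
    exact (h.integrableOn.mono_set inter_subset_right).congr_fun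
      (fun r hr => mul_bulk_eq hφ hr.1.2) hm
  measurableSet := (show Measurable fun r : ℝ => x + r • (θ : Rn n) by fun_prop) hA
  mem_interior := by
    intro r _ _ hrP
    have hc : Continuous fun r : ℝ => x + r • (θ : Rn n) := by fun_prop
    by_cases hrA : x + r • (θ : Rn n) ∈ interior A
    · exact Or.inl (preimage_interior_subset_interior_preimage hc hrA)
    · refine Or.inr (preimage_interior_subset_interior_preimage hc (t := Aᶜ) ?_)
      rw [mem_preimage, interior_compl]
      exact fun hcl => hrP ⟨hcl, hrA⟩
  finite := fun a b ha hbD => h.finite hφ hb hx ha hbD.2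

/-- Transversality makes the left minus the right indicator `1` at an exit and `-1` at an entry;
away from the boundary there is no jump. -/
theorem rayJump_eq (h : IsGoodDirection φ A M ν g x θ) (hφ : IsConvexFun φ)
    (hb : IsRegularBoundary φ A M ν g) :
    ({r : ℝ | 0 ≤ r ∧ x + r • (θ : Rn n) ∈ dom φ} ∩ Ioi 0).indicator
      (rayJump n (fun r => (φ (x + r • (θ : Rn n))).toReal) {r | x + r • (θ : Rn n) ∈ A}) =
    fun r => ((Ioi (0 : ℝ)).indicator fun r => r ^ n *
        (crossing M ν x 1).indicator g (x + r • (θ : Rn n))) r -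
      ((Ioi (0 : ℝ)).indicator fun r => r ^ n *
        (crossing M ν x (-1)).indicator g (x + r • (θ : Rn n))) r := by
  ext r
  by_cases hr0 : 0 < r
  swap
  · rw [indicator_of_notMem (fun h => hr0 h.2), indicator_of_notMem (mt mem_Ioi.1 hr0),
      indicator_of_notMem (mt mem_Ioi.1 hr0), sub_zero]
  rw [indicator_of_mem (mem_Ioi.2 hr0), indicator_of_mem (mem_Ioi.2 hr0)]
  by_cases hrd : x + r • (θ : Rn n) ∈ dom φ
  swap
  · rw [indicator_of_notMem (fun h => hrd h.1.2), indicator_of_notMem, indicator_of_notMem]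
    · simp
    · exact fun h => hrd (hb.subset_dom h.1)
    · exact fun h => hrd (hb.subset_dom h.1)
  have hrD : r ∈ {r : ℝ | 0 ≤ r ∧ x + r • (θ : Rn n) ∈ dom φ} ∩ Ioi 0 := ⟨⟨hr0.le, hrd⟩, hr0⟩
  rw [indicator_of_mem hrD]
  by_cases hrA : x + r • (θ : Rn n) ∈ frontier A
  swap
  · rw [indicator_of_notMem, indicator_of_notMem, rayJump_eq_zero]
    · simp
    · have hc : Continuous fun r : ℝ => x + r • (θ : Rn n) := by fun_prop
      by_cases hri : x + r • (θ : Rn n) ∈ interior A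
      · exact Or.inl (preimage_interior_subset_interior_preimage hc hri)
      · refine Or.inr (preimage_interior_subset_interior_preimage hc (t := Aᶜ) ?_)
        rw [mem_preimage, interior_compl]
        exact fun hcl => hrA ⟨hcl, hri⟩
    · exact fun h => hrA (hb.subset_frontier h.1)
    · exact fun h => hrA (hb.subset_frontier h.1)
  have hM := h.mem r hr0 hrA hrd
  have hn := hb.isExteriorNormal _ hM
  have hg := hb.density_eq _ hM
  rw [rayJump, rayFlux, ← hφ.expNeg_eq hrd]
  rcases h.eq_crossing hr0 hrA hrd with ⟨h1, h2⟩ | ⟨h1, h2⟩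
  · have h3 := ((mem_crossing_ray hr0).1 h1).2
    rw [indicator_of_mem h1, indicator_of_notMem h2, hg,
      hn.leftInd_sub_rightInd_of_pos (by linarith)]
    ring
  · have h3 := ((mem_crossing_ray hr0).1 h1).2
    rw [indicator_of_mem h1, indicator_of_notMem h2, hg,
      hn.leftInd_sub_rightInd_of_neg (by linarith)]
    ring

/-- The inequality on a single ray, with the case of equality. -/
theorem crossingSum_sub_le (h : IsGoodDirection φ A M ν g x θ) (hφ : IsConvexFun φ)
    (hpos : 0 < ∫⁻ x, EReal.exp (-φ x)) (hfin : ∫⁻ x, EReal.exp (-φ x) < ⊤)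
    (hA : MeasurableSet A) (hb : IsRegularBoundary φ A M ν g) (hx : x ∈ dom φ) :
    (crossingSum M ν g x 1 θ).toReal - (crossingSum M ν g x (-1) θ).toReal ≤
      (∫ r in Ioi (0 : ℝ), r ^ (n - 1) * A.indicator (bulk φ x) (x + r • (θ : Rn n))) ∧
    ((crossingSum M ν g x 1 θ).toReal - (crossingSum M ν g x (-1) θ).toReal =
      (∫ r in Ioi (0 : ℝ), r ^ (n - 1) * A.indicator (bulk φ x) (x + r • (θ : Rn n))) →
      ∀ r : ℝ, 0 < r → x + r • (θ : Rn n) ∈ interior A ∩ interior (dom φ) →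
        ∀ t : ℝ, 0 ≤ t → t ≤ 1 → (φ (x + (t * r) • (θ : Rn n))).toReal =
          (1 - t) * (φ x).toReal + t * (φ (x + r • (θ : Rn n))).toReal) := by
  have hray := h.isRay hφ hpos hfin hA hb hx
  have hsum := (hasSum_crossing hb h.outer_ne_top).sub (hasSum_crossing hb h.inner_ne_top)
  rw [← h.rayJump_eq hφ hb] at hsum
  have hm : MeasurableSet ({r : ℝ | 0 ≤ r ∧ x + r • (θ : Rn n) ∈ dom φ} ∩ Ioi 0) :=
    (hφ.convexOn_ray x θ).1.ordConnected.measurableSet.inter measurableSet_Ioi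
  have hint : (∫ r in Ioi (0 : ℝ), r ^ (n - 1) * A.indicator (bulk φ x) (x + r • (θ : Rn n))) =
      ∫ r in {r : ℝ | 0 ≤ r ∧ x + r • (θ : Rn n) ∈ dom φ} ∩ Ioi 0,
        {r : ℝ | x + r • (θ : Rn n) ∈ A}.indicator
          (rayBound n fun r => (φ (x + r • (θ : Rn n))).toReal) r := by
    refine (setIntegral_eq_of_subset_of_forall_sdiff_eq_zero measurableSet_Ioi
      (inter_subset_right (s := {r : ℝ | 0 ≤ r ∧ x + r • (θ : Rn n) ∈ dom φ})) ?_).trans ?_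
    swap
    · refine setIntegral_congr_fun hm fun r hr => ?_
      by_cases hrA : x + r • (θ : Rn n) ∈ A
      · simp only [indicator_of_mem hrA]
        rw [mul_bulk_eq hφ hr.1.2, indicator_of_mem (by exact hrA)]
      · simp only [indicator_of_notMem hrA]
        rw [indicator_of_notMem (by exact hrA), mul_zero]
    · rintro r ⟨hr0, hrn⟩
      have hrd : x + r • (θ : Rn n) ∉ dom φ := fun hd => hrn ⟨⟨(mem_Ioi.1 hr0).le, hd⟩, hr0⟩
      have : bulk φ x (x + r • (θ : Rn n)) = 0 := by rw [bulk, expNeg_of_notMem hrd, zero_mul]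
      by_cases hrA : x + r • (θ : Rn n) ∈ A
      · rw [indicator_of_mem hrA, this, mul_zero]
      · rw [indicator_of_notMem hrA, mul_zero]
  rw [hint, ← hsum.tsum_eq]
  refine ⟨(hray.tsum_rayJump_add_le hsum.summable).1, fun heq r hr0 hr t ht0 ht1 => ?_⟩
  have hc : Continuous fun r : ℝ => x + r • (θ : Rn n) := by fun_prop
  have hrA : r ∈ interior {r : ℝ | x + r • (θ : Rn n) ∈ A} :=
    preimage_interior_subset_interior_preimage hc hr.1
  have hrD : r ∈ interior {r : ℝ | 0 ≤ r ∧ x + r • (θ : Rn n) ∈ dom φ} := by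
    rw [mem_interior_iff_mem_nhds]
    have h1 : ∀ᶠ s in 𝓝 r, x + s • (θ : Rn n) ∈ dom φ :=
      mem_interior_iff_mem_nhds.1 (preimage_interior_subset_interior_preimage hc hr.2)
    filter_upwards [h1, lt_mem_nhds hr0] with s hs hs0
    exact ⟨hs0.le, hs⟩
  have := hray.affine_of_tsum_eq hsum.summable heq hr0 hrD hrA ht0 ht1
  simpa using this

end IsGoodDirection

end SingleRay

/-! ### Integration over all directions. -/

section GlobalInequality

open Metric

variable {n : ℕ} {φ : Rn n → EReal} {A M : Set (Rn n)} {ν : Rn n → Rn n} {g : Rn n → ℝ}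

theorem isExteriorNormal_exteriorNormal {y : Rn n} (h : ∃ ν, IsExteriorNormal A y ν) :
    IsExteriorNormal A y (exteriorNormal A y) := by
  rw [exteriorNormal, dif_pos h]
  exact h.choose_spec

/-- Measurability of the normal is recovered from the integrand of `V`: its measurable version `W'`
has norm `e^{-φ}` almost everywhere, so on the domain the normal is `W' / ‖W'‖` and the density is
`‖W'‖`. -/
theorem exists_isRegularBoundary (hφ : IsConvexFun φ)
    (hnormal : ∀ᵐ y ∂(surfaceMeasure (frontier A)), ∃ ν, IsExteriorNormal A y ν)
    (hV : Integrable (fun y => expNeg φ y • exteriorNormal A y) (surfaceMeasure (frontier A))) :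
    ∃ (M : Set (Rn n)) (ν : Rn n → Rn n) (g : Rn n → ℝ), IsRegularBoundary φ A M ν g := by
  set W : Rn n → Rn n := fun y => expNeg φ y • exteriorNormal A y with hW
  set W' := hV.1.mk W with hW'
  have hWm : Measurable W' := hV.1.stronglyMeasurable_mk.measurable
  have hae : ∀ᵐ y ∂(surfaceMeasure (frontier A)), W y = W' y ∧ ∃ ν, IsExteriorNormal A y ν :=
    hV.1.ae_eq_mk.and hnormal
  obtain ⟨N, hsub, hN, hN0⟩ := exists_measurable_superset_of_null (ae_iff.1 hae)
  rw [surfaceMeasure, Measure.restrict_apply hN] at hN0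
  have hgood : ∀ y, y ∉ N → W' y = expNeg φ y • exteriorNormal A y ∧
      IsExteriorNormal A y (exteriorNormal A y) ∧ ‖W' y‖ = expNeg φ y := by
    intro y hy
    have h1 : W y = W' y ∧ ∃ ν, IsExteriorNormal A y ν := by
      by_contra hcon
      exact hy (hsub hcon)
    have h2 := isExteriorNormal_exteriorNormal h1.2
    refine ⟨h1.1.symm, h2, ?_⟩
    rw [← h1.1, hW]
    simp only [norm_smul, h2.1, mul_one, Real.norm_of_nonneg (expNeg_nonneg y)]
  refine ⟨(frontier A ∩ {y | 0 < ‖W' y‖}) \ N, fun y => ‖W' y‖⁻¹ • W' y, fun y => ‖W' y‖,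
    ?_, by fun_prop, by fun_prop, ?_, ?_, ?_, ?_, ?_⟩
  · exact (isClosed_frontier.measurableSet.inter
      (measurableSet_lt measurable_const (by fun_prop))).diff hN
  · exact fun y hy => hy.1.1
  · rintro y ⟨⟨-, hy⟩, hyN⟩
    rw [mem_ofPred_eq, (hgood y hyN).2.2] at hy
    exact hφ.expNeg_pos_iff.1 hy
  · rintro y ⟨⟨-, hy⟩, hyN⟩
    obtain ⟨h1, h2, h3⟩ := hgood y hyN
    have hy : 0 < ‖W' y‖ := hy
    beta_reduce
    rw [h3] at hy
    rwa [h3, h1, smul_smul, inv_mul_cancel₀ hy.ne', one_smul]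
  · exact fun y hy => (hgood y hy.2).2.2
  · refine measure_mono_null ?_ hN0
    rintro y ⟨⟨hyA, hyd⟩, hyM⟩
    refine ⟨?_, hyA⟩
    by_contra hyN
    refine hyM ⟨⟨hyA, ?_⟩, hyN⟩
    rw [mem_ofPred_eq, (hgood y hyN).2.2]
    exact hφ.expNeg_pos_iff.2 hyd

namespace IsRegularBoundary

theorem normal_eq (hb : IsRegularBoundary φ A M ν g) {y : Rn n} (hy : y ∈ M) :
    ν y = exteriorNormal A y :=
  (hb.isExteriorNormal y hy).unique (isExteriorNormal_exteriorNormal ⟨_, hb.isExteriorNormal y hy⟩)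

theorem integral_surfaceMeasure {F : Type*} [NormedAddCommGroup F] [NormedSpace ℝ F]
    (hb : IsRegularBoundary φ A M ν g) {f : Rn n → F} (hf : ∀ y ∉ dom φ, f y = 0) :
    ∫ y, f y ∂(surfaceMeasure (frontier A)) = ∫ y in M, f y ∂(μHE[n - 1]) := by
  rw [surfaceMeasure]
  refine setIntegral_eq_of_subset_of_ae_sdiff_eq_zero
    isClosed_frontier.measurableSet.nullMeasurableSet hb.subset_frontier ?_
  have := measure_eq_zero_iff_ae_notMem.1 hb.null
  filter_upwards [this] with y hy hyM
  by_contra h0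
  refine hy ⟨⟨hyM.1, ?_⟩, hyM.2⟩
  by_contra hd
  exact h0 (hf y hd)

theorem integral_eq (hb : IsRegularBoundary φ A M ν g)
    (hV : Integrable (fun y => expNeg φ y • exteriorNormal A y) (surfaceMeasure (frontier A)))
    (hQ : Integrable (fun y => ⟪y, exteriorNormal A y⟫ * expNeg φ y)
      (surfaceMeasure (frontier A))) (x : Rn n) :
    IntegrableOn (fun y => g y * ⟪ν y, y - x⟫) M (μHE[n - 1]) ∧
    ∫ y in M, g y * ⟪ν y, y - x⟫ ∂(μHE[n - 1]) = boundaryQ φ A - ⟪x, boundaryV φ A⟫ := by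
  have hle : (μHE[n - 1] : Measure (Rn n)).restrict M ≤ surfaceMeasure (frontier A) :=
    Measure.restrict_mono hb.subset_frontier le_rfl
  have hV' := hV.mono_measure hle
  have hQ' := hQ.mono_measure hle
  have heq : EqOn (fun y => ⟪y, exteriorNormal A y⟫ * expNeg φ y -
      ⟪x, expNeg φ y • exteriorNormal A y⟫) (fun y => g y * ⟪ν y, y - x⟫) M := by
    intro y hy
    simp only [hb.density_eq y hy, hb.normal_eq hy, inner_smul_right, inner_sub_right]
    rw [real_inner_comm y, real_inner_comm x]
    ring
  constructor
  · exact IntegrableOn.congr_fun (hQ'.sub (hV'.const_inner x)) heq hb.measurableSet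
  · rw [← setIntegral_congr_fun hb.measurableSet heq, integral_sub hQ' (hV'.const_inner x),
      integral_inner hV', boundaryQ, boundaryV,
      hb.integral_surfaceMeasure fun y hy => by rw [expNeg_of_notMem hy, mul_zero],
      hb.integral_surfaceMeasure fun y hy => by rw [expNeg_of_notMem hy, zero_smul]]

theorem measurableSet_crossing (hb : IsRegularBoundary φ A M ν g) (x : Rn n) (s : ℝ) :
    MeasurableSet (crossing M ν x s) := by
  have := hb.measurable_normal
  exact hb.measurableSet.inter (measurableSet_lt (f := fun _ => (0 : ℝ))
    (g := fun y => s * ⟪ν y, y - x⟫) measurable_const (by fun_prop))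

variable [Nontrivial (Rn n)]

/-- The area formula on the part of `M` where `|⟨ν, y - x⟩| = s ⟨ν, y - x⟩`. Treating exits and
entries separately keeps all terms nonnegative, and absolute convergence makes both sums finite on
almost every ray. -/
theorem crossingSum_integral (hb : IsRegularBoundary φ A M ν g) {x : Rn n}
    (hI : IntegrableOn (fun y => g y * ⟪ν y, y - x⟫) M (μHE[n - 1])) {s : ℝ} (hs : |s| = 1) :
    (∀ᵐ θ ∂(volume : Measure (Rn n)).toSphere, crossingSum M ν g x s θ ≠ ⊤) ∧
    Integrable (fun θ => (crossingSum M ν g x s θ).toReal) (volume : Measure (Rn n)).toSphere ∧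
    ∫ θ, (crossingSum M ν g x s θ).toReal ∂(volume : Measure (Rn n)).toSphere =
      s * ∫ y in crossing M ν x s, g y * ⟪ν y, y - x⟫ ∂(μHE[n - 1]) := by
  have hm := hb.measurableSet_crossing x s
  have hsub : crossing M ν x s ⊆ M := fun y hy => hy.1
  have hg := hb.measurable_density
  have hν := hb.measurable_normal
  obtain ⟨h1, h2⟩ := (hb.hasNormal.mono hsub).lintegral_raySum_translate hm hν
    (F := fun y => ENNReal.ofReal (g y)) (by fun_prop) x
  rw [finrank_euclideanSpace_fin] at h2
  change AEMeasurable (crossingSum M ν g x s) _ at h1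
  change ∫⁻ θ, crossingSum M ν g x s θ ∂(volume : Measure (Rn n)).toSphere = _ at h2
  have h3 : ∀ y ∈ crossing M ν x s, ENNReal.ofReal (g y) * ENNReal.ofReal |⟪ν y, y - x⟫| =
      ENNReal.ofReal (s * (g y * ⟪ν y, y - x⟫)) := by
    intro y hy
    rw [← ENNReal.ofReal_mul (hb.density_nonneg hy.1)]
    congr 1
    have : |⟪ν y, y - x⟫| = s * ⟪ν y, y - x⟫ := by
      rw [← abs_of_pos hy.2, abs_mul, hs, one_mul]
    rw [this]; ring
  rw [setLIntegral_congr_fun hm h3] at h2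
  have hI' : Integrable (fun y => s * (g y * ⟪ν y, y - x⟫))
      ((μHE[n - 1] : Measure (Rn n)).restrict (crossing M ν x s)) :=
    (hI.mono_set hsub).const_mul s
  have hnn : 0 ≤ᵐ[(μHE[n - 1] : Measure (Rn n)).restrict (crossing M ν x s)]
      fun y => s * (g y * ⟪ν y, y - x⟫) := by
    filter_upwards [ae_restrict_mem hm] with y hy
    have := mul_nonneg (hb.density_nonneg hy.1) hy.2.le
    simp only [Pi.zero_apply]
    linarith
  have h4 : ∫⁻ y in crossing M ν x s, ENNReal.ofReal (s * (g y * ⟪ν y, y - x⟫)) ∂(μHE[n - 1]) ≠ ⊤ :=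
    ((hasFiniteIntegral_iff_ofReal hnn).1 hI'.2).ne
  have h5 : ∫⁻ θ, crossingSum M ν g x s θ ∂(volume : Measure (Rn n)).toSphere ≠ ⊤ := by
    rwa [h2]
  have h6 := ae_lt_top' h1 h5
  refine ⟨h6.mono fun θ hθ => hθ.ne, integrable_toReal_of_lintegral_ne_top h1 h5, ?_⟩
  rw [integral_toReal h1 h6, ← integral_const_mul, integral_eq_lintegral_of_nonneg_ae hnn hI'.1]
  rw [h2]

theorem integral_crossing_sub (hb : IsRegularBoundary φ A M ν g) {x : Rn n}
    (hI : IntegrableOn (fun y => g y * ⟪ν y, y - x⟫) M (μHE[n - 1])) :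
    Integrable (fun θ => (crossingSum M ν g x 1 θ).toReal - (crossingSum M ν g x (-1) θ).toReal)
      (volume : Measure (Rn n)).toSphere ∧
    ∫ θ, ((crossingSum M ν g x 1 θ).toReal - (crossingSum M ν g x (-1) θ).toReal)
      ∂(volume : Measure (Rn n)).toSphere = ∫ y in M, g y * ⟪ν y, y - x⟫ ∂(μHE[n - 1]) := by
  obtain ⟨-, h1, h2⟩ := hb.crossingSum_integral hI (s := 1) (by simp)
  obtain ⟨-, h3, h4⟩ := hb.crossingSum_integral hI (s := -1) (by simp)
  refine ⟨h1.sub h3, ?_⟩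
  rw [integral_sub h1 h3, h2, h4]
  have hd : Disjoint (crossing M ν x 1) (crossing M ν x (-1)) := by
    refine disjoint_left.2 fun y hy hy' => ?_
    have := hy.2
    have := hy'.2
    linarith
  have hsub : ∀ s, crossing M ν x s ⊆ M := fun s y hy => hy.1
  have h5 := setIntegral_union hd (hb.measurableSet_crossing x (-1))
    (hI.mono_set (hsub 1)) (hI.mono_set (hsub (-1)))
  have h6 : ∫ y in M, g y * ⟪ν y, y - x⟫ ∂(μHE[n - 1]) =
      ∫ y in crossing M ν x 1 ∪ crossing M ν x (-1), g y * ⟪ν y, y - x⟫ ∂(μHE[n - 1]) := by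
    refine setIntegral_eq_of_subset_of_forall_sdiff_eq_zero hb.measurableSet
      (union_subset (hsub _) (hsub _)) ?_
    rintro y ⟨hyM, hy⟩
    have : ⟪ν y, y - x⟫ = 0 := by
      by_contra h0
      refine hy ?_
      rcases lt_or_gt_of_ne h0 with h | h
      · exact Or.inr ⟨hyM, by linarith⟩
      · exact Or.inl ⟨hyM, by linarith⟩
    rw [this, mul_zero]
  rw [h6, h5]
  ring

theorem ae_isGoodDirection (hb : IsRegularBoundary φ A M ν g) {x : Rn n}
    (hI : IntegrableOn (fun y => g y * ⟪ν y, y - x⟫) M (μHE[n - 1]))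
    (hB : Integrable (bulk φ x)) :
    ∀ᵐ θ ∂(volume : Measure (Rn n)).toSphere, IsGoodDirection φ A M ν g x θ := by
  have hnull : μHE[finrank ℝ (Rn n) - 1] ((frontier A ∩ dom φ) \ M) = 0 := by
    rw [finrank_euclideanSpace_fin]; exact hb.null
  filter_upwards [ae_ray_add_notMem hnull x,
    hb.hasNormal.ae_transversal hb.measurableSet hb.measurable_normal x,
    (hb.crossingSum_integral hI (s := 1) (by simp)).1,
    (hb.crossingSum_integral hI (s := -1) (by simp)).1, (integral_polar_translate hB x).1]
    with θ h1 h2 h3 h4 h5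
  refine ⟨fun r hr hA hd => ?_, h2, h3, h4, ?_⟩
  · by_contra hM
    exact h1 r hr ⟨⟨hA, hd⟩, hM⟩
  · rwa [finrank_euclideanSpace_fin] at h5

/-- The integrated inequality, with the case of equality. -/
theorem integral_le (hb : IsRegularBoundary φ A M ν g) (hφ : IsConvexFun φ)
    (hpos : 0 < ∫⁻ x, EReal.exp (-φ x)) (hfin : ∫⁻ x, EReal.exp (-φ x) < ⊤)
    (hA : MeasurableSet A) {x : Rn n} (hx : x ∈ dom φ)
    (hI : IntegrableOn (fun y => g y * ⟪ν y, y - x⟫) M (μHE[n - 1]))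
    (hB : Integrable (bulk φ x)) :
    ∫ y in M, g y * ⟪ν y, y - x⟫ ∂(μHE[n - 1]) ≤ ∫ y in A, bulk φ x y ∧
    (∫ y in M, g y * ⟪ν y, y - x⟫ ∂(μHE[n - 1]) = ∫ y in A, bulk φ x y →
      ∀ᵐ y : Rn n, y ∈ interior A ∩ interior (dom φ) → ∀ t : ℝ, 0 ≤ t → t ≤ 1 →
        (φ (x + t • (y - x))).toReal = (1 - t) * (φ x).toReal + t * (φ y).toReal) := by
  obtain ⟨h1, h2⟩ := hb.integral_crossing_sub hI
  obtain ⟨-, h3, h4⟩ := integral_polar_translate (hB.indicator hA) x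
  rw [finrank_euclideanSpace_fin] at h3 h4
  rw [integral_indicator hA] at h4
  have hgood := hb.ae_isGoodDirection hI hB
  have hle := hgood.mono fun θ hθ => hθ.crossingSum_sub_le hφ hpos hfin hA hb hx
  rw [← h2, ← h4]
  refine ⟨integral_mono_ae h1 h3 (hle.mono fun θ hθ => hθ.1), fun heq => ?_⟩
  -- Integrals of almost everywhere ordered functions agree only if the functions agree almost
  -- everywhere.
  have hae := (integral_eq_iff_of_ae_le h1 h3 (hle.mono fun θ hθ => hθ.1)).1 heq
  refine ae_of_ae_sphere x ?_
  filter_upwards [hae, hle] with θ hθ1 hθ2 r hr hrm t ht0 ht1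
  have := hθ2.2 hθ1 r hr hrm t ht0 ht1
  rwa [add_sub_cancel_left, smul_smul]

end IsRegularBoundary

theorem IsConvexFun.integrable_bulk (hφ : IsConvexFun φ) (hpos : 0 < ∫⁻ x, EReal.exp (-φ x))
    (hfin : ∫⁻ x, EReal.exp (-φ x) < ⊤) (x : Rn n) : Integrable (bulk φ x) := by
  refine (((hφ.integrable_expNeg hfin).mul_const (n + (φ x).toReal)).sub
    (hφ.integrable_toReal_mul_expNeg hpos hfin)).congr (Eventually.of_forall fun y => ?_)
  simp only [bulk, Pi.sub_apply]
  ring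

theorem IsConvexFun.setIntegral_bulk (hφ : IsConvexFun φ) (hpos : 0 < ∫⁻ x, EReal.exp (-φ x))
    (hfin : ∫⁻ x, EReal.exp (-φ x) < ⊤) (hA : MeasurableSet A) (x : Rn n) :
    ∫ y in A, bulk φ x y = (n + (φ x).toReal) * (expMeasure φ).real A -
      ∫ y in A, (φ y).toReal ∂(expMeasure φ) := by
  have h1 : bulk φ x = fun y => (n + (φ x).toReal) * expNeg φ y - (φ y).toReal * expNeg φ y := by
    ext y; rw [bulk]; ring
  rw [h1, integral_sub ((hφ.integrable_expNeg hfin).integrableOn.const_mul _)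
    (hφ.integrable_toReal_mul_expNeg hpos hfin).integrableOn, integral_const_mul,
    ← hφ.expMeasure_real hA, ← hφ.setIntegral_expMeasure hA]

/-- The inequality at a point of the domain, with the case of equality. -/
theorem inner_slope_sub_le [Nontrivial (Rn n)] (hφ : IsConvexFun φ)
    (hpos : 0 < ∫⁻ x, EReal.exp (-φ x)) (hfin : ∫⁻ x, EReal.exp (-φ x) < ⊤)
    (hA : MeasurableSet A) (hμA : 0 < expMeasure φ A)
    (hnormal : ∀ᵐ y ∂(surfaceMeasure (frontier A)), ∃ ν, IsExteriorNormal A y ν)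
    (hV : Integrable (fun y => expNeg φ y • exteriorNormal A y) (surfaceMeasure (frontier A)))
    (hQ : Integrable (fun y => ⟪y, exteriorNormal A y⟫ * expNeg φ y)
      (surfaceMeasure (frontier A))) {x : Rn n} (hx : x ∈ dom φ) :
    ⟪x, slope φ A⟫ - (φ x).toReal ≤ upperBound φ A ∧
    (⟪x, slope φ A⟫ - (φ x).toReal = upperBound φ A →
      ∀ᵐ y : Rn n, y ∈ interior A ∩ interior (dom φ) → ∀ t : ℝ, 0 ≤ t → t ≤ 1 →
        (φ (x + t • (y - x))).toReal = (1 - t) * (φ x).toReal + t * (φ y).toReal) := by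
  obtain ⟨M, ν, g, hb⟩ := exists_isRegularBoundary hφ hnormal hV
  obtain ⟨hI, hIeq⟩ := hb.integral_eq hV hQ x
  obtain ⟨h1, h2⟩ := hb.integral_le hφ hpos hfin hA hx hI (hφ.integrable_bulk hpos hfin x)
  rw [hIeq, hφ.setIntegral_bulk hpos hfin hA] at h1 h2
  have htop : expMeasure φ A ≠ ⊤ := by
    refine ((measure_mono (subset_univ A)).trans_lt ?_).ne
    rw [expMeasure, withDensity_apply _ MeasurableSet.univ, setLIntegral_univ]
    exact hfin
  have hm : 0 < (expMeasure φ).real A := ENNReal.toReal_pos hμA.ne' htop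
  have hkey : (⟪x, slope φ A⟫ - (φ x).toReal) * (expMeasure φ).real A =
      -⟪x, boundaryV φ A⟫ - (φ x).toReal * (expMeasure φ).real A := by
    rw [slope, inner_neg_right, inner_smul_right]
    field_simp
  have hkey2 : upperBound φ A * (expMeasure φ).real A = n * (expMeasure φ).real A -
      (∫ y in A, (φ y).toReal ∂(expMeasure φ)) - boundaryQ φ A := by
    rw [upperBound]
    field_simp
  refine ⟨?_, fun heq => h2 ?_⟩
  · rw [← mul_le_mul_iff_left₀ hm, hkey, hkey2]
    linarith
  · rw [heq, hkey2] at hkey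
    linarith

end GlobalInequality

/-! ### From almost every point to the points of the equality statement. -/

section EqualityCase

open Metric

variable {n : ℕ} {φ : Rn n → EReal} {A : Set (Rn n)}

theorem euclideanHausdorffMeasure_hyperplane_ball_pos [Nontrivial (Rn n)] {e p : Rn n}
    (he : ‖e‖ = 1) (hp : ⟪e, p⟫ = 0) {r : ℝ} (hr : 0 < r) :
    0 < μHE[n - 1] ({q : Rn n | ⟪e, q⟫ = 0} ∩ ball p r) := by
  have hn : 1 ≤ n := one_le_of_nontrivial_Rn
  have : Fact (finrank ℝ (Rn n) = n - 1 + 1) := ⟨by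
    rw [finrank_euclideanSpace_fin, Nat.sub_add_cancel hn]⟩
  have he0 : e ≠ 0 := by rintro rfl; simp at he
  set K : Submodule ℝ (Rn n) := (ℝ ∙ e)ᗮ with hK
  have hfr : finrank ℝ K = n - 1 :=
    Submodule.finrank_orthogonal_span_singleton he0
  have hpK : p ∈ K := Submodule.mem_orthogonal_singleton_iff_inner_right.2 hp
  have hiso : Isometry (Subtype.val : K → Rn n) := isometry_subtype_coe
  have himg : Subtype.val '' (ball (⟨p, hpK⟩ : K) r) ⊆ {q : Rn n | ⟪e, q⟫ = 0} ∩ ball p r := by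
    rintro _ ⟨q, hq, rfl⟩
    exact ⟨Submodule.mem_orthogonal_singleton_iff_inner_right.1 q.2, hq⟩
  refine lt_of_lt_of_le ?_ (measure_mono himg)
  rw [hiso.euclideanHausdorffMeasure_image, ← hfr,
    InnerProductSpace.euclideanHausdorffMeasure_eq_volume]
  exact measure_ball_pos _ _ hr

/-- A Lipschitz graph has positive surface measure near each of its points. -/
theorem IsLipschitzGraphAt.measure_pos [Nontrivial (Rn n)] {S W : Set (Rn n)} {y : Rn n}
    (h : IsLipschitzGraphAt S y) (hy : y ∈ S) (hW : W ∈ 𝓝 y) : 0 < μHE[n - 1] (S ∩ W) := by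
  obtain ⟨U, hU, hyU, e, he, K, g, hg, hSU⟩ := h
  set γ : Rn n → Rn n := fun p => p + g p • e with hγ
  have hγc : Continuous γ := continuous_id.add (hg.continuous.smul continuous_const)
  have hgraph : ⟪e, y⟫ = g (projAlong e y) := by
    have h : y ∈ S ∩ U := ⟨hy, hyU⟩
    rw [hSU] at h
    exact h.1
  have hγy : γ (projAlong e y) = y := by
    rw [hγ]
    beta_reduce
    rw [← hgraph, projAlong]
    simp
  have hnhds : γ ⁻¹' (U ∩ W) ∈ 𝓝 (projAlong e y) :=
    hγc.continuousAt.preimage_mem_nhds (by rw [hγy]; exact inter_mem (hU.mem_nhds hyU) hW)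
  obtain ⟨r, hr, hball⟩ := Metric.mem_nhds_iff.1 hnhds
  refine (euclideanHausdorffMeasure_hyperplane_ball_pos he (inner_projAlong he y) hr).trans_le ?_
  -- Projection along `e` does not increase measure, and the projection of the graph near `y` covers
  -- a ball of the hyperplane.
  refine le_trans (measure_mono ?_) (euclideanHausdorffMeasure_projAlong_image_le (S ∩ W) he (n - 1))
  rintro p ⟨hp, hpb⟩
  have hp : ⟪e, p⟫ = 0 := hp
  have h1 : ⟪e, γ p⟫ = g p := by
    rw [hγ]
    simp [inner_add_right, inner_smul_right, hp, he]
  have h2 : γ p - ⟪e, γ p⟫ • e = p := by rw [h1, hγ]; simp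
  have h3 : γ p ∈ U ∩ W := hball hpb
  have h4 : γ p ∈ S ∩ U := by
    rw [hSU]
    refine ⟨?_, h3.1⟩
    rw [mem_ofPred_eq, h2, h1]
  exact ⟨γ p, ⟨h4.1, h3.2⟩, h2⟩

theorem IsExteriorNormal.mem_closure_interior {y ν : Rn n} (h : IsExteriorNormal A y ν) :
    y ∈ closure (interior A) := by
  obtain ⟨r, hr, H⟩ := h.2 (1 / 2) (by norm_num)
  have hν : ⟪ν, ν⟫ = 1 := by rw [real_inner_self_eq_norm_sq, h.1, one_pow]
  have hc : Tendsto (fun s : ℝ => y - s • ν) (𝓝[>] 0) (𝓝 y) := by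
    have h1 : Tendsto (fun s : ℝ => y - s • ν) (𝓝 0) (𝓝 (y - (0 : ℝ) • ν)) :=
      (show Continuous fun s : ℝ => y - s • ν by fun_prop).tendsto 0
    rw [zero_smul, sub_zero] at h1
    exact h1.mono_left nhdsWithin_le_nhds
  refine mem_closure_of_tendsto hc ?_
  filter_upwards [self_mem_nhdsWithin,
    (gt_mem_nhds hr).filter_mono (nhdsWithin_le_nhds (s := Ioi (0 : ℝ)))] with s hs0 hsr
  have hs0 : 0 < s := hs0
  have hz : y - s • ν - y = -(s • ν) := by abel
  have hn : ‖y - s • ν - y‖ = s := by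
    rw [hz, norm_neg, norm_smul, h.1, mul_one, Real.norm_of_nonneg hs0.le]
  have hi : ⟪y - s • ν - y, ν⟫ = -s := by
    rw [hz, inner_neg_left, inner_smul_left, hν]; simp
  rw [mem_interior_iff_mem_nhds]
  have h1 : ∀ᶠ z in 𝓝 (y - s • ν), ‖z - y‖ < r :=
    (isOpen_lt (by fun_prop) continuous_const).mem_nhds (by rw [mem_ofPred_eq, hn]; exact hsr)
  have h2 : ∀ᶠ z in 𝓝 (y - s • ν), ⟪z - y, ν⟫ < -(1 / 2 * ‖z - y‖) :=
    (isOpen_lt (by fun_prop) (by fun_prop)).mem_nhds (by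
      rw [mem_ofPred_eq, hn, hi]; linarith)
  filter_upwards [h1, h2] with z hz1 hz2
  refine (H z ?_ hz1).1 hz2.le
  rintro rfl
  simp at hz2

/-- Every neighbourhood of a graph point has positive surface measure, so it contains a point with
an exterior normal, hence interior points of `A`. Density of the graph points extends this to the
whole frontier. -/
theorem frontier_subset_closure_interior [Nontrivial (Rn n)] (hS : IsHypersurface (frontier A))
    (hnormal : ∀ᵐ y ∂(surfaceMeasure (frontier A)), ∃ ν, IsExteriorNormal A y ν) :
    frontier A ⊆ closure (interior A) := by
  refine hS.dense_graph.trans (closure_minimal ?_ isClosed_closure)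
  rintro y ⟨hyA, hy⟩
  rw [mem_closure_iff_nhds]
  intro W hW
  obtain ⟨W', hW', hWo, hyW⟩ := _root_.mem_nhds_iff.1 hW
  have hpos := hy.measure_pos hyA (hWo.mem_nhds hyW)
  have hex : ∃ z ∈ W', ∃ ν, IsExteriorNormal A z ν := by
    by_contra! hcon
    have h1 : surfaceMeasure (frontier A) W' = 0 :=
      measure_mono_null (fun z hz => fun ⟨ν, hν⟩ => hcon z hz ν hν) (ae_iff.1 hnormal)
    rw [surfaceMeasure, Measure.restrict_apply hWo.measurableSet, inter_comm] at h1
    exact hpos.ne' h1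
  obtain ⟨z, hzW, ν, hν⟩ := hex
  obtain ⟨w, hw⟩ := mem_closure_iff_nhds.1 hν.mem_closure_interior W' (hWo.mem_nhds hzW)
  exact ⟨w, hW' hw.1, hw.2⟩

namespace IsConvexFun

theorem continuousOn_lineMap (hφ : IsConvexFun φ) {x : Rn n} (hx : x ∈ dom φ) {t : ℝ}
    (ht0 : 0 ≤ t) (ht1 : t ≤ 1) :
    ContinuousOn (fun y => (φ (x + t • (y - x))).toReal) (interior (dom φ)) := by
  rcases ht0.eq_or_lt with rfl | ht
  · simpa using continuousOn_const
  · have hc : Continuous fun y => x + t • (y - x) := by fun_prop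
    exact hφ.continuousOn_interior.comp hc.continuousOn fun y hy =>
      hφ.convex_dom.add_smul_sub_mem_interior hx hy ⟨ht, ht1⟩

/-- If `φ` is affine on the segments from `x` to almost every point of an open set, then it is affine
on the segments to all the points of the closure that are interior to the domain. -/
theorem eq_of_ae_eq (hφ : IsConvexFun φ) {x : Rn n} (hx : x ∈ dom φ) {U : Set (Rn n)}
    (hU : IsOpen U) (hUd : U ⊆ interior (dom φ))
    (h : ∀ᵐ y : Rn n, y ∈ U → ∀ t : ℝ, 0 ≤ t → t ≤ 1 →
      (φ (x + t • (y - x))).toReal = (1 - t) * (φ x).toReal + t * (φ y).toReal)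
    {z : Rn n} (hz : z ∈ closure U) (hzd : z ∈ interior (dom φ)) {t : ℝ}
    (ht0 : 0 ≤ t) (ht1 : t ≤ 1) :
    (φ (x + t • (z - x))).toReal = (1 - t) * (φ x).toReal + t * (φ z).toReal := by
  have h1 := hφ.continuousOn_lineMap hx ht0 ht1
  have h2 : ContinuousOn (fun y => (1 - t) * (φ x).toReal + t * (φ y).toReal)
      (interior (dom φ)) := continuousOn_const.add (continuousOn_const.mul hφ.continuousOn_interior)
  have h3 : EqOn (fun y => (φ (x + t • (y - x))).toReal)
      (fun y => (1 - t) * (φ x).toReal + t * (φ y).toReal) U := by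
    refine Measure.eqOn_open_of_ae_eq (μ := volume) ?_ hU (h1.mono hUd) (h2.mono hUd)
    refine (ae_restrict_iff' hU.measurableSet).2 (h.mono fun y hy hyU => hy hyU t ht0 ht1)
  have : (𝓝[U] z).NeBot := mem_closure_iff_nhdsWithin_neBot.1 hz
  have h4 := (h1 z hzd).mono hUd
  have h5 := (h2 z hzd).mono hUd
  exact tendsto_nhds_unique (h4.congr' (eventually_nhdsWithin_of_forall h3)) h5

/-- For `z` on the boundary of the domain, approach it along `[z, p]`. On the moving segments
convexity bounds `φ` above by values tending to `φ w`, and lower semicontinuity bounds `φ` below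
near `z`. -/
theorem eq_of_lowerSemicontinuousAt (hφ : IsConvexFun φ) {x z p : Rn n} (hx : x ∈ dom φ)
    (hz : z ∈ dom φ) (hzl : LowerSemicontinuousAt φ z) (hp : p ∈ dom φ) {t : ℝ}
    (ht0 : 0 ≤ t) (ht1 : t ≤ 1)
    (h : ∀ s : ℝ, 0 < s → s < 1 → (φ (x + t • (z + s • (p - z) - x))).toReal =
      (1 - t) * (φ x).toReal + t * (φ (z + s • (p - z))).toReal) :
    (φ (x + t • (z - x))).toReal = (1 - t) * (φ x).toReal + t * (φ z).toReal := by
  have hmem : ∀ {u v : Rn n}, u ∈ dom φ → v ∈ dom φ → ∀ {s : ℝ}, 0 ≤ s → s ≤ 1 →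
      u + s • (v - u) ∈ dom φ ∧ (φ (u + s • (v - u))).toReal ≤
        (1 - s) * (φ u).toReal + s * (φ v).toReal := by
    intro u v hu hv s hs0 hs1
    have heq : u + s • (v - u) = (1 - s) • u + s • v := by module
    rw [heq]
    exact ⟨hφ.convex_dom hu hv (by linarith) hs0 (by ring),
      hφ.convexOn.2 hu hv (by linarith) hs0 (by ring)⟩
  refine le_antisymm (hmem hx hz ht0 ht1).2 ?_
  rcases ht0.eq_or_lt with rfl | ht
  · simp
  have hwd := (hmem hx hz ht0 ht1).1
  have hqd := (hmem hx hp ht0 ht1).1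
  by_contra! hcon
  set w := x + t • (z - x) with hw
  set q := x + t • (p - x) with hq
  -- The value at `z` for which `φ w` would fit the affine formula; a strict inequality at `w` means
  -- `c < φ z`, which leaves room for `c'`.
  set c := ((φ w).toReal - (1 - t) * (φ x).toReal) / t with hc
  have hct : t * c = (φ w).toReal - (1 - t) * (φ x).toReal := mul_div_cancel₀ _ ht.ne'
  have hcz : c < (φ z).toReal := by
    rw [hc, div_lt_iff₀ ht]; linarith
  obtain ⟨c', hcc', hc'z⟩ := exists_between hcz
  have hev : ∀ᶠ y in 𝓝 z, (c' : EReal) < φ y := hzl _ (by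
    change (c' : EReal) < φ z
    rw [← hφ.coe_toReal hz]; exact EReal.coe_lt_coe_iff.2 hc'z)
  have hlim : Tendsto (fun s : ℝ => z + s • (p - z)) (𝓝[>] 0) (𝓝 z) := by
    have h1 : Tendsto (fun s : ℝ => z + s • (p - z)) (𝓝 0) (𝓝 (z + (0 : ℝ) • (p - z))) :=
      (show Continuous fun s : ℝ => z + s • (p - z) by fun_prop).tendsto 0
    rw [zero_smul, add_zero] at h1
    exact h1.mono_left nhdsWithin_le_nhds
  have hlim2 : Tendsto (fun s : ℝ => (1 - s) * (φ w).toReal + s * (φ q).toReal) (𝓝[>] 0)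
      (𝓝 (φ w).toReal) := by
    have h1 : Tendsto (fun s : ℝ => (1 - s) * (φ w).toReal + s * (φ q).toReal) (𝓝 0)
        (𝓝 ((1 - 0) * (φ w).toReal + 0 * (φ q).toReal)) :=
      (show Continuous fun s : ℝ => (1 - s) * (φ w).toReal + s * (φ q).toReal by
        fun_prop).tendsto 0
    rw [sub_zero, one_mul, zero_mul, add_zero] at h1
    exact h1.mono_left nhdsWithin_le_nhds
  have hfin : (1 - t) * (φ x).toReal + t * c' ≤ (φ w).toReal := by
    refine ge_of_tendsto hlim2 ?_
    filter_upwards [hlim.eventually hev, self_mem_nhdsWithin,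
      (gt_mem_nhds one_pos).filter_mono (nhdsWithin_le_nhds (s := Ioi (0 : ℝ)))] with s hs hs0 hs1
    have hs0 : 0 < s := hs0
    have hyd := (hmem hz hp hs0.le hs1.le).1
    rw [← hφ.coe_toReal hyd, EReal.coe_lt_coe_iff] at hs
    have h1 := h s hs0 hs1
    have heq : x + t • (z + s • (p - z) - x) = w + s • (q - w) := by rw [hw, hq]; module
    rw [heq] at h1
    have h2 := (hmem hwd hqd hs0.le hs1.le).2
    have h3 : t * c' ≤ t * (φ (z + s • (p - z))).toReal := mul_le_mul_of_nonneg_left hs.le ht.le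
    linarith
  have : t * c < t * c' := mul_lt_mul_of_pos_left hcc' ht
  linarith

theorem isAffineOnSegment (hφ : IsConvexFun φ) {x z : Rn n} (hx : x ∈ dom φ) (hz : z ∈ dom φ)
    (h : ∀ t : ℝ, 0 ≤ t → t ≤ 1 →
      (φ (x + t • (z - x))).toReal = (1 - t) * (φ x).toReal + t * (φ z).toReal) :
    IsAffineOnSegment φ x z := by
  intro a b ha hb hab
  have h1 := h b hb (by linarith)
  have heq : x + b • (z - x) = a • x + b • z := by
    rw [← eq_sub_iff_add_eq] at hab
    rw [hab]; module
  rw [heq, show 1 - b = a by linarith] at h1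
  rw [← hφ.coe_toReal (hφ.convex_dom hx hz ha hb hab), h1, ← hφ.coe_toReal hx,
    ← hφ.coe_toReal hz]
  simp only [EReal.toReal_coe]
  push_cast
  rfl

end IsConvexFun

theorem isAffineOnSegment_of_ae [Nontrivial (Rn n)] (hφ : IsConvexFun φ)
    (hS : IsHypersurface (frontier A))
    (hnormal : ∀ᵐ y ∂(surfaceMeasure (frontier A)), ∃ ν, IsExteriorNormal A y ν)
    {x : Rn n} (hx : x ∈ dom φ)
    (h : ∀ᵐ y : Rn n, y ∈ interior A ∩ interior (dom φ) → ∀ t : ℝ, 0 ≤ t → t ≤ 1 →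
      (φ (x + t • (y - x))).toReal = (1 - t) * (φ x).toReal + t * (φ y).toReal)
    {z : Rn n} (hz : z ∈ A ∩ dom φ) (hzl : LowerSemicontinuousAt φ z)
    (hzp : z ∈ interior (dom φ) ∨
      ∃ p : Rn n, openSegment ℝ z p ⊆ interior A ∩ interior (dom φ)) :
    IsAffineOnSegment φ x z := by
  have hU : IsOpen (interior A ∩ interior (dom φ)) := isOpen_interior.inter isOpen_interior
  refine hφ.isAffineOnSegment hx hz.2 fun t ht0 ht1 => ?_
  rcases hzp with hzd | ⟨p, hp⟩
  · refine hφ.eq_of_ae_eq hx hU inter_subset_right h ?_ hzd ht0 ht1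
    have hzA : z ∈ closure (interior A) := by
      by_cases hzi : z ∈ interior A
      · exact subset_closure hzi
      · exact frontier_subset_closure_interior hS hnormal ⟨subset_closure hz.1, hzi⟩
    rw [inter_comm]
    exact isOpen_interior.inter_closure ⟨hzd, hzA⟩
  · have hmem : ∀ s : ℝ, 0 < s → s < 1 →
        z + s • (p - z) ∈ interior A ∩ interior (dom φ) := by
      intro s hs0 hs1
      refine hp ⟨1 - s, s, by linarith, hs0, by ring, by module⟩
    -- The endpoint `p` need not lie in the domain; the midpoint of `z` and `p` does and replaces
    -- it.
    have hpd := hmem (1 / 2) (by norm_num) (by norm_num)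
    refine hφ.eq_of_lowerSemicontinuousAt hx hz.2 hzl (interior_subset hpd.2) ht0 ht1
      fun s hs0 hs1 => ?_
    have heq : z + s • (z + (1 / 2 : ℝ) • (p - z) - z) = z + (s / 2) • (p - z) := by module
    rw [heq]
    have hs := hmem (s / 2) (by linarith) (by linarith)
    exact hφ.eq_of_ae_eq hx hU inter_subset_right h (subset_closure hs) hs.2 ht0 ht1

end EqualityCase

end FunctionalMahler

open FunctionalMahler in
theorem mainTheorem3 (n : ℕ) (hn : 1 ≤ n) (φ : Rn n → EReal) (hφ : IsConvexFun φ)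
    (hpos : 0 < ∫⁻ x, EReal.exp (-φ x)) (hfin : ∫⁻ x, EReal.exp (-φ x) < ⊤)
    (A : Set (Rn n)) (hA : MeasurableSet A) (hμA : 0 < expMeasure φ A)
    (hS : IsHypersurface (frontier A))
    (hnormal : ∀ᵐ y ∂(surfaceMeasure (frontier A)), ∃ ν, IsExteriorNormal A y ν)
    (hV : Integrable (fun y => expNeg φ y • exteriorNormal A y) (surfaceMeasure (frontier A)))
    (hQ : Integrable (fun y => ⟪y, exteriorNormal A y⟫ * expNeg φ y)
      (surfaceMeasure (frontier A))) :
    IntegrableOn (fun y => (φ y).toReal) A (expMeasure φ) ∧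
    (∀ x : Rn n, ((⟪x, slope φ A⟫ : ℝ) : EReal) - φ x ≤ (upperBound φ A : EReal)) ∧
    legendre φ (slope φ A) ≤ (upperBound φ A : EReal) ∧
    ∀ x₀ : Rn n, ((⟪x₀, slope φ A⟫ : ℝ) : EReal) - φ x₀ = (upperBound φ A : EReal) →
      x₀ ∈ dom φ ∧
      ∀ z ∈ A ∩ dom φ, LowerSemicontinuousAt φ z →
        (z ∈ interior (dom φ) ∨
          ∃ p : Rn n, openSegment ℝ z p ⊆ interior A ∩ interior (dom φ)) →
        IsAffineOnSegment φ x₀ z := by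
  have hne : Nontrivial (Rn n) := Module.nontrivial_of_finrank_pos (R := ℝ) (by
    rw [finrank_euclideanSpace_fin]; exact hn)
  have hdom : ∀ x ∈ dom φ, ((⟪x, slope φ A⟫ : ℝ) : EReal) - φ x =
      ((⟪x, slope φ A⟫ - (φ x).toReal : ℝ) : EReal) := fun x hx => by
    rw [EReal.coe_sub, hφ.coe_toReal hx]
  have hbot : ∀ x ∉ dom φ, ((⟪x, slope φ A⟫ : ℝ) : EReal) - φ x = ⊥ := fun x hx => by
    rw [notMem_dom.1 hx, EReal.sub_top]
  have hle : ∀ x : Rn n, ((⟪x, slope φ A⟫ : ℝ) : EReal) - φ x ≤ (upperBound φ A : EReal) := by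
    intro x
    by_cases hx : x ∈ dom φ
    · rw [hdom x hx, EReal.coe_le_coe_iff]
      exact (inner_slope_sub_le hφ hpos hfin hA hμA hnormal hV hQ hx).1
    · rw [hbot x hx]
      exact bot_le
  refine ⟨hφ.integrableOn_expMeasure hpos hfin A, hle, iSup_le hle, fun x hx => ?_⟩
  have hxd : x ∈ dom φ := by
    by_contra hxd
    rw [hbot x hxd] at hx
    exact EReal.bot_ne_coe _ hx
  rw [hdom x hxd, EReal.coe_eq_coe_iff] at hx
  have hae := (inner_slope_sub_le hφ hpos hfin hA hμA hnormal hV hQ hxd).2 hx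
  exact ⟨hxd, fun z hz hzl hzp => isAffineOnSegment_of_ae hφ hS hnormal hxd hae hz hzl hzp⟩
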